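/- **Setting.** Let $d\ge 0$, and use the parabolic scaling $\mathfrak s=(2,1,\dots,1)$ on $\mathbb R^{d+1}$ (coordinate $0$ is time): $|\mathfrak s|=d+2$, $\|z\|_{\mathfrak s}=\sup_i|z_i|^{1/\mathfrak s_i}$, $|k|_{\mathfrak s}=\sum_i\mathfrak s_ik_i$. For $N\ge 0$ let $\mathbb T^d_N=2^{-N}(\mathbb Z/2^N\mathbb Z)^d$. The representative in $(-\tfrac12,\tfrac12]^d$ of the spatial part is used when a monomial $z^j$, a norm $\|z\|_{\mathfrak s}$ or a test function is evaluated at $z\in\mathbb R\times\mathbb T^d_N$. Integration over $\mathbb R\times\mathbb T_N^d$ is $2^{-dN}\sum_x\int dt$. *Graphs.* $\mathbb G=(\mathbb V,\mathbb E)$ is a finite directed multigraph without self-loops; each edge $e=(e_-,e_+)$ has a label $(a_e,r_e,v_e)\in\mathbb R\times\mathbb N\times\mathbb V$. There are a distinguished vertex $0$, $M\ge1$ distinct vertices $v_{\star,1},\dots,v_{\star,M}\neq0$, and for each $i$ a distinguished edge $e_{\star,i}$ from $0$ to $v_{\star,i}$ with label $(0,0,0)$. Put $\mathbb V_0=\mathbb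 V\setminus\{0\}$ and $\mathbb V_\star=\{0,v_{\star,1},\dots,v_{\star,M}\}$. If $r_e>0$, assume $v_e\ne e_-$ and $a_e\ge0$. For $S\subset\mathbb V$ let $\mathbb E_0(S)$, $\mathbb E^\uparrow(S)$, $\mathbb E^\downarrow(S)$ be the sets of edges with both endpoints in $S$, with only $e_-$ in $S$, and with only $e_+$ in $S$; parallel edges are counted with multiplicity. *Power counting.* Assume that for every $S\subset\mathbb V$ with $|S|\ge2$ $$\sum_{e\in\mathbb E_0(S)}a_e+\sum_{e\in\mathbb E^\uparrow(S),\,r_e>0}\mathbf 1_{v_e\in S}(a_e+r_e-1)-\sum_{e\in\mathbb E^\downarrow(S)}\mathbf 1_{v_e\in S}\,r_e<(|S|-1)|\mathfrak s|,$$ and that for every non-empty $S\subset\mathbb V\setminus\mathbb V_\star$ $$\sum_{e\in\mathbb E_0(S)}a_e+\sum_{e\in\mathbb E^\downarrow(S)}\bigl(\mathbf 1_{v_e\in S\text{ or }r_e=0}(a_e+r_e-1)-(r_e-1)\bigr)+\sum_{e\in\mathbb E^\uparrow(S)}\bigl(a_e+r_e-\mathbf 1_{v_e\in S}r_e\bigr)>|S||\mathfrak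 s|.$$ *Kernels.* A kernel of order $a$ and level $q$ on $\mathbb R\times\mathbb T_N^d$ is a function $K$ with $K(z)=\sum_{0\le n\le q}K^{(n)}(z)$ for $z\neq0$, where for $n<q$ the function $K^{(n)}$ is the restriction of a smooth function on $\mathbb R\times\mathbb T^d$ supported in $2^{-(n+2)}\le\|z\|_{\mathfrak s}\le2^{-n}$, $K^{(q)}$ is a measurable function on $\mathbb R\times\mathbb T^d_N$ supported in $\|z\|_{\mathfrak s}\le2^{-q}$, and for every $p$ there is $C$ with $2^{-(a+|k|_{\mathfrak s})n}|D^kK^{(n)}|\le C$ for $|k|\le p$, $n<q$, and $2^{-aq}|K^{(q)}|\le C$; the least such $C$ is $\|K\|_{a;p}$. Put $D^0K=K$ and $D^jK=\sum_{n<q}D^jK^{(n)}$ for $j\ne0$. Given kernels $K_e$ of order $a_e$, let $$\hat K_e(z_{e_-},z_{e_+})=K_e(z_{e_+}-z_{e_-})-\sum_{|j|_{\mathfrak s}<r_e}\frac{(z_{e_+}-z_{v_e})^j}{j!}D^jK_e(z_{v_e}-z_{e_-}).$$ *Generalised convolution.* For kernels of level $N$, $\varphi\in C_c^\infty(\mathbb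 R^{d+1})$ and $\varphi_{\lambda,\mu}(t,x)=\lambda^{-d}\mu^{-2}\varphi(t/\mu^2,x/\lambda)$, let, with $z_0=0$, $$\mathcal I^{\mathbb G}(\varphi_{\lambda,\mu},K)=\int_{(\mathbb R\times\mathbb T_N^d)^{\mathbb V_0}}\prod_{e\in\mathbb E}\hat K_e(z_{e_-},z_{e_+})\prod_{i=1}^M\varphi_{\lambda,\mu}(z_{v_{\star,i}})\,dz .$$ *Multiscale form.* Let $\psi:\mathbb R\to[0,1]$ be smooth, supported in $[3/8,1]$, with $\sum_{n\in\mathbb Z}\psi(2^nx)=1$ for $x>0$; let $\Psi^{(n)}(z)=\psi(2^n\|z\|_{\mathfrak s})$ and $L=\lceil|\log_2\mu|\rceil$. Let $K_e$ be a kernel of order $a_e$, of level $\max(N,L)$ if $e$ is distinguished and of level $N$ otherwise. The localised kernel $\hat K_e^{(k,p,m)}$ is defined as follows. For distinguished $e$ it is $\Psi^{(k)}(z_{e_+}-z_{e_-})K_e^{(k)}(z_{e_+}-z_{e_-})$ if $p=m=0$, and $0$ otherwise. For other $e$ with $r_e=0$ it is $K_e^{(k)}(z_{e_+}-z_{e_-})$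 if $p=m=0$, and $0$ otherwise. For $r_e>0$ it is $\Psi^{(k)}(z_{e_+}-z_{e_-})\Psi^{(p)}(z_{v_e}-z_{e_-})\Psi^{(m)}(z_{e_+}-z_{v_e})\hat K_e(z_{e_-},z_{e_+})$ if $k,p,m<N$, it is $\Psi^{(N)}(z_{e_+}-z_{e_-})K_e(z_{e_+}-z_{e_-})$ if $(k,p,m)=(N,0,0)$, and $0$ otherwise. Let $\mathcal N_{\lambda,\mu}$ be the set of maps $\mathbf n:\mathbb E\to\mathbb N^3$ with $\mathbf n(e)\in\{0,\dots,L\}^3$ and $2^{-|\mathbf n(e)|}\le\mu$ for distinguished $e$, and $\mathbf n(e)\in\{0,\dots,N\}^3$ for the others, where $|(k,p,m)|=k+p+m$. Let $$\mathcal I^{\mathbb G}_{\lambda,\mu}(K)=\sum_{\mathbf n\in\mathcal N_{\lambda,\mu}}\int_{(\mathbb R\times\mathbb T^d_N)^{\mathbb V_0}}\prod_{e\in\mathbb E}\hat K_e^{(\mathbf n(e))}(z_{e_-},z_{e_+})\,dz .$$ **Theorem.** Let $\tilde\alpha=|\mathfrak s||\mathbb V\setminus\mathbb V_\star|-\sum_{e\in\mathbb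 E}a_e$ and $\alpha=|\mathfrak s||\mathbb V_0|-\sum_{e\in\mathbb E}a_e$. There is an integer $p$ depending only on $d$ and the labelled graph such that the following holds for all $N\ge0$ and all $\lambda,\mu>0$ with $2^{-N}\le\lambda=\mu\le1$ or $\mu<2^{-N}=\lambda$. 1. For every $\rho>0$ there is $C$, depending only on $d$, the labelled graph and $\rho$, such that for all kernels $K_e$ as above (of level $N$) and all $\varphi\in C^\infty_c$ supported in $\{\|z\|_{\mathfrak s}\le\rho\}$ the integrand of $\mathcal I^{\mathbb G}(\varphi_{\lambda,\mu},K)$ is integrable and $$|\mathcal I^{\mathbb G}(\varphi_{\lambda,\mu},K)|\le C\lambda^{\tilde\alpha}\,\|\varphi\|_\infty^M\prod_{e\in\mathbb E}\|K_e\|_{a_e;p}.$$ 2. There is $C$, depending only on $d$ and the labelled graph, such that for all $\psi$ and all kernels as in the multiscale form every integrand in $\mathcal I^{\mathbb G}_{\lambda,\mu}(K)$ is integrable, and $|\mathcal I^{\mathbb G}_{\lambda,\mu}(K)|\le C\lambda^\alpha(\mu^2 2^{2N})^M\prod_{e}\|K_e\|_{a_e;p}$ if $\mu<2^{-N}=\lambda$,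 while $|\mathcal I^{\mathbb G}_{\lambda,\mu}(K)|\le C\lambda^\alpha\prod_{e}\|K_e\|_{a_e;p}$ if $\lambda=\mu$. -/

import Mathlib

open scoped BigOperators ContDiff

noncomputable section

namespace GenConv

/-! ### Parabolic space-time -/

/-- The parabolic scaling `(2, 1, …, 1)` on `ℝ^{d+1}`; coordinate `0` is time. -/
def scaling {d : ℕ} (i : Fin (d + 1)) : ℕ := if i = 0 then 2 else 1

/-- The size `|𝔰| = d + 2` of the scaling. -/
def scalingSize (d : ℕ) : ℕ := ∑ i : Fin (d + 1), scaling i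

/-- The scaled norm `sup_i |z_i|^{1/𝔰_i}`. -/
def scaledNorm {d : ℕ} (z : Fin (d + 1) → ℝ) : ℝ :=
  ⨆ i, |z i| ^ (1 / (scaling i : ℝ))

/-- The scaled degree `|j|_𝔰` of a multi-index. -/
def scaledDegree {d : ℕ} (j : Fin (d + 1) → ℕ) : ℕ := ∑ i, scaling i * j i

/-- The partial derivative `D^j f` on `ℝ^{d+1}`. -/
def partialDeriv {d : ℕ} (j : Fin (d + 1) → ℕ) (f : (Fin (d + 1) → ℝ) → ℝ) :
    (Fin (d + 1) → ℝ) → ℝ :=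
  (List.finRange (d + 1)).foldr
    (fun i g => (fun h : (Fin (d + 1) → ℝ) → ℝ => fun z => fderiv ℝ h z (Pi.single i 1))^[j i] g) f

/-- `ℝ × 𝕋_N^d`, where the torus `𝕋_N^d = 2^{-N} (ℤ / 2^N ℤ)^d` is represented by
`(ℤ / 2^N ℤ)^d`. -/
abbrev SpaceTime (d N : ℕ) : Type := ℝ × (Fin d → ZMod (2 ^ N))

/-- The real coordinates of a point of `ℝ × 𝕋_N^d`; the spatial ones are the representatives
in `(-1/2, 1/2]`. -/
def coord {d N : ℕ} (z : SpaceTime d N) : Fin (d + 1) → ℝ :=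
  Fin.cons z.1 (fun i => ((z.2 i).valMinAbs : ℝ) / 2 ^ N)

/-- Reduction of the spatial coordinates modulo `1`, to the representatives of least modulus. -/
def torusRep {d : ℕ} (z : Fin (d + 1) → ℝ) : Fin (d + 1) → ℝ :=
  Fin.cons (z 0) (fun i => z i.succ - (round (z i.succ) : ℝ))

/-- The monomial `h^j`. -/
def monomial {d : ℕ} (h : Fin (d + 1) → ℝ) (j : Fin (d + 1) → ℕ) : ℝ := ∏ i, h i ^ j i

/-- The finite set of multi-indices with `|j|_𝔰 < r`. -/
def lowIndices (d r : ℕ) : Finset (Fin (d + 1) → ℕ) :=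
  (Fintype.piFinset fun _ => Finset.range r).filter fun j => scaledDegree j < r

/-! ### Kernels -/

/-- A kernel on `ℝ × 𝕋_N^d` with a dyadic decomposition down to the scale `2^{-q}`.
The pieces of index `n < q` are (restrictions of) smooth functions on `ℝ × 𝕋^d`, that is, smooth
functions on `ℝ^{d+1}` of period `1` in space, supported in dyadic annuli; the piece of index `q`
is only a function on `ℝ × 𝕋_N^d`, supported in the ball of radius `2^{-q}`. -/
structure Kernel (d N q : ℕ) where
  toFun : SpaceTime d N → ℝ
  piece : ℕ → (Fin (d + 1) → ℝ) → ℝ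
  last : SpaceTime d N → ℝ
  sum_eq : ∀ z, z ≠ 0 → toFun z = (∑ n ∈ Finset.range q, piece n (coord z)) + last z
  smooth : ∀ n < q, ContDiff ℝ ∞ (piece n)
  periodic : ∀ n < q, ∀ i : Fin d, Function.Periodic (piece n) (Pi.single i.succ 1)
  piece_support : ∀ n < q, ∀ z, piece n z ≠ 0 →
    ((2 : ℝ) ^ (n + 2))⁻¹ ≤ scaledNorm (torusRep z) ∧ scaledNorm (torusRep z) ≤ ((2 : ℝ) ^ n)⁻¹
  last_support : ∀ z, last z ≠ 0 → scaledNorm (coord z) ≤ ((2 : ℝ) ^ q)⁻¹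
  last_measurable : ∀ x, Measurable fun t => last (t, x)

namespace Kernel

variable {d N q : ℕ}

/-- The bounds of order `p`, with constant `C`, on the pieces of a kernel with singularity of
order `a`. -/
def HasBound (K : Kernel d N q) (a : ℝ) (p : ℕ) (C : ℝ) : Prop :=
  (∀ n < q, ∀ j : Fin (d + 1) → ℕ, ∑ i, j i ≤ p → ∀ z,
    (2 : ℝ) ^ (-((a + scaledDegree j) * n)) * |partialDeriv j (K.piece n) z| ≤ C) ∧
  ∀ z, (2 : ℝ) ^ (-(a * q)) * |K.last z| ≤ C

/-- The kernel has a singularity of order `a`: for every `p` the bounds hold with some `C`. -/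
def HasOrder (K : Kernel d N q) (a : ℝ) : Prop := ∀ p, ∃ C, K.HasBound a p C

/-- The norm `‖K‖_{a;p}`: the least constant in the bounds of order `p`. -/
def norm (K : Kernel d N q) (a : ℝ) (p : ℕ) : ℝ := sInf {C | K.HasBound a p C}

/-- The piece `K^{(k)}` as a function on `ℝ × 𝕋_N^d`, for `0 ≤ k ≤ q`. -/
def scale (K : Kernel d N q) (k : ℕ) (z : SpaceTime d N) : ℝ :=
  if k < q then K.piece k (coord z) else if k = q then K.last z else 0

/-- `D^j K`. The piece of the finest scale, which need not be differentiable, enters for `j = 0`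
only. -/
def deriv (K : Kernel d N q) (j : Fin (d + 1) → ℕ) (z : SpaceTime d N) : ℝ :=
  if j = 0 then K.toFun z else ∑ n ∈ Finset.range q, partialDeriv j (K.piece n) (coord z)

/-- The kernel `K(z₊ - z₋) - ∑_{|j|_𝔰 < r} (z₊ - z_v)^j / j! D^j K(z_v - z₋)`, recentred at `z_v`. -/
def recentred (K : Kernel d N q) (r : ℕ) (zm zp zv : SpaceTime d N) : ℝ :=
  K.toFun (zp - zm) -
    ∑ j ∈ lowIndices d r,
      monomial (coord (zp - zv)) j / ((∏ i, (j i).factorial : ℕ) : ℝ) * K.deriv j (zv - zm)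

end Kernel

/-! ### Labelled graphs -/

/-- A finite directed multigraph without self-loops, with vertex set `V` and edge set `E`, edge
labels `(a_e, r_e, v_e)`, a distinguished vertex `0`, and `M` distinguished edges that connect it
to `M` distinct vertices and carry the label `(0, 0, 0)`. -/
structure LabelledGraph (V E : Type*) (M : ℕ) where
  src : E → V
  tgt : E → V
  a : E → ℝ
  r : E → ℕ
  base : E → V
  src_ne_tgt : ∀ e, src e ≠ tgt e
  origin : V
  star : Fin M → V
  star_injective : Function.Injective star
  star_ne_origin : ∀ i, star i ≠ origin
  starEdge : Fin M → E
  starEdge_src : ∀ i, src (starEdge i) = origin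
  starEdge_tgt : ∀ i, tgt (starEdge i) = star i
  starEdge_a : ∀ i, a (starEdge i) = 0
  starEdge_r : ∀ i, r (starEdge i) = 0
  starEdge_base : ∀ i, base (starEdge i) = origin

namespace LabelledGraph

variable {V E : Type*} [Fintype V] [DecidableEq V] [Fintype E] [DecidableEq E] {M : ℕ}

/-- `𝕍_⋆`, the distinguished vertices, `0` included. -/
def starVertices (G : LabelledGraph V E M) : Finset V :=
  insert G.origin (Finset.univ.image G.star)

/-- `𝔼_0(S)`: both endpoints in `S`. -/
def innerEdges (G : LabelledGraph V E M) (S : Finset V) : Finset E :=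
  Finset.univ.filter fun e => G.src e ∈ S ∧ G.tgt e ∈ S

/-- `𝔼^↑(S)`: the edges that leave `S`. -/
def outEdges (G : LabelledGraph V E M) (S : Finset V) : Finset E :=
  Finset.univ.filter fun e => G.src e ∈ S ∧ G.tgt e ∉ S

/-- `𝔼^↓(S)`: the edges that enter `S`. -/
def inEdges (G : LabelledGraph V E M) (S : Finset V) : Finset E :=
  Finset.univ.filter fun e => G.src e ∉ S ∧ G.tgt e ∈ S

/-- The power-counting conditions. Parallel edges are counted with multiplicity. -/
def PowerCounting (G : LabelledGraph V E M) (d : ℕ) : Prop :=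
  (∀ S : Finset V, 2 ≤ S.card →
    (∑ e ∈ G.innerEdges S, G.a e)
      + (∑ e ∈ (G.outEdges S).filter (fun e => 0 < G.r e),
          if G.base e ∈ S then G.a e + G.r e - 1 else 0)
      - (∑ e ∈ G.inEdges S, if G.base e ∈ S then (G.r e : ℝ) else 0)
    < ((S.card : ℝ) - 1) * scalingSize d) ∧
  (∀ S : Finset V, S.Nonempty → Disjoint S G.starVertices →
    (S.card : ℝ) * scalingSize d <
      (∑ e ∈ G.innerEdges S, G.a e)
      + (∑ e ∈ G.inEdges S,
          ((if G.base e ∈ S ∨ G.r e = 0 then G.a e + G.r e - 1 else 0) - ((G.r e : ℝ) - 1)))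
      + (∑ e ∈ G.outEdges S,
          ((G.a e + G.r e) - if G.base e ∈ S then (G.r e : ℝ) else 0)))

/-- `α̃ = |𝔰| |𝕍 ∖ 𝕍_⋆| - ∑_e a_e`. -/
def alphaTilde (G : LabelledGraph V E M) (d : ℕ) : ℝ :=
  (scalingSize d : ℝ) * ((Finset.univ \ G.starVertices).card : ℝ) - ∑ e, G.a e

/-- `α = |𝔰| |𝕍_0| - ∑_e a_e`, where `𝕍_0 = 𝕍 ∖ {0}`. -/
def alpha (G : LabelledGraph V E M) (d : ℕ) : ℝ :=
  (scalingSize d : ℝ) * ((Finset.univ.erase G.origin).card : ℝ) - ∑ e, G.a e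

/-- The points attached to all vertices, when the vertex `0` sits at the origin and the other
ones have times `t` and positions `x`. -/
def place {d N : ℕ} (G : LabelledGraph V E M) (t : {v // v ≠ G.origin} → ℝ)
    (x : {v // v ≠ G.origin} → Fin d → ZMod (2 ^ N)) (v : V) : SpaceTime d N :=
  if h : v ≠ G.origin then (t ⟨v, h⟩, x ⟨v, h⟩) else 0

/-- Integrability over `(ℝ × 𝕋_N^d)^{𝕍_0}`. -/
def IntegrableConfig {d N : ℕ} (G : LabelledGraph V E M)
    (F : (V → SpaceTime d N) → ℝ) : Prop :=
  ∀ x : {v // v ≠ G.origin} → Fin d → ZMod (2 ^ N),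
    MeasureTheory.Integrable fun t : {v // v ≠ G.origin} → ℝ => F (G.place t x)

/-- The integral over `(ℝ × 𝕋_N^d)^{𝕍_0}`: Lebesgue measure in time, and counting measure
with weight `2^{-dN}` on `𝕋_N^d`. -/
def integralConfig {d N : ℕ} (G : LabelledGraph V E M)
    (F : (V → SpaceTime d N) → ℝ) : ℝ :=
  (((2 : ℝ) ^ (d * N))⁻¹) ^ (Fintype.card {v // v ≠ G.origin}) *
    ∑ x : {v // v ≠ G.origin} → Fin d → ZMod (2 ^ N),
      ∫ t : {v // v ≠ G.origin} → ℝ, F (G.place t x)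

end LabelledGraph

/-! ### The generalised convolution -/

/-- `φ_{λ,μ}(t, x) = λ^{-d} μ^{-2} φ(t / μ², x / λ)`. -/
def rescaled {d N : ℕ} (φ : (Fin (d + 1) → ℝ) → ℝ) (lam mu : ℝ) (z : SpaceTime d N) : ℝ :=
  (lam ^ d)⁻¹ * (mu ^ 2)⁻¹ *
    φ (Fin.cons (coord z 0 / mu ^ 2) fun i => coord z i.succ / lam)

namespace LabelledGraph

variable {V E : Type*} [Fintype V] [DecidableEq V] [Fintype E] [DecidableEq E] {M : ℕ}

/-- The integrand of the generalised convolution. -/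
def integrand {d N : ℕ} (G : LabelledGraph V E M) (K : E → Kernel d N N)
    (φ : (Fin (d + 1) → ℝ) → ℝ) (lam mu : ℝ) (z : V → SpaceTime d N) : ℝ :=
  (∏ e, (K e).recentred (G.r e) (z (G.src e)) (z (G.tgt e)) (z (G.base e))) *
    ∏ i, rescaled φ lam mu (z (G.star i))

/-- The generalised convolution `𝓘^𝔾(φ_{λ,μ}, K)`. -/
def genConv {d N : ℕ} (G : LabelledGraph V E M) (K : E → Kernel d N N)
    (φ : (Fin (d + 1) → ℝ) → ℝ) (lam mu : ℝ) : ℝ :=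
  G.integralConfig (G.integrand K φ lam mu)

/-! ### Its multiscale form -/

/-- `⌈|log₂ μ|⌉`. -/
def logScale (mu : ℝ) : ℕ := ⌈|Real.logb 2 mu|⌉₊

/-- The finest scale in the decomposition of the kernel of an edge: `N`, except that the kernels
of the distinguished edges (which stand for test functions) are decomposed at least down to
`⌈|log₂ μ|⌉`. -/
def level (G : LabelledGraph V E M) (N : ℕ) (mu : ℝ) (e : E) : ℕ :=
  if e ∈ Finset.univ.image G.starEdge then max N (logScale mu) else N

/-- A smooth dyadic partition of unity on `(0, ∞)` generated by `ψ`. -/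
def IsDyadicCutoff (ψ : ℝ → ℝ) : Prop :=
  ContDiff ℝ ∞ ψ ∧ (∀ x, 0 ≤ ψ x ∧ ψ x ≤ 1) ∧ (∀ x, ψ x ≠ 0 → 3 / 8 ≤ x ∧ x ≤ 1) ∧
    ∀ x, 0 < x → HasSum (fun n : ℤ => ψ (2 ^ n * x)) 1

/-- The cutoff `Ψ^{(n)}(z) = ψ(2^n ‖z‖_𝔰)`. -/
def cutoff {d N : ℕ} (ψ : ℝ → ℝ) (n : ℕ) (z : SpaceTime d N) : ℝ :=
  ψ (2 ^ n * scaledNorm (coord z))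

/-- The localised kernel `K̂_e^{(k,p,m)}`. -/
def localKernel {d N : ℕ} {mu : ℝ} (G : LabelledGraph V E M) (ψ : ℝ → ℝ) (e : E)
    (K : Kernel d N (G.level N mu e)) (n : ℕ × ℕ × ℕ) (zm zp zv : SpaceTime d N) : ℝ :=
  if e ∈ Finset.univ.image G.starEdge then
    if n.2.1 = 0 ∧ n.2.2 = 0 then cutoff ψ n.1 (zp - zm) * K.scale n.1 (zp - zm) else 0
  else if G.r e = 0 then
    if n.2.1 = 0 ∧ n.2.2 = 0 then K.scale n.1 (zp - zm) else 0
  else if n.1 < N ∧ n.2.1 < N ∧ n.2.2 < N then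
    cutoff ψ n.1 (zp - zm) * cutoff ψ n.2.1 (zv - zm) * cutoff ψ n.2.2 (zp - zv) *
      K.recentred (G.r e) zm zp zv
  else if n = (N, 0, 0) then cutoff ψ N (zp - zm) * K.toFun (zp - zm)
  else 0

/-- The set `𝓝_{λ,μ}` of scale assignments: values in `{0, …, N}³`, and in
`{0, …, ⌈|log₂ μ|⌉}³` with `2^{-|n|} ≤ μ` on the distinguished edges. -/
def scaleAssignments (G : LabelledGraph V E M) (N : ℕ) (mu : ℝ) : Finset (E → ℕ × ℕ × ℕ) :=
  open Classical in
  (Fintype.piFinset fun e =>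
    let R := Finset.range
      ((if e ∈ Finset.univ.image G.starEdge then logScale mu else N) + 1)
    R ×ˢ R ×ˢ R).filter fun n =>
      ∀ i, ((2 : ℝ) ^ ((n (G.starEdge i)).1 + (n (G.starEdge i)).2.1
        + (n (G.starEdge i)).2.2))⁻¹ ≤ mu

/-- The integrand `K̂^{(n)}`. -/
def scaleIntegrand {d N : ℕ} {mu : ℝ} (G : LabelledGraph V E M) (ψ : ℝ → ℝ)
    (K : (e : E) → Kernel d N (G.level N mu e)) (n : E → ℕ × ℕ × ℕ)
    (z : V → SpaceTime d N) : ℝ :=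
  ∏ e, G.localKernel ψ e (K e) (n e) (z (G.src e)) (z (G.tgt e)) (z (G.base e))

/-- The multiscale sum `𝓘^𝔾_{λ,μ}(K)`. -/
def multiscale {d N : ℕ} {mu : ℝ} (G : LabelledGraph V E M) (ψ : ℝ → ℝ)
    (K : (e : E) → Kernel d N (G.level N mu e)) : ℝ :=
  ∑ n ∈ G.scaleAssignments N mu, G.integralConfig (G.scaleIntegrand ψ K n)

end LabelledGraph

end GenConv

end

set_option linter.unusedSectionVars false

/-! The integrand is bounded pointwise in absolute value, and the bound is integrated along spanning
trees. The only cancellation used is the one inside a single recentred kernel.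

Fix a configuration and cluster its points by single linkage at the thresholds 2^{-k}, 1 ≤ k ≤ N
(`exists_clustering`). A kernel of order a is at most a constant times 2^{an}, where n counts the
scales at which its endpoints share a cluster. A recentred kernel is controlled by its individual
terms when the base point is near the source, and by a Taylor remainder when the base point is near
the target. In all cases the bound is 2 to the power of the sum over k of `edgeDegree`
(`abs_toFun_le_edgeFactor`, `abs_recentred_le_edgeFactor`). This exponent is additive over scales.
At one scale, its sum over the edges equals the sum over the clusters of the left side of the first
power-counting condition (`sum_setDegree_fibre`), hence is at most |𝔰|(|𝕍| - number of clusters). At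
scales coarser than λ all distinguished vertices lie in the cluster of 0; the second condition,
applied to the complement of that cluster, lowers the bound by α. Since there are finitely many
partitions, both bounds hold with a margin δ at the nontrivial scales (`exists_margin`).

The number |𝕍| - number of clusters is at most the number of edges of length at most 2^{-k} in a
minimal spanning tree. Summation over k (`sum_edgeDegree_scales_le`) bounds the integrand by 2^{-αL}
times the product over the tree edges of 2^{|𝔰|m - δ|m-L|}, where 2^{-m} is the length of the edge
and 2^{-L} is comparable to λ. The second condition also shows that the integrand vanishes unless
the configuration has bounded diameter (`label_eq_of_edges`).

A parabolic ball of radius 2^{-m} has volume of order 2^{-|𝔰|m}, so integrating the vertices one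
after the other costs a convergent sum over m of 2^{-δ|m-L|} each; the total is of order λ^α
(`lintegralConfig_prod_le`). If μ < 2^{-N}, each distinguished vertex is confined to times of order
μ² and gains the factor μ²2^{2N}. The prefactors λ^{-d}μ^{-2} of the test functions then turn α into
α̃. In the multiscale form the sum over scale assignments is taken inside the modulus, edge by edge,
where the cutoffs add up to at most 1. -/

noncomputable section
namespace GenConv

/-! ### Degrees of clusters and the power-counting conditions. -/

namespace LabelledGraph

variable {V E : Type*} [Fintype V] [DecidableEq V] [Fintype E] [DecidableEq E] {M : ℕ}

/-- The contribution of the edge `e` to the degree of the partition of the vertices into the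
fibres of `c`. -/
def edgeDegree (G : LabelledGraph V E M) (c : V → V) (e : E) : ℝ :=
  (if c (G.src e) = c (G.tgt e) then G.a e else 0)
    + (if 0 < G.r e ∧ c (G.src e) = c (G.base e) ∧ c (G.src e) ≠ c (G.tgt e)
        then G.a e + G.r e - 1 else 0)
    - (if 0 < G.r e ∧ c (G.tgt e) = c (G.base e) ∧ c (G.src e) ≠ c (G.tgt e)
        then (G.r e : ℝ) else 0)

/-- The degree of a cluster of vertices. -/
def setDegree (G : LabelledGraph V E M) (S : Finset V) : ℝ :=
  (∑ e ∈ G.innerEdges S, G.a e)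
      + (∑ e ∈ (G.outEdges S).filter (fun e => 0 < G.r e),
          if G.base e ∈ S then G.a e + G.r e - 1 else 0)
      - (∑ e ∈ G.inEdges S, if G.base e ∈ S then (G.r e : ℝ) else 0)

/-- The fibre of `c` above `w`. -/
def fibre (c : V → V) (w : V) : Finset V := Finset.univ.filter fun v => c v = w

theorem setDegree_eq_sum (G : LabelledGraph V E M) (S : Finset V) :
    G.setDegree S = ∑ e, ((if G.src e ∈ S ∧ G.tgt e ∈ S then G.a e else 0)
      + (if (G.src e ∈ S ∧ G.tgt e ∉ S) ∧ 0 < G.r e ∧ G.base e ∈ S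
          then G.a e + G.r e - 1 else 0)
      - (if (G.src e ∉ S ∧ G.tgt e ∈ S) ∧ G.base e ∈ S then (G.r e : ℝ) else 0)) := by
  unfold setDegree innerEdges outEdges inEdges
  rw [Finset.sum_sub_distrib, Finset.sum_add_distrib]
  simp only [Finset.sum_filter, ← ite_and]

/-- Only the cluster of the source or that of the target can see an edge, so for each edge the sum
over clusters has at most one nonzero term of each kind. -/
theorem sum_setDegree_fibre (G : LabelledGraph V E M) (c : V → V) :
    ∑ w, G.setDegree (fibre c w) = ∑ e, G.edgeDegree c e := by
  simp only [setDegree_eq_sum]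
  rw [Finset.sum_comm]
  refine Finset.sum_congr rfl fun e _ => ?_
  unfold edgeDegree fibre
  rw [Finset.sum_sub_distrib, Finset.sum_add_distrib]
  simp only [Finset.mem_filter, Finset.mem_univ, true_and]
  congr 1
  · congr 1
    · rw [Finset.sum_eq_single (c (G.src e))]
      · simp [eq_comm]
      · intro w _ hw; rw [if_neg]; rintro ⟨h, -⟩; exact hw h.symm
      · simp
    · rw [Finset.sum_eq_single (c (G.src e))]
      · grind
      · intro w _ hw; rw [if_neg]; rintro ⟨⟨h, -⟩, -⟩; exact hw h.symm
      · simp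
  · rw [Finset.sum_eq_single (c (G.tgt e))]
    · rcases Nat.eq_zero_or_pos (G.r e) with h | h
      · simp [h]
      · grind
    · intro w _ hw; rw [if_neg]; rintro ⟨⟨-, h⟩, -⟩; exact hw h.symm
    · simp

/-- The first condition does not cover singletons. There no edge is inner, and no outgoing edge
counts because its base point is not its source, so only the nonpositive terms remain. -/
theorem setDegree_le (G : LabelledGraph V E M) {d : ℕ} (hG : G.PowerCounting d)
    (hbase : ∀ e, 0 < G.r e → G.base e ≠ G.src e) (S : Finset V) (hS : S.Nonempty) :
    G.setDegree S ≤ ((S.card : ℝ) - 1) * scalingSize d := by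
  rcases Nat.lt_or_ge S.card 2 with h | h
  · have h1 : S.card = 1 := by have := hS.card_pos; omega
    obtain ⟨v, rfl⟩ := Finset.card_eq_one.1 h1
    rw [setDegree_eq_sum]
    simp only [Finset.card_singleton, Nat.cast_one, sub_self, zero_mul]
    refine Finset.sum_nonpos fun e _ => ?_
    have h1 := G.src_ne_tgt e
    have h2 := hbase e
    simp only [Finset.mem_singleton]
    have h3 : (0 : ℝ) ≤ G.r e := Nat.cast_nonneg _
    rw [if_neg (by grind), if_neg (by grind)]
    split_ifs <;> linarith
  · exact (hG.1 S h).le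

theorem setDegree_empty (G : LabelledGraph V E M) : G.setDegree ∅ = 0 := by
  simp [setDegree_eq_sum]

theorem sum_card_fibre (c : V → V) :
    ∑ w ∈ Finset.univ.image c, (fibre c w).card = Fintype.card V := by
  classical
  rw [← Finset.card_univ]
  exact (Finset.card_eq_sum_card_image c Finset.univ).symm

theorem fibre_nonempty {c : V → V} {w : V} (hw : w ∈ Finset.univ.image c) :
    (fibre c w).Nonempty := by
  obtain ⟨v, -, rfl⟩ := Finset.mem_image.1 hw
  exact ⟨v, by simp [fibre]⟩

theorem sum_edgeDegree_eq (G : LabelledGraph V E M) (c : V → V) :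
    ∑ e, G.edgeDegree c e = ∑ w ∈ Finset.univ.image c, G.setDegree (fibre c w) := by
  rw [← sum_setDegree_fibre]
  symm
  refine Finset.sum_subset (Finset.subset_univ _) fun w _ hw => ?_
  have : fibre c w = ∅ := by
    by_contra h
    obtain ⟨v, hv⟩ := Finset.nonempty_iff_ne_empty.2 h
    apply hw
    simp only [fibre, Finset.mem_filter, Finset.mem_univ, true_and] at hv
    simp [← hv]
  rw [this, setDegree_empty]

theorem sum_edgeDegree_le (G : LabelledGraph V E M) {d : ℕ} (hG : G.PowerCounting d)
    (hbase : ∀ e, 0 < G.r e → G.base e ≠ G.src e) (c : V → V) :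
    ∑ e, G.edgeDegree c e ≤
      ((Fintype.card V : ℝ) - (Finset.univ.image c).card) * scalingSize d := by
  rw [sum_edgeDegree_eq]
  calc _ ≤ ∑ w ∈ Finset.univ.image c, (((fibre c w).card : ℝ) - 1) * scalingSize d :=
        Finset.sum_le_sum fun w hw => G.setDegree_le hG hbase _ (fibre_nonempty hw)
    _ = _ := by
        rw [← Finset.sum_mul, Finset.sum_sub_distrib, ← sum_card_fibre c]
        simp

theorem sum_edgeDegree_lt (G : LabelledGraph V E M) {d : ℕ} (hG : G.PowerCounting d)
    (hbase : ∀ e, 0 < G.r e → G.base e ≠ G.src e) (c : V → V)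
    (hc : ¬ Function.Injective c) :
    ∑ e, G.edgeDegree c e <
      ((Fintype.card V : ℝ) - (Finset.univ.image c).card) * scalingSize d := by
  rw [sum_edgeDegree_eq]
  calc _ < ∑ w ∈ Finset.univ.image c, (((fibre c w).card : ℝ) - 1) * scalingSize d := by
        refine Finset.sum_lt_sum
          (fun w hw => G.setDegree_le hG hbase _ (fibre_nonempty hw)) ?_
        simp only [Function.Injective, not_forall] at hc
        obtain ⟨u, v, huv, hne⟩ := hc
        refine ⟨c u, by simp, hG.1 _ ?_⟩
        have : ({u, v} : Finset V) ⊆ fibre c (c u) := by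
          intro x hx
          simp only [Finset.mem_insert, Finset.mem_singleton] at hx
          rcases hx with rfl | rfl <;> simp [fibre, huv]
        calc 2 = ({u, v} : Finset V).card := (Finset.card_pair hne).symm
          _ ≤ _ := Finset.card_le_card this
    _ = _ := by
        rw [← Finset.sum_mul, Finset.sum_sub_distrib, ← sum_card_fibre c]
        simp

/-- Edge by edge, the left contribution to the degree of S and the contribution of the complement to
the second condition add up to a_e; the second condition is therefore an upper bound on clusters
that contain 𝕍_⋆. -/
theorem setDegree_compl_lt (G : LabelledGraph V E M) {d : ℕ} (hG : G.PowerCounting d)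
    (S : Finset V) (hS : Sᶜ.Nonempty) (hstar : G.starVertices ⊆ S) :
    G.setDegree S + (Sᶜ.card : ℝ) * scalingSize d < ∑ e, G.a e := by
  have h := hG.2 Sᶜ hS (by
    rw [Finset.disjoint_left]; intro v hv hv'
    exact (Finset.mem_compl.1 hv) (hstar hv'))
  refine lt_of_lt_of_le (add_lt_add_right h _) (le_of_eq ?_)
  rw [setDegree_eq_sum]
  unfold innerEdges outEdges inEdges
  simp only [Finset.sum_filter]
  rw [← Finset.sum_add_distrib, ← Finset.sum_add_distrib, ← Finset.sum_add_distrib]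
  refine Finset.sum_congr rfl fun e _ => ?_
  simp only [Finset.mem_compl]
  rcases Nat.eq_zero_or_pos (G.r e) with h0 | h0
  · by_cases h1 : G.src e ∈ S <;> by_cases h2 : G.tgt e ∈ S <;> by_cases h3 : G.base e ∈ S <;>
      simp [h1, h2, h3, h0]
  · have h0' := h0.ne'
    by_cases h1 : G.src e ∈ S <;> by_cases h2 : G.tgt e ∈ S <;> by_cases h3 : G.base e ∈ S <;>
      simp [h1, h2, h3, h0, h0']

/-- The cluster of the origin is treated by the second condition, all other clusters by the first
one. -/
theorem sum_edgeDegree_lt_of_star (G : LabelledGraph V E M) {d : ℕ} (hG : G.PowerCounting d)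
    (hbase : ∀ e, 0 < G.r e → G.base e ≠ G.src e) (c : V → V)
    (hstar : ∀ i, c (G.star i) = c G.origin) (hc : ∃ u v, c u ≠ c v) :
    ∑ e, G.edgeDegree c e <
      ∑ e, G.a e - ((Finset.univ.image c).card - 1 : ℝ) * scalingSize d := by
  have ho : c G.origin ∈ Finset.univ.image c := by simp
  have hcompl : (fibre c (c G.origin))ᶜ.Nonempty := by
    by_contra h
    rw [Finset.not_nonempty_iff_eq_empty, Finset.compl_eq_empty_iff] at h
    obtain ⟨u, v, huv⟩ := hc
    have h1 : ∀ x, c x = c G.origin := fun x => by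
      have : x ∈ fibre c (c G.origin) := h ▸ Finset.mem_univ x
      simpa [fibre] using this
    exact huv ((h1 u).trans (h1 v).symm)
  have h1 := G.setDegree_compl_lt hG (fibre c (c G.origin)) hcompl (by
    intro v hv
    simp only [starVertices, Finset.mem_insert, Finset.mem_image, Finset.mem_univ,
      true_and] at hv
    rcases hv with rfl | ⟨i, rfl⟩ <;> simp [fibre, hstar])
  rw [sum_edgeDegree_eq, ← Finset.add_sum_erase _ _ ho]
  have h2 : ∑ w ∈ (Finset.univ.image c).erase (c G.origin), G.setDegree (fibre c w) ≤
      ∑ w ∈ (Finset.univ.image c).erase (c G.origin),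
        (((fibre c w).card : ℝ) - 1) * scalingSize d :=
    Finset.sum_le_sum fun w hw =>
      G.setDegree_le hG hbase _ (fibre_nonempty (Finset.mem_of_mem_erase hw))
  have h3 : (∑ w ∈ (Finset.univ.image c).erase (c G.origin), ((fibre c w).card : ℝ)) +
      (fibre c (c G.origin)).card = Fintype.card V := by
    rw [← sum_card_fibre c, ← Finset.add_sum_erase _ _ ho]
    push_cast; ring
  have h4 : (((fibre c (c G.origin))ᶜ).card : ℝ) =
      Fintype.card V - (fibre c (c G.origin)).card := by
    rw [Finset.card_compl, Nat.cast_sub (Finset.card_le_univ _)]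
  have h5 : (((Finset.univ.image c).erase (c G.origin)).card : ℝ) =
      (Finset.univ.image c).card - 1 := by
    rw [Finset.card_erase_of_mem ho, Nat.cast_sub (Finset.card_pos.2 ⟨_, ho⟩)]; simp
  rw [← Finset.sum_mul, Finset.sum_sub_distrib] at h2
  simp only [Finset.sum_const, nsmul_eq_mul, mul_one] at h2
  rw [h5] at h2
  rw [h4] at h1
  have h6 : (∑ w ∈ (Finset.univ.image c).erase (c G.origin), ((fibre c w).card : ℝ)) =
    Fintype.card V - (fibre c (c G.origin)).card := by linarith
  rw [h6] at h2
  nlinarith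

theorem card_image_pos [Nonempty V] (c : V → V) : 0 < (Finset.univ.image c).card :=
  Finset.card_pos.2 (Finset.univ_nonempty.image c)

/-- The power-counting conditions hold with a uniform margin. -/
theorem exists_margin (G : LabelledGraph V E M) {d : ℕ} (hG : G.PowerCounting d)
    (hbase : ∀ e, 0 < G.r e → G.base e ≠ G.src e) :
    ∃ δ : ℝ, 0 < δ ∧ ∀ c : V → V,
      (¬ Function.Injective c → ∑ e, G.edgeDegree c e + δ ≤
        ((Fintype.card V : ℝ) - (Finset.univ.image c).card) * scalingSize d) ∧
      ((∀ i, c (G.star i) = c G.origin) → (∃ u v, c u ≠ c v) → ∑ e, G.edgeDegree c e + δ ≤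
        ∑ e, G.a e - ((Finset.univ.image c).card - 1 : ℝ) * scalingSize d) := by
  classical
  have key : ∀ c : V → V, ∃ δ : ℝ, 0 < δ ∧
      (¬ Function.Injective c → ∑ e, G.edgeDegree c e + δ ≤
        ((Fintype.card V : ℝ) - (Finset.univ.image c).card) * scalingSize d) ∧
      ((∀ i, c (G.star i) = c G.origin) → (∃ u v, c u ≠ c v) → ∑ e, G.edgeDegree c e + δ ≤
        ∑ e, G.a e - ((Finset.univ.image c).card - 1 : ℝ) * scalingSize d) := by
    intro c
    have h1 : ∃ δ : ℝ, 0 < δ ∧ (¬ Function.Injective c → ∑ e, G.edgeDegree c e + δ ≤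
        ((Fintype.card V : ℝ) - (Finset.univ.image c).card) * scalingSize d) := by
      by_cases h : Function.Injective c
      · exact ⟨1, one_pos, fun h' => absurd h h'⟩
      · exact ⟨_, sub_pos.2 (G.sum_edgeDegree_lt hG hbase c h), fun _ => by linarith⟩
    have h2 : ∃ δ : ℝ, 0 < δ ∧ ((∀ i, c (G.star i) = c G.origin) → (∃ u v, c u ≠ c v) →
        ∑ e, G.edgeDegree c e + δ ≤
        ∑ e, G.a e - ((Finset.univ.image c).card - 1 : ℝ) * scalingSize d) := by
      by_cases h : (∀ i, c (G.star i) = c G.origin) ∧ (∃ u v, c u ≠ c v)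
      · exact ⟨_, sub_pos.2 (G.sum_edgeDegree_lt_of_star hG hbase c h.1 h.2),
          fun _ _ => by linarith⟩
      · exact ⟨1, one_pos, fun h' h'' => absurd ⟨h', h''⟩ h⟩
    obtain ⟨δ₁, p₁, h₁⟩ := h1
    obtain ⟨δ₂, p₂, h₂⟩ := h2
    refine ⟨min δ₁ δ₂, lt_min p₁ p₂, fun h => ?_, fun h h' => ?_⟩
    · linarith [h₁ h, min_le_left δ₁ δ₂]
    · linarith [h₂ h h', min_le_right δ₁ δ₂]
  -- Labels are taken in `V` itself, so there are finitely many labellings and the smallest of their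
  -- margins serves all of them.
  choose δ hδ h1 h2 using key
  have : Nonempty V := ⟨G.origin⟩
  obtain ⟨c₀, hc₀⟩ := Finite.exists_min δ
  refine ⟨δ c₀, hδ c₀, fun c => ⟨fun h => ?_, fun h h' => ?_⟩⟩
  · linarith [h1 c h, hc₀ c]
  · linarith [h2 c h h', hc₀ c]

/-- If every edge joins two points with the same label, possibly after passing from its endpoint
to its base point, then all labels agree. -/
theorem label_eq_of_edges (G : LabelledGraph V E M) {d : ℕ} (hG : G.PowerCounting d)
    (hbase : ∀ e, 0 < G.r e → G.base e ≠ G.src e) (c : V → V)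
    (he : ∀ e, c (G.src e) = c (G.tgt e) ∨ 0 < G.r e ∧ c (G.src e) = c (G.base e)) (u v : V) :
    c u = c v := by
  by_contra huv
  have : Nonempty V := ⟨G.origin⟩
  have hstar : ∀ i, c (G.star i) = c G.origin := fun i => by
    rcases he (G.starEdge i) with h | h
    · rw [G.starEdge_src, G.starEdge_tgt] at h; exact h.symm
    · rw [G.starEdge_r] at h; exact absurd h.1 (lt_irrefl _)
  have h1 := G.sum_edgeDegree_lt_of_star hG hbase c hstar ⟨u, v, huv⟩
  -- An edge tied only through its base point counts a + r - 1 ≥ a. The total degree is thus at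
  -- least ∑ a, which the second condition forbids as soon as two labels occur.
  have h2 : ∑ e, G.a e ≤ ∑ e, G.edgeDegree c e := by
    refine Finset.sum_le_sum fun e _ => ?_
    unfold edgeDegree
    by_cases h : c (G.src e) = c (G.tgt e)
    · simp [h]
    · obtain ⟨h0, h3⟩ := (he e).resolve_left h
      have h4 : ¬ (c (G.tgt e) = c (G.base e)) := fun h' => h (h3.trans h'.symm)
      have h5 : (1 : ℝ) ≤ G.r e := by exact_mod_cast h0
      rw [if_neg h, if_pos ⟨h0, h3, h⟩, if_neg (fun h' => h4 h'.2.1)]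
      linarith
  have h3 : (1 : ℝ) ≤ (Finset.univ.image c).card := by exact_mod_cast card_image_pos c
  have h4 : (0 : ℝ) ≤ scalingSize d := Nat.cast_nonneg _
  nlinarith

end LabelledGraph
end GenConv
end

noncomputable section
namespace GenConv

/-! ### Single-linkage clustering -/

/-- The last index `m ≤ i` which is `0` or satisfies `r < ℓ m`. -/
def lastBreak (ℓ : ℕ → ℝ) (r : ℝ) : ℕ → ℕ
  | 0 => 0
  | i + 1 => if r < ℓ (i + 1) then i + 1 else lastBreak ℓ r i

theorem lastBreak_le (ℓ : ℕ → ℝ) (r : ℝ) (i : ℕ) : lastBreak ℓ r i ≤ i := by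
  induction i with
  | zero => simp [lastBreak]
  | succ i ih => simp only [lastBreak]; split_ifs <;> omega

theorem lastBreak_spec (ℓ : ℕ → ℝ) (r : ℝ) (i : ℕ) :
    lastBreak ℓ r i = 0 ∨ r < ℓ (lastBreak ℓ r i) := by
  induction i with
  | zero => simp [lastBreak]
  | succ i ih =>
    simp only [lastBreak]; split_ifs with h
    · exact Or.inr h
    · exact ih

theorem lastBreak_of_lt {ℓ : ℕ → ℝ} {r : ℝ} {i : ℕ} (h : r < ℓ i) : lastBreak ℓ r i = i := by
  cases i with
  | zero => simp [lastBreak]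
  | succ i => simp [lastBreak, h]

theorem lastBreak_idem (ℓ : ℕ → ℝ) (r : ℝ) (i : ℕ) :
    lastBreak ℓ r (lastBreak ℓ r i) = lastBreak ℓ r i := by
  rcases lastBreak_spec ℓ r i with h | h
  · rw [h]; rfl
  · exact lastBreak_of_lt h

theorem lastBreak_mono (ℓ : ℕ → ℝ) (r : ℝ) : Monotone (lastBreak ℓ r) := by
  refine monotone_nat_of_le_succ fun i => ?_
  have := lastBreak_le ℓ r i
  simp only [lastBreak]; split_ifs <;> omega

/-- The breaks cut the indices into intervals; two indices in different intervals are separated by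
the first index of the later one. -/
theorem lastBreak_lt {ℓ : ℕ → ℝ} {r : ℝ} {i j : ℕ} (hij : i ≤ j)
    (h : lastBreak ℓ r i ≠ lastBreak ℓ r j) :
    i < lastBreak ℓ r j ∧ r < ℓ (lastBreak ℓ r j) := by
  have h1 : i < lastBreak ℓ r j := by
    by_contra h'
    have h2 := lastBreak_mono ℓ r (not_lt.1 h')
    rw [lastBreak_idem] at h2
    exact h (le_antisymm (lastBreak_mono ℓ r hij) h2)
  exact ⟨h1, (lastBreak_spec ℓ r j).resolve_left (by omega)⟩

theorem lastBreak_eq_of_le {ℓ : ℕ → ℝ} {r r' : ℝ} (hr : r ≤ r') {i j : ℕ} (hij : i ≤ j)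
    (h : lastBreak ℓ r i = lastBreak ℓ r j) : lastBreak ℓ r' i = lastBreak ℓ r' j := by
  by_contra h'
  obtain ⟨h1, h2⟩ := lastBreak_lt hij h'
  have h3 := lastBreak_mono ℓ r (lastBreak_le ℓ r' j)
  rw [lastBreak_of_lt (lt_of_le_of_lt hr h2), ← h] at h3
  have := lastBreak_le ℓ r i
  omega

/-- An enumeration of finitely many points in which each one is as close as possible to the
preceding ones. -/
theorem exists_greedy_enumeration {V : Type*} [Fintype V] [DecidableEq V] (o : V)
    (D : V → V → ℝ) : ∀ k, 1 ≤ k → k ≤ Fintype.card V → ∃ s : ℕ → V, s 0 = o ∧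
      Set.InjOn s (Set.Iio k) ∧
      ∀ i, 0 < i → i < k → ∃ j < i, ∀ j' < i, ∀ v, v ∉ s '' Set.Iio i →
        D (s i) (s j) ≤ D v (s j') := by
  intro k hk
  induction k, hk using Nat.le_induction with
  | base =>
    intro _
    refine ⟨fun _ => o, rfl, ?_, fun i h1 h2 => by omega⟩
    intro i hi j hj _
    simp only [Set.mem_Iio] at hi hj; omega
  | succ k hk ih =>
    intro hkV
    obtain ⟨s, h0, hinj, hs⟩ := ih (by omega)
    let A : Finset V := (Finset.range k).image s
    have hA : ∀ v, v ∈ A ↔ v ∈ s '' Set.Iio k := fun v => by simp [A]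
    have hAc : (Aᶜ).Nonempty := by
      rw [← Finset.card_pos, Finset.card_compl]
      have : A.card ≤ k := Finset.card_image_le.trans (by simp)
      omega
    -- One step of Prim's algorithm: among all pairs of a new and an old point, a closest one is
    -- selected.
    obtain ⟨⟨w, j⟩, hwj, hmin⟩ := Finset.exists_min_image (Aᶜ ×ˢ Finset.range k)
      (fun x => D x.1 (s x.2)) (hAc.product (Finset.nonempty_range_iff.2 (by omega)))
    simp only [Finset.mem_product, Finset.mem_compl, Finset.mem_range] at hwj hmin
    have hne : ∀ i, i < k → Function.update s k w i = s i := fun i hi =>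
      Function.update_of_ne (by omega) _ _
    have himg : ∀ i, i ≤ k → Function.update s k w '' Set.Iio i = s '' Set.Iio i := fun i hi =>
      Set.image_congr fun x hx => hne x (lt_of_lt_of_le hx hi)
    refine ⟨Function.update s k w, by rw [hne 0 (by omega), h0], ?_, ?_⟩
    · have hw : ∀ i, i < k → s i ≠ w := fun i hi h => hwj.1 ((hA w).2 ⟨i, hi, h⟩)
      intro a ha b hb hab
      simp only [Set.mem_Iio] at ha hb
      rcases Nat.lt_or_ge a k with h1 | h1 <;> rcases Nat.lt_or_ge b k with h2 | h2
      · rw [hne a h1, hne b h2] at hab; exact hinj h1 h2 hab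
      · obtain rfl : b = k := by omega
        rw [hne a h1, Function.update_self] at hab; exact absurd hab (hw a h1)
      · obtain rfl : a = k := by omega
        rw [hne b h2, Function.update_self] at hab; exact absurd hab.symm (hw b h2)
      · omega
    · intro i hi hik
      rw [himg i (by omega)]
      rcases Nat.lt_or_ge i k with h1 | h1
      · obtain ⟨j', hj', h⟩ := hs i hi h1
        refine ⟨j', hj', fun j'' hj'' v hv => ?_⟩
        rw [hne i h1, hne j' (by omega), hne j'' (by omega)]
        exact h j'' hj'' v hv
      · obtain rfl : i = k := by omega
        refine ⟨j, hwj.2, fun j' hj' v hv => ?_⟩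
        rw [hne j hwj.2, hne j' hj', Function.update_self]
        exact hmin (v, j') ⟨fun h => hv ((hA v).1 h), hj'⟩

/-- The data of the single-linkage clustering of a finite pseudometric space: an enumeration of
the points, the distance of each point to the preceding ones, and for each threshold a labelling
of the clusters. -/
structure Clustering {V : Type*} [Fintype V] [DecidableEq V] (o : V) (D : V → V → ℝ) where
  enum : Fin (Fintype.card V) ≃ V
  enum_eq : ∀ i, enum i = o ↔ i.val = 0
  len : Fin (Fintype.card V) → ℝ
  len_eq : ∀ i, i.val ≠ 0 → ∃ j < i, len i = D (enum i) (enum j)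
  label : ℝ → V → V
  dist_le : ∀ r, 0 ≤ r → ∀ u v, label r u = label r v → D u v ≤ 2 * Fintype.card V * r
  lt_dist : ∀ r u v, label r u ≠ label r v → r < D u v
  label_mono : ∀ r r', r ≤ r' → ∀ u v, label r u = label r v → label r' u = label r' v
  card_le : ∀ r, Fintype.card V ≤ (Finset.univ.image (label r)).card +
    (Finset.univ.filter fun i => i.val ≠ 0 ∧ len i ≤ r).card
  not_injective : ∀ r i, i.val ≠ 0 → len i ≤ r → ¬ Function.Injective (label r)
  not_constant : ∀ r i, i.val ≠ 0 → r < len i → ∃ u v, label r u ≠ label r v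

/-- In Prim's order the clusters at threshold r are intervals, cut at the indices whose attaching
length exceeds r. A cluster is labelled by its first point, which makes the clusters nested as r
grows. -/
theorem exists_clustering {V : Type*} [Fintype V] [DecidableEq V] (o : V) (D : V → V → ℝ)
    (hself : ∀ v, D v v = 0) (hsymm : ∀ u v, D u v = D v u)
    (htri : ∀ u v w, D u w ≤ D u v + D v w) : Nonempty (Clustering o D) := by
  have hn : 1 ≤ Fintype.card V := Fintype.card_pos_iff.2 ⟨o⟩
  obtain ⟨s, h0, hinj, hs⟩ := exists_greedy_enumeration o D (Fintype.card V) hn le_rfl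
  have hs' : ∀ i, ∃ j, 0 < i → i < Fintype.card V → j < i ∧ ∀ j' < i, ∀ v,
      v ∉ s '' Set.Iio i → D (s i) (s j) ≤ D v (s j') := fun i => by
    by_cases h : 0 < i ∧ i < Fintype.card V
    · obtain ⟨j, hj, h'⟩ := hs i h.1 h.2
      exact ⟨j, fun _ _ => ⟨hj, h'⟩⟩
    · exact ⟨0, fun h1 h2 => absurd ⟨h1, h2⟩ h⟩
  choose q hq using hs'
  let ℓ : ℕ → ℝ := fun i => D (s i) (s (q i))
  have hnot : ∀ i m, m ≤ i → i < Fintype.card V → s i ∉ s '' Set.Iio m := by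
    rintro i m hm hi ⟨j, hj, hji⟩
    simp only [Set.mem_Iio] at hj
    have := hinj (show j < _ by omega) hi hji
    omega
  -- the greedy property, for pairs of points on both sides of an index
  have hgreedy : ∀ m i j, 0 < m → j < m → m ≤ i → i < Fintype.card V →
      ℓ m ≤ D (s i) (s j) := fun m i j hm hj hi hin =>
    (hq m hm (by omega)).2 j hj (s i) (hnot i m hi hin)
  -- Following the attachments back to the head of the interval takes at most i steps of length at
  -- most r. Two points of a cluster are compared through its head, whence the factor 2 in
  -- `dist_le`.
  have hchain : ∀ r, 0 ≤ r → ∀ i, i < Fintype.card V →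
      D (s i) (s (lastBreak ℓ r i)) ≤ i * r := by
    intro r hr i
    induction i using Nat.strong_induction_on with
    | _ i ih =>
      intro hi
      by_cases hbi : lastBreak ℓ r i = i
      · rw [hbi, hself]; positivity
      · have hb1 : lastBreak ℓ r i < i := lt_of_le_of_ne (lastBreak_le _ _ _) hbi
        have hℓ : ℓ i ≤ r := not_lt.1 fun h => hbi (lastBreak_of_lt h)
        have hqi := (hq i (by omega) hi).1
        -- An attachment that jumped over the break would join its two sides within distance r,
        -- although the greedy choice at the break found nothing that close.
        have hge : lastBreak ℓ r i ≤ q i := by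
          by_contra h
          rcases lastBreak_spec ℓ r i with h' | h'
          · omega
          · exact absurd (lt_of_lt_of_le h' (hgreedy _ i (q i) (by omega) (by omega)
              hb1.le hi)) (not_lt.2 hℓ)
        have hb : lastBreak ℓ r (q i) = lastBreak ℓ r i := by
          refine le_antisymm (lastBreak_mono _ _ hqi.le) ?_
          have := lastBreak_mono ℓ r hge
          rwa [lastBreak_idem] at this
        have h1 := ih (q i) hqi (by omega)
        rw [hb] at h1
        have h2 : ((q i : ℝ) + 1) * r ≤ i * r :=
          mul_le_mul_of_nonneg_right (by exact_mod_cast hqi) hr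
        have h3 : D (s i) (s (q i)) ≤ r := hℓ
        linarith [htri (s i) (s (q i)) (s (lastBreak ℓ r i))]
  have hbij : Function.Bijective fun i : Fin (Fintype.card V) => s i := by
    rw [Fintype.bijective_iff_injective_and_card]
    refine ⟨fun i j hij => Fin.ext (hinj i.2 j.2 hij), by simp⟩
  let σ : Fin (Fintype.card V) ≃ V := Equiv.ofBijective _ hbij
  have hσ : ∀ i, σ i = s i := fun i => rfl
  have hσs : ∀ v, s (σ.symm v) = v := fun v => σ.apply_symm_apply v
  have hlab : ∀ r i, lastBreak ℓ r i = i → i < Fintype.card V →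
      s (lastBreak ℓ r (σ.symm (s i))) = s i := fun r i h hi => by
    have : σ.symm (s i) = ⟨i, hi⟩ := σ.symm_apply_eq.2 rfl
    rw [this, h]
  have hinj' : ∀ r u v, s (lastBreak ℓ r (σ.symm u)) = s (lastBreak ℓ r (σ.symm v)) →
      lastBreak ℓ r (σ.symm u) = lastBreak ℓ r (σ.symm v) := fun r u v h =>
    hinj (lt_of_le_of_lt (lastBreak_le _ _ _) (σ.symm u).2)
      (lt_of_le_of_lt (lastBreak_le _ _ _) (σ.symm v).2) h
  refine ⟨⟨σ, fun i => ?_, fun i => ℓ i, fun i hi => ?_,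
    fun r v => s (lastBreak ℓ r (σ.symm v)), ?_, ?_, ?_, ?_, ?_, ?_⟩⟩
  · rw [hσ, ← h0]
    exact ⟨fun h => hinj i.2 (show 0 < _ by omega) h, fun h => by rw [h]⟩
  · have := (hq i (by omega) i.2).1
    exact ⟨⟨q i, by omega⟩, this, rfl⟩
  · intro r hr u v huv
    have huv' := hinj' r u v huv
    have h1 := hchain r hr _ (σ.symm u).2
    have h2 := hchain r hr _ (σ.symm v).2
    rw [hσs] at h1 h2
    rw [huv'] at h1
    have h3 : ((σ.symm u : ℕ) : ℝ) * r ≤ Fintype.card V * r :=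
      mul_le_mul_of_nonneg_right (by exact_mod_cast (σ.symm u).2.le) hr
    have h4 : ((σ.symm v : ℕ) : ℝ) * r ≤ Fintype.card V * r :=
      mul_le_mul_of_nonneg_right (by exact_mod_cast (σ.symm v).2.le) hr
    rw [hsymm] at h2
    linarith [htri u (s (lastBreak ℓ r (σ.symm v))) v]
  · intro r u v huv
    have key : ∀ u v, (σ.symm u : ℕ) ≤ σ.symm v →
        s (lastBreak ℓ r (σ.symm u)) ≠ s (lastBreak ℓ r (σ.symm v)) → r < D v u := by
      intro u v hle hne
      obtain ⟨h1, h2⟩ := lastBreak_lt (r := r) (ℓ := ℓ) hle (fun h => hne (by rw [h]))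
      have h3 := hgreedy _ (σ.symm v) (σ.symm u) (by omega) h1 (lastBreak_le _ _ _)
        (σ.symm v).2
      rw [hσs, hσs] at h3
      exact lt_of_lt_of_le h2 h3
    rcases le_total (σ.symm u : ℕ) (σ.symm v) with h | h
    · rw [hsymm]; exact key u v h huv
    · exact key v u h huv.symm
  · intro r r' hr u v huv
    have huv' := hinj' r u v huv
    rcases le_total (σ.symm u : ℕ) (σ.symm v) with h | h
    · rw [lastBreak_eq_of_le hr h huv']
    · rw [lastBreak_eq_of_le hr h huv'.symm]
  · intro r
    -- Index 0 and every break are heads of their own intervals, so they provide distinct labels.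
    have h1 : (Finset.univ.filter fun i : Fin (Fintype.card V) =>
        ¬ (i.val ≠ 0 ∧ ℓ i ≤ r)).card ≤
        (Finset.univ.image fun v => s (lastBreak ℓ r (σ.symm v))).card := by
      rw [← Finset.card_image_of_injective _ σ.injective]
      refine Finset.card_le_card fun v hv => ?_
      simp only [Finset.mem_image, Finset.mem_filter, Finset.mem_univ, true_and] at hv ⊢
      obtain ⟨i, hi, rfl⟩ := hv
      refine ⟨σ i, hlab r i ?_ i.2⟩
      by_cases h : i.val = 0
      · rw [h]; rfl
      · exact lastBreak_of_lt (not_le.1 fun h' => hi ⟨h, h'⟩)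
    have h2 := Finset.card_filter_add_card_filter_not (s := Finset.univ)
      (fun i : Fin (Fintype.card V) => i.val ≠ 0 ∧ ℓ i ≤ r)
    simp only [Finset.card_univ, Fintype.card_fin] at h2
    omega
  · intro r i hi hℓ hinjl
    obtain ⟨m, hm⟩ : ∃ m, i.val = m + 1 := ⟨i.val - 1, by omega⟩
    have h1 : m < Fintype.card V := by have := i.2; omega
    have h2 : lastBreak ℓ r i = lastBreak ℓ r m := by
      rw [hm]; simp only [lastBreak]
      rw [if_neg (by rw [← hm]; exact not_lt.2 hℓ)]
    have h3 : σ i = σ ⟨m, h1⟩ := hinjl (by simp [h2])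
    have h4 := congrArg Fin.val (σ.injective h3)
    simp only at h4; omega
  · intro r i hi hℓ
    refine ⟨σ i, o, fun h => ?_⟩
    have ho : σ.symm o = ⟨0, by omega⟩ := σ.symm_apply_eq.2 h0.symm
    have h1 := hinj' r _ _ h
    rw [ho, σ.symm_apply_apply, lastBreak_of_lt hℓ] at h1
    exact hi h1

end GenConv
end

noncomputable section
namespace GenConv

/-! ### Counting scales -/

open Classical in
/-- The number of scales `1 ≤ k ≤ N` with the property `P`. -/
def scaleCount (N : ℕ) (P : ℕ → Prop) : ℕ := ((Finset.Icc 1 N).filter P).card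

theorem scaleCount_le (N : ℕ) (P : ℕ → Prop) : scaleCount N P ≤ N := by
  classical
  exact (Finset.card_filter_le _ _).trans (by simp)

/-- A property inherited by coarser scales holds on an initial segment of the scales, and the count
is the end of that segment. Sums of indicators over scales thereby become integers. -/
theorem le_scaleCount_iff {N : ℕ} {P : ℕ → Prop} (hP : ∀ k l, k ≤ l → P l → P k) {k : ℕ}
    (hk : 1 ≤ k) (hkN : k ≤ N) : k ≤ scaleCount N P ↔ P k := by
  classical
  constructor
  · intro h
    by_contra hk'
    have : ((Finset.Icc 1 N).filter P) ⊆ Finset.Icc 1 (k - 1) := fun l hl => by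
      simp only [Finset.mem_filter, Finset.mem_Icc] at hl ⊢
      by_contra h'
      exact hk' (hP k l (by omega) hl.2)
    have h2 := Finset.card_le_card this
    simp only [Nat.card_Icc, scaleCount] at h2 h
    omega
  · intro h
    have : Finset.Icc 1 k ⊆ (Finset.Icc 1 N).filter P := fun l hl => by
      simp only [Finset.mem_filter, Finset.mem_Icc] at hl ⊢
      exact ⟨⟨hl.1, by omega⟩, hP l k hl.2 h⟩
    simpa [scaleCount] using Finset.card_le_card this

theorem sum_ite_scaleCount (N : ℕ) (P : ℕ → Prop) [DecidablePred P] (x : ℝ) :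
    ∑ k ∈ Finset.Icc 1 N, (if P k then x else 0) = scaleCount N P * x := by
  rw [← Finset.sum_filter, Finset.sum_const, nsmul_eq_mul, scaleCount]
  congr!

theorem scaleCount_and_not {N m n : ℕ} {P : ℕ → Prop} (hm : m ≤ N)
    (h : ∀ k, 1 ≤ k → k ≤ N → (P k ↔ k ≤ m ∧ ¬ k ≤ n)) : scaleCount N P = m - n := by
  classical
  have : (Finset.Icc 1 N).filter P = Finset.Icc (n + 1) m := by
    ext k
    simp only [Finset.mem_filter, Finset.mem_Icc]
    constructor
    · rintro ⟨⟨h1, h2⟩, h3⟩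
      have := (h k h1 h2).1 h3; omega
    · rintro ⟨h1, h2⟩
      exact ⟨⟨by omega, by omega⟩, (h k (by omega) (by omega)).2 ⟨h2, by omega⟩⟩
  rw [scaleCount, this]; simp

/-- The index `n ≤ N` of the scale `2^{-n}` of a length. -/
def scaleIdx (N : ℕ) (x : ℝ) : ℕ := scaleCount N fun k => x ≤ ((2 : ℝ) ^ k)⁻¹

theorem scaleIdx_le (N : ℕ) (x : ℝ) : scaleIdx N x ≤ N := scaleCount_le _ _

theorem inv_two_pow_anti {k l : ℕ} (h : k ≤ l) : ((2 : ℝ) ^ l)⁻¹ ≤ ((2 : ℝ) ^ k)⁻¹ :=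
  inv_anti₀ (by positivity) (pow_le_pow_right₀ (by norm_num) h)

theorem le_scaleIdx_iff {N : ℕ} {x : ℝ} {k : ℕ} (hk : 1 ≤ k) (hkN : k ≤ N) :
    k ≤ scaleIdx N x ↔ x ≤ ((2 : ℝ) ^ k)⁻¹ :=
  le_scaleCount_iff (P := fun k => x ≤ ((2 : ℝ) ^ k)⁻¹)
    (fun _ _ h1 h2 => h2.trans (inv_two_pow_anti h1)) hk hkN

/-- The distance between two natural numbers. -/
def gap (m n : ℕ) : ℕ := (m - n) + (n - m)

/-- The two penalties are active exactly at the scales that lie between n and L, and there are `gap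
n L` of these. -/
theorem sum_weight (N n L : ℕ) (hn : n ≤ N) (hL : L ≤ N) (D δ : ℝ) :
    ∑ k ∈ Finset.Icc 1 N, ((if k ≤ n then D else 0)
      - ((if k ≤ n ∧ ¬ k ≤ L then δ else 0) + (if k ≤ L ∧ ¬ k ≤ n then δ else 0))) =
    D * n - δ * gap n L := by
  rw [Finset.sum_sub_distrib, Finset.sum_add_distrib, sum_ite_scaleCount, sum_ite_scaleCount,
    sum_ite_scaleCount, scaleCount_and_not (m := n) (n := L) hn (fun k _ _ => Iff.rfl),
    scaleCount_and_not (m := L) (n := n) hL (fun k _ _ => Iff.rfl),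
    scaleCount_and_not (m := n) (n := 0) hn (fun k h _ => by omega)]
  unfold gap; push_cast; simp only [Nat.sub_zero]; ring

/-! ### Power counting summed over all scales. -/

namespace LabelledGraph

variable {V E : Type*} [Fintype V] [DecidableEq V] [Fintype E] [DecidableEq E] {M : ℕ}

theorem alpha_eq (G : LabelledGraph V E M) (d : ℕ) :
    G.alpha d = ((Fintype.card V : ℝ) - 1) * scalingSize d - ∑ e, G.a e := by
  have h : (Finset.univ.erase G.origin).card = Fintype.card V - 1 := by
    rw [Finset.card_erase_of_mem (Finset.mem_univ _), Finset.card_univ]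
  have h1 : 1 ≤ Fintype.card V := Fintype.card_pos_iff.2 ⟨G.origin⟩
  rw [alpha, h, Nat.cast_sub h1]
  push_cast; ring

/-- The power-counting estimate: the total degree of the clusters at all scales. -/
theorem sum_edgeDegree_scales_le (G : LabelledGraph V E M) {d : ℕ} (hG : G.PowerCounting d)
    (hbase : ∀ e, 0 < G.r e → G.base e ≠ G.src e) :
    ∃ δ : ℝ, 0 < δ ∧ ∀ (D : V → V → ℝ) (cl : Clustering G.origin D) (N L : ℕ), L ≤ N →
      (∀ i, D (G.star i) G.origin ≤ ((2 : ℝ) ^ L)⁻¹) →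
      ∑ k ∈ Finset.Icc 1 N, ∑ e, G.edgeDegree (cl.label ((2 : ℝ) ^ k)⁻¹) e ≤
        ∑ i ∈ Finset.univ.filter (fun i : Fin (Fintype.card V) => i.val ≠ 0),
          (scalingSize d * scaleIdx N (cl.len i) - δ * gap (scaleIdx N (cl.len i)) L)
        - G.alpha d * L := by
  classical
  obtain ⟨δ, hδ, hmargin⟩ := G.exists_margin hG hbase
  have hn : (0 : ℝ) < Fintype.card V := by exact_mod_cast Fintype.card_pos_iff.2 ⟨G.origin⟩
  have : Nonempty V := ⟨G.origin⟩
  set n : ℝ := (Fintype.card V : ℝ) with hndef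
  refine ⟨δ / n, by positivity, fun D cl N L hLN hstar => ?_⟩
  set I := Finset.univ.filter (fun i : Fin (Fintype.card V) => i.val ≠ 0) with hI
  set m : Fin (Fintype.card V) → ℕ := fun i => scaleIdx N (cl.len i) with hm
  have hDs : (0 : ℝ) ≤ scalingSize d := Nat.cast_nonneg _
  have hIn : (I.card : ℝ) ≤ n := by
    have : I.card ≤ Fintype.card V := by
      simpa using Finset.card_le_univ I
    rw [hndef]; exact_mod_cast this
  -- The margin δ gained at one scale is divided among the tree edges, of which there are at most n;
  -- hence the rate δ / n for each edge.
  have hcount : ∀ P : Fin (Fintype.card V) → Prop, [DecidablePred P] →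
      ∑ i ∈ I, (if P i then δ / n else 0) ≤ δ := fun P _ => by
    calc ∑ i ∈ I, (if P i then δ / n else 0) ≤ ∑ i ∈ I, δ / n :=
          Finset.sum_le_sum fun i _ => by split_ifs <;> [exact le_rfl; positivity]
      _ = I.card * (δ / n) := by simp
      _ ≤ n * (δ / n) := by gcongr
      _ = δ := by field_simp
  have key : ∀ k ∈ Finset.Icc 1 N, ∑ e, G.edgeDegree (cl.label ((2 : ℝ) ^ k)⁻¹) e ≤
      ∑ i ∈ I, ((if k ≤ m i then (scalingSize d : ℝ) else 0)
        - ((if k ≤ m i ∧ ¬ k ≤ L then δ / n else 0) + (if k ≤ L ∧ ¬ k ≤ m i then δ / n else 0)))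
      - (if k ≤ L then G.alpha d else 0) := by
    intro k hk
    rw [Finset.mem_Icc] at hk
    have hiff : ∀ i, k ≤ m i ↔ cl.len i ≤ ((2 : ℝ) ^ k)⁻¹ := fun i => le_scaleIdx_iff hk.1 hk.2
    set c := cl.label ((2 : ℝ) ^ k)⁻¹ with hc
    have hcard : n - (Finset.univ.image c).card ≤ ∑ i ∈ I, (if k ≤ m i then (1 : ℝ) else 0) := by
      have h1 := cl.card_le ((2 : ℝ) ^ k)⁻¹
      rw [← hc] at h1
      have h1' : (Fintype.card V : ℝ) ≤ ((Finset.univ.image c).card : ℝ) +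
        ((Finset.univ.filter fun i => i.val ≠ 0 ∧ cl.len i ≤ ((2 : ℝ) ^ k)⁻¹).card : ℝ) := by
        rw [← Nat.cast_add]; exact Nat.cast_le.2 h1
      rw [← Finset.sum_filter, hI, Finset.filter_filter]
      simp only [hiff, Finset.sum_const, nsmul_eq_mul, mul_one]
      rw [sub_le_iff_le_add, hndef]
      rw [add_comm]
      exact h1'
    have hcard' : (n - (Finset.univ.image c).card) * scalingSize d ≤
        ∑ i ∈ I, (if k ≤ m i then (scalingSize d : ℝ) else 0) := by
      calc _ ≤ (∑ i ∈ I, (if k ≤ m i then (1 : ℝ) else 0)) * scalingSize d := by gcongr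
        _ = _ := by rw [Finset.sum_mul]; simp only [ite_mul, one_mul, zero_mul]
    rw [Finset.sum_sub_distrib, Finset.sum_add_distrib]
    by_cases hkL : k ≤ L
    -- Scales k ≤ L: the distinguished vertices are closer to the origin than the threshold, so the
    -- second condition applies and yields the gain α.
    · have hst : ∀ i, c (G.star i) = c G.origin := fun i => by
        by_contra h
        have h1 := cl.lt_dist _ _ _ h
        exact absurd ((hstar i).trans (inv_two_pow_anti hkL)) (not_le.2 h1)
      simp only [hkL, not_true, and_false, if_false, Finset.sum_const_zero, true_and, if_true,
        zero_add]
      by_cases hall : ∃ i ∈ I, ¬ k ≤ m i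
      · obtain ⟨i, hiI, hi⟩ := hall
        have h1 := (hmargin c).2 hst (cl.not_constant _ i (by simpa [hI] using hiI)
          (not_le.1 fun h => hi ((hiff i).2 h)))
        have h2 := hcount (fun i => ¬ k ≤ m i)
        rw [alpha_eq, ← hndef]
        linarith
      -- All tree edges are shorter than the threshold: no penalty is to be paid, and the bound
      -- without margin is enough.
      · push Not at hall
        have h0 : ∑ i ∈ I, (if ¬ k ≤ m i then δ / n else 0) = 0 :=
          Finset.sum_eq_zero fun i hi => if_neg (not_not.2 (hall i hi))
        rw [h0, sub_zero, Finset.sum_congr rfl fun i hi => if_pos (hall i hi)]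
        have hIc : (I.card : ℝ) = n - 1 := by
          have : I = Finset.univ.erase ⟨0, Fintype.card_pos⟩ := by
            ext i; rw [hI, Finset.mem_filter, Finset.mem_erase, ne_eq (a := i), Fin.ext_iff]; exact and_comm
          rw [this, Finset.card_erase_of_mem (Finset.mem_univ _), Finset.card_univ,
            Fintype.card_fin, Nat.cast_sub Fintype.card_pos, Nat.cast_one]
        rw [Finset.sum_const, nsmul_eq_mul, hIc, alpha_eq, ← hndef]
        have : ∑ e, G.edgeDegree c e ≤ ∑ e, G.a e := by
          by_cases hcc : ∃ u v, c u ≠ c v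
          · have h1 := G.sum_edgeDegree_lt_of_star hG hbase c hst hcc
            have h3 : (1 : ℝ) ≤ (Finset.univ.image c).card := by
              exact_mod_cast card_image_pos c
            nlinarith
          · push Not at hcc
            refine Finset.sum_le_sum fun e _ => ?_
            simp [edgeDegree, hcc (G.src e) (G.tgt e)]
        linarith
    · simp only [hkL, not_false_eq_true, and_true, false_and, if_false, Finset.sum_const_zero,
        add_zero, sub_zero]
      -- Scales k > L: the first condition has a margin unless all points are separated, and only a
      -- tree edge shorter than the threshold needs that margin.
      by_cases hall : ∃ i ∈ I, k ≤ m i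
      · obtain ⟨i, hiI, hi⟩ := hall
        have h1 := (hmargin c).1 (cl.not_injective _ i (by simpa [hI] using hiI) ((hiff i).1 hi))
        have h2 := hcount (fun i => k ≤ m i)
        linarith
      · push Not at hall
        have h0 : ∑ i ∈ I, (if k ≤ m i then δ / n else 0) = 0 :=
          Finset.sum_eq_zero fun i hi => if_neg (not_le.2 (hall i hi))
        rw [h0]
        linarith [G.sum_edgeDegree_le hG hbase c]
  refine (Finset.sum_le_sum key).trans (le_of_eq ?_)
  rw [Finset.sum_sub_distrib, Finset.sum_comm, sum_ite_scaleCount,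
    scaleCount_and_not (m := L) (n := 0) hLN (fun k h _ => by omega), Nat.sub_zero]
  rw [mul_comm (L : ℝ)]
  congr 1
  exact Finset.sum_congr rfl fun i _ => sum_weight N _ L (scaleIdx_le _ _) hLN _ _

/-- The sum over all scales of the degree of an edge, in terms of the scales at which its
endpoints and its base point are separated. -/
theorem sum_edgeDegree_edge (G : LabelledGraph V E M) {D : V → V → ℝ}
    (cl : Clustering G.origin D) (N : ℕ) (e : E) :
    ∃ nA nB nD : ℕ, nA ≤ N ∧ nB ≤ N ∧ nD ≤ N ∧
      (∀ k, 1 ≤ k → k ≤ N →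
        (k ≤ nA ↔ cl.label ((2 : ℝ) ^ k)⁻¹ (G.src e) = cl.label ((2 : ℝ) ^ k)⁻¹ (G.tgt e))) ∧
      (∀ k, 1 ≤ k → k ≤ N →
        (k ≤ nB ↔ cl.label ((2 : ℝ) ^ k)⁻¹ (G.src e) = cl.label ((2 : ℝ) ^ k)⁻¹ (G.base e))) ∧
      (∀ k, 1 ≤ k → k ≤ N →
        (k ≤ nD ↔ cl.label ((2 : ℝ) ^ k)⁻¹ (G.tgt e) = cl.label ((2 : ℝ) ^ k)⁻¹ (G.base e))) ∧
      ∑ k ∈ Finset.Icc 1 N, G.edgeDegree (cl.label ((2 : ℝ) ^ k)⁻¹) e =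
        G.a e * nA + if 0 < G.r e then
          (G.a e + G.r e - 1) * (nB - nA : ℕ) - G.r e * (nD - nA : ℕ) else 0 := by
  classical
  have hiff : ∀ u v k, 1 ≤ k → k ≤ N →
      (k ≤ scaleCount N (fun k => cl.label ((2 : ℝ) ^ k)⁻¹ u = cl.label ((2 : ℝ) ^ k)⁻¹ v) ↔
        cl.label ((2 : ℝ) ^ k)⁻¹ u = cl.label ((2 : ℝ) ^ k)⁻¹ v) := fun u v k h1 h2 =>
    le_scaleCount_iff (P := fun k => cl.label ((2 : ℝ) ^ k)⁻¹ u = cl.label ((2 : ℝ) ^ k)⁻¹ v)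
      (fun k l hkl h => cl.label_mono _ _ (inv_two_pow_anti hkl) u v h) h1 h2
  -- The three numbers count the scales shared by source and target, by source and base point, and
  -- by target and base point. The indicators in `edgeDegree` are differences of such initial
  -- segments, which explains the truncated subtractions.
  refine ⟨_, _, _, scaleCount_le _ _, scaleCount_le _ _, scaleCount_le _ _,
    hiff _ _, hiff _ _, hiff _ _, ?_⟩
  unfold edgeDegree
  rw [Finset.sum_sub_distrib, Finset.sum_add_distrib, sum_ite_scaleCount]
  rcases Nat.eq_zero_or_pos (G.r e) with h | h
  · simp [h, mul_comm]
  · simp only [h, true_and, if_true]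
    rw [sum_ite_scaleCount, sum_ite_scaleCount,
      scaleCount_and_not (scaleCount_le _ _) (P := fun k =>
        cl.label ((2 : ℝ) ^ k)⁻¹ (G.src e) = cl.label ((2 : ℝ) ^ k)⁻¹ (G.base e) ∧
        cl.label ((2 : ℝ) ^ k)⁻¹ (G.src e) ≠ cl.label ((2 : ℝ) ^ k)⁻¹ (G.tgt e))
        (fun k h1 h2 => and_congr (hiff _ _ k h1 h2).symm (not_congr (hiff _ _ k h1 h2).symm)),
      scaleCount_and_not (scaleCount_le _ _) (P := fun k =>
        cl.label ((2 : ℝ) ^ k)⁻¹ (G.tgt e) = cl.label ((2 : ℝ) ^ k)⁻¹ (G.base e) ∧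
        cl.label ((2 : ℝ) ^ k)⁻¹ (G.src e) ≠ cl.label ((2 : ℝ) ^ k)⁻¹ (G.tgt e))
        (fun k h1 h2 => and_congr (hiff _ _ k h1 h2).symm (not_congr (hiff _ _ k h1 h2).symm))]
    ring

end LabelledGraph
end GenConv
end

noncomputable section
namespace GenConv

/-! ### The scaled norm -/

variable {d N : ℕ}

theorem scaling_pos (i : Fin (d + 1)) : 0 < scaling i := by
  unfold scaling; split_ifs <;> norm_num

theorem abs_rpow_le_scaledNorm (z : Fin (d + 1) → ℝ) (i : Fin (d + 1)) :
    |z i| ^ (1 / (scaling i : ℝ)) ≤ scaledNorm z :=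
  le_ciSup (f := fun i => |z i| ^ (1 / (scaling i : ℝ))) (Set.finite_range _).bddAbove i

theorem scaledNorm_nonneg (z : Fin (d + 1) → ℝ) : 0 ≤ scaledNorm z :=
  le_trans (by positivity) (abs_rpow_le_scaledNorm z 0)

theorem scaledNorm_le_iff {z : Fin (d + 1) → ℝ} {r : ℝ} (hr : 0 ≤ r) :
    scaledNorm z ≤ r ↔ ∀ i, |z i| ≤ r ^ scaling i := by
  have key : ∀ i, |z i| ^ (1 / (scaling i : ℝ)) ≤ r ↔ |z i| ≤ r ^ scaling i := fun i => by
    rw [one_div, Real.rpow_inv_le_iff_of_pos (abs_nonneg _) hr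
      (by exact_mod_cast scaling_pos i), Real.rpow_natCast]
  constructor
  · intro h i
    exact (key i).1 ((abs_rpow_le_scaledNorm z i).trans h)
  · intro h
    exact ciSup_le fun i => (key i).2 (h i)

theorem abs_le_scaledNorm_pow (z : Fin (d + 1) → ℝ) (i : Fin (d + 1)) :
    |z i| ≤ scaledNorm z ^ scaling i :=
  (scaledNorm_le_iff (scaledNorm_nonneg z)).1 le_rfl i

theorem scaledNorm_mono {z w : Fin (d + 1) → ℝ} (h : ∀ i, |z i| ≤ |w i|) :
    scaledNorm z ≤ scaledNorm w :=
  (scaledNorm_le_iff (scaledNorm_nonneg w)).2 fun i => (h i).trans (abs_le_scaledNorm_pow w i)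

theorem scaledNorm_congr {z w : Fin (d + 1) → ℝ} (h : ∀ i, |z i| = |w i|) :
    scaledNorm z = scaledNorm w :=
  le_antisymm (scaledNorm_mono fun i => (h i).le) (scaledNorm_mono fun i => (h i).ge)

theorem scaledNorm_zero : scaledNorm (0 : Fin (d + 1) → ℝ) = 0 :=
  le_antisymm ((scaledNorm_le_iff le_rfl).2 fun i => by simp [(scaling_pos i).ne'])
    (scaledNorm_nonneg _)

theorem scaledNorm_add_le (z w : Fin (d + 1) → ℝ) :
    scaledNorm (z + w) ≤ scaledNorm z + scaledNorm w := by
  have hz := scaledNorm_nonneg z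
  have hw := scaledNorm_nonneg w
  refine (scaledNorm_le_iff (by positivity)).2 fun i => ?_
  calc |(z + w) i| ≤ |z i| + |w i| := abs_add_le _ _
    _ ≤ scaledNorm z ^ scaling i + scaledNorm w ^ scaling i :=
      add_le_add (abs_le_scaledNorm_pow z i) (abs_le_scaledNorm_pow w i)
    _ ≤ _ := pow_add_pow_le hz hw (scaling_pos i).ne'

theorem abs_monomial_le (h : Fin (d + 1) → ℝ) (j : Fin (d + 1) → ℕ) :
    |monomial h j| ≤ scaledNorm h ^ scaledDegree j := by
  unfold monomial scaledDegree
  rw [Finset.abs_prod, ← Finset.prod_pow_eq_pow_sum]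
  refine Finset.prod_le_prod (fun _ _ => abs_nonneg _) fun i _ => ?_
  rw [abs_pow, pow_mul]
  exact pow_le_pow_left₀ (abs_nonneg _) (abs_le_scaledNorm_pow h i) _

theorem continuous_scaledNorm : Continuous (scaledNorm : (Fin (d + 1) → ℝ) → ℝ) := by
  have : (scaledNorm : (Fin (d + 1) → ℝ) → ℝ) = fun z =>
      Finset.univ.sup' Finset.univ_nonempty fun i => |z i| ^ (1 / (scaling i : ℝ)) := by
    ext z; rw [scaledNorm, Finset.sup'_univ_eq_ciSup]
  rw [this]
  refine Continuous.finset_sup'_apply _ fun i _ => ?_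
  exact (continuous_abs.comp (continuous_apply i)).rpow_const fun _ => Or.inr (by positivity)

/-! ### The norm on the torus -/

/-- The scaled distance to the lattice of spatial periods. -/
def torusNorm (z : Fin (d + 1) → ℝ) : ℝ := scaledNorm (torusRep z)

/-- The vector with integer spatial coordinates `m`. -/
def period (m : Fin d → ℤ) : Fin (d + 1) → ℝ := Fin.cons 0 fun i => (m i : ℝ)

theorem torusNorm_le_scaledNorm_sub (z : Fin (d + 1) → ℝ) (m : Fin d → ℤ) :
    torusNorm z ≤ scaledNorm (z - period m) := by
  refine scaledNorm_mono fun i => ?_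
  refine Fin.cases ?_ (fun i => ?_) i
  · simp [torusRep, period]
  · simpa [torusRep, period] using round_le (z i.succ) (m i)

theorem torusNorm_le_scaledNorm (z : Fin (d + 1) → ℝ) : torusNorm z ≤ scaledNorm z := by
  have h := torusNorm_le_scaledNorm_sub z 0
  have h0 : period (0 : Fin d → ℤ) = 0 := by
    ext i; refine Fin.cases ?_ (fun i => ?_) i <;> simp [period]
  rwa [h0, sub_zero] at h

theorem exists_torusRep_eq (z : Fin (d + 1) → ℝ) : ∃ m, torusRep z = z - period m := by
  refine ⟨fun i => round (z i.succ), ?_⟩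
  ext i
  refine Fin.cases ?_ (fun i => ?_) i <;> simp [torusRep, period]

theorem torusNorm_add_le (z w : Fin (d + 1) → ℝ) :
    torusNorm (z + w) ≤ torusNorm z + scaledNorm w := by
  obtain ⟨m, hm⟩ := exists_torusRep_eq z
  calc torusNorm (z + w) ≤ scaledNorm (z + w - period m) := torusNorm_le_scaledNorm_sub _ m
    _ = scaledNorm (torusRep z + w) := by rw [hm]; congr 1; abel
    _ ≤ _ := scaledNorm_add_le _ _

theorem torusNorm_add_period_le (z : Fin (d + 1) → ℝ) (m : Fin d → ℤ) :
    torusNorm (z + period m) ≤ torusNorm z := by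
  obtain ⟨l, hl⟩ := exists_torusRep_eq z
  have : z + period m - period (l + m) = torusRep z := by
    rw [hl]; ext i
    refine Fin.cases ?_ (fun i => ?_) i <;> simp [period]
  calc _ ≤ scaledNorm (z + period m - period (l + m)) := torusNorm_le_scaledNorm_sub _ _
    _ = torusNorm z := by rw [this, torusNorm]

theorem scaledNorm_neg (z : Fin (d + 1) → ℝ) : scaledNorm (-z) = scaledNorm z :=
  scaledNorm_congr fun i => by simp

/-- Although `torusRep` jumps at half-integers, the distance to a lattice is 1-Lipschitz for the
scaled norm. -/
theorem continuous_torusNorm : Continuous (torusNorm : (Fin (d + 1) → ℝ) → ℝ) := by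
  have h : ∀ z w : Fin (d + 1) → ℝ, torusNorm z - torusNorm w ≤ scaledNorm (z - w) := fun z w => by
    have := torusNorm_add_le w (z - w)
    rw [add_sub_cancel] at this
    linarith
  rw [continuous_iff_continuousAt]
  intro w
  have h0 : Filter.Tendsto (fun z => scaledNorm (z - w)) (nhds w) (nhds 0) := by
    have : Continuous fun z => scaledNorm (z - w) :=
      continuous_scaledNorm.comp (continuous_id.sub continuous_const)
    have h1 := this.tendsto w
    simpa [scaledNorm_zero] using h1
  rw [ContinuousAt, tendsto_iff_dist_tendsto_zero]
  refine squeeze_zero (fun _ => dist_nonneg) (fun z => ?_) h0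
  rw [Real.dist_eq, abs_le]
  constructor
  · have := h w z
    rw [← scaledNorm_neg, neg_sub] at this
    linarith
  · exact h z w

/-! ### Space-time points -/

theorem abs_le_abs_sub_int {x : ℝ} (hx : |x| ≤ 1 / 2) (m : ℤ) : |x| ≤ |x - m| := by
  rcases eq_or_ne m 0 with rfl | hm
  · simp
  · have h1 : (1 : ℝ) ≤ |(m : ℝ)| := by exact_mod_cast Int.one_le_abs hm
    have h2 : |(m : ℝ)| ≤ |x| + |x - m| := by
      have := abs_sub x (x - m)
      rwa [sub_sub_cancel] at this
    linarith

theorem abs_coord_succ_le (z : SpaceTime d N) (i : Fin d) : |coord z i.succ| ≤ 1 / 2 := by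
  simp only [coord, Fin.cons_succ, abs_div, abs_pow, abs_two]
  have h := ZMod.natAbs_valMinAbs_le (z.2 i)
  have h1 : |((z.2 i).valMinAbs : ℝ)| = ((z.2 i).valMinAbs.natAbs : ℝ) := by
    rw [Nat.cast_natAbs, Int.cast_abs]
  rw [h1, div_le_div_iff₀ (by positivity) (by norm_num)]
  have h2 : (z.2 i).valMinAbs.natAbs * 2 ≤ 1 * 2 ^ N := by omega
  exact_mod_cast h2

/-- The representatives have modulus at most 1/2, so no lattice translate is closer to 0. Bounds on
periodic functions can thus be evaluated at points of the discrete torus. -/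
theorem torusNorm_coord (z : SpaceTime d N) : torusNorm (coord z) = scaledNorm (coord z) := by
  refine le_antisymm (torusNorm_le_scaledNorm _) ?_
  obtain ⟨m, hm⟩ := exists_torusRep_eq (coord z)
  rw [torusNorm, hm]
  refine scaledNorm_mono fun i => ?_
  refine Fin.cases ?_ (fun i => ?_) i
  · simp [period]
  · simpa [period] using abs_le_abs_sub_int (abs_coord_succ_le z i) (m i)

/-- The representatives of a sum differ from the sum of the representatives by a multiple of 2^N
before rescaling, hence by an integer after it. -/
theorem coord_add (z w : SpaceTime d N) : ∃ m, coord (z + w) = coord z + coord w + period m := by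
  have key : ∀ i, ∃ m : ℤ, (((z + w).2 i).valMinAbs : ℝ) / 2 ^ N =
      ((z.2 i).valMinAbs : ℝ) / 2 ^ N + ((w.2 i).valMinAbs : ℝ) / 2 ^ N + m := fun i => by
    have h : (((((z + w).2 i).valMinAbs - ((z.2 i).valMinAbs + (w.2 i).valMinAbs) : ℤ)) :
        ZMod (2 ^ N)) = 0 := by
      push_cast
      simp only [Prod.snd_add, Pi.add_apply, sub_self]
    rw [ZMod.intCast_zmod_eq_zero_iff_dvd] at h
    obtain ⟨m, hm⟩ := h
    refine ⟨m, ?_⟩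
    have h1 : (((z + w).2 i).valMinAbs : ℝ) =
        (z.2 i).valMinAbs + (w.2 i).valMinAbs + 2 ^ N * m := by
      have := congrArg (Int.cast : ℤ → ℝ) hm
      push_cast at this
      linarith
    rw [h1]
    field_simp
  choose m hm using key
  refine ⟨m, ?_⟩
  ext i
  refine Fin.cases ?_ (fun i => ?_) i
  · simp [coord, period]
  · simpa [coord, period] using hm i

theorem scaledNorm_coord_add_le (z w : SpaceTime d N) :
    scaledNorm (coord (z + w)) ≤ scaledNorm (coord z) + scaledNorm (coord w) := by
  obtain ⟨m, hm⟩ := coord_add z w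
  rw [← torusNorm_coord, hm]
  exact (torusNorm_add_period_le _ _).trans
    ((torusNorm_le_scaledNorm _).trans (scaledNorm_add_le _ _))

theorem scaledNorm_coord_neg (z : SpaceTime d N) :
    scaledNorm (coord (-z)) = scaledNorm (coord z) := by
  refine scaledNorm_congr fun i => ?_
  refine Fin.cases ?_ (fun i => ?_) i
  · simp [coord]
  · simp only [coord, Fin.cons_succ, abs_div, Prod.snd_neg, Pi.neg_apply]
    congr 1
    have := ZMod.natAbs_valMinAbs_neg (z.2 i)
    have h1 : ∀ a : ℤ, |(a : ℝ)| = (a.natAbs : ℝ) := fun a => by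
      rw [Nat.cast_natAbs, Int.cast_abs]
    rw [h1, h1, this]

theorem coord_zero : coord (0 : SpaceTime d N) = 0 := by
  ext i
  refine Fin.cases ?_ (fun i => ?_) i <;> simp [coord]

/-- The distance between two points of space-time. -/
def stDist (z w : SpaceTime d N) : ℝ := scaledNorm (coord (z - w))

theorem stDist_self (z : SpaceTime d N) : stDist z z = 0 := by
  rw [stDist, sub_self, coord_zero, scaledNorm_zero]

theorem stDist_comm (z w : SpaceTime d N) : stDist z w = stDist w z := by
  rw [stDist, stDist, ← scaledNorm_coord_neg, neg_sub]

theorem stDist_triangle (x y z : SpaceTime d N) : stDist x z ≤ stDist x y + stDist y z := by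
  have := scaledNorm_coord_add_le (x - y) (y - z)
  rwa [sub_add_sub_cancel] at this

end GenConv
end

noncomputable section
namespace GenConv

/-! ### Taylor expansion, one coordinate after the other -/

/-- Here `g m` is the m-th derivative. The derivative of the remainder is the remainder of one order
less for `g 1`, and the mean value inequality supplies the missing factor |s|. The factorial in the
remainder is given up. -/
theorem abs_sub_taylor_le {r : ℕ} {g : ℕ → ℝ → ℝ}
    (hg : ∀ m s, HasDerivAt (g m) (g (m + 1) s) s) {M x : ℝ}
    (hM : ∀ s, |s| ≤ x → |g r s| ≤ M) :
    ∀ s, |s| ≤ x → |g 0 s - ∑ m ∈ Finset.range r, s ^ m / (m.factorial : ℝ) * g m 0| ≤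
      M * |s| ^ r := by
  induction r generalizing g with
  | zero => intro s hs; simpa using hM s hs
  | succ r ih =>
    intro s hs
    have hM0 : 0 ≤ M := (abs_nonneg _).trans (hM s hs)
    have h1 := ih (g := fun m => g (m + 1)) (fun m s => hg (m + 1) s) hM
    have hder : ∀ u, HasDerivAt
        (fun u => g 0 u - ∑ m ∈ Finset.range (r + 1), u ^ m / (m.factorial : ℝ) * g m 0)
        (g 1 u - ∑ m ∈ Finset.range r, u ^ m / (m.factorial : ℝ) * g (m + 1) 0) u := by
      intro u
      refine (hg 0 u).sub ?_
      have h2 : HasDerivAt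
          (fun u : ℝ => ∑ m ∈ Finset.range (r + 1), u ^ m / (m.factorial : ℝ) * g m 0)
          (∑ m ∈ Finset.range (r + 1), (m * u ^ (m - 1)) / (m.factorial : ℝ) * g m 0) u :=
        HasDerivAt.fun_sum fun m _ => ((hasDerivAt_pow m u).div_const _).mul_const _
      refine h2.congr_deriv ?_
      rw [Finset.sum_range_succ']
      simp only [Nat.cast_zero, zero_mul, zero_div, add_zero, Nat.add_sub_cancel]
      refine Finset.sum_congr rfl fun m _ => ?_
      rw [Nat.factorial_succ]
      push_cast
      have h3 : (m.factorial : ℝ) ≠ 0 := by positivity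
      have h4 : ((m : ℝ) + 1) ≠ 0 := by positivity
      field_simp
    have hmv := Convex.norm_image_sub_le_of_norm_hasDerivWithin_le
      (f := fun u => g 0 u - ∑ m ∈ Finset.range (r + 1), u ^ m / (m.factorial : ℝ) * g m 0)
      (C := M * |s| ^ r) (s := Metric.closedBall (0 : ℝ) |s|) (x := 0) (y := s)
      (fun u _ => (hder u).hasDerivWithinAt)
      (fun u hu => by
        have hu' : |u| ≤ |s| := by simpa using hu
        refine (h1 u (hu'.trans hs)).trans ?_
        gcongr)
      (convex_closedBall _ _) (by simp) (by simp)
    simp only [Real.norm_eq_abs, sub_zero] at hmv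
    have h0 : g 0 0 - ∑ m ∈ Finset.range (r + 1), (0 : ℝ) ^ m / (m.factorial : ℝ) * g m 0 = 0 := by
      rw [Finset.sum_range_succ']; simp
    rw [h0, sub_zero] at hmv
    calc _ ≤ M * |s| ^ r * |s| := hmv
      _ = _ := by ring

variable {d : ℕ}

/-- The partial derivative in the direction of the coordinate `i`. -/
def coordDeriv (i : Fin (d + 1)) (f : (Fin (d + 1) → ℝ) → ℝ) : (Fin (d + 1) → ℝ) → ℝ :=
  fun z => fderiv ℝ f z (Pi.single i 1)

/-- The iterated partial derivatives in the coordinates of a list. -/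
def listDeriv (l : List (Fin (d + 1))) (j : Fin (d + 1) → ℕ) (f : (Fin (d + 1) → ℝ) → ℝ) :
    (Fin (d + 1) → ℝ) → ℝ :=
  l.foldr (fun i g => (coordDeriv i)^[j i] g) f

theorem partialDeriv_eq_listDeriv (j : Fin (d + 1) → ℕ) (f : (Fin (d + 1) → ℝ) → ℝ) :
    partialDeriv j f = listDeriv (List.finRange (d + 1)) j f := rfl

theorem listDeriv_cons (i : Fin (d + 1)) (l : List (Fin (d + 1))) (j : Fin (d + 1) → ℕ)
    (f : (Fin (d + 1) → ℝ) → ℝ) :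
    listDeriv (i :: l) j f = (coordDeriv i)^[j i] (listDeriv l j f) := rfl

theorem listDeriv_congr {l : List (Fin (d + 1))} {j j' : Fin (d + 1) → ℕ}
    (h : ∀ i ∈ l, j i = j' i) (f : (Fin (d + 1) → ℝ) → ℝ) :
    listDeriv l j f = listDeriv l j' f := by
  induction l with
  | nil => rfl
  | cons i l ih =>
    rw [listDeriv_cons, listDeriv_cons, h i (by simp),
      ih fun k hk => h k (List.mem_cons_of_mem _ hk)]

theorem contDiff_coordDeriv {f : (Fin (d + 1) → ℝ) → ℝ} (hf : ContDiff ℝ ∞ f)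
    (i : Fin (d + 1)) : ContDiff ℝ ∞ (coordDeriv i f) :=
  (hf.fderiv_right (m := ∞) (by simp)).clm_apply contDiff_const

theorem contDiff_iterate_coordDeriv {f : (Fin (d + 1) → ℝ) → ℝ} (hf : ContDiff ℝ ∞ f)
    (i : Fin (d + 1)) (m : ℕ) : ContDiff ℝ ∞ ((coordDeriv i)^[m] f) := by
  induction m with
  | zero => exact hf
  | succ m ih => rw [Function.iterate_succ_apply']; exact contDiff_coordDeriv ih i

theorem contDiff_listDeriv {f : (Fin (d + 1) → ℝ) → ℝ} (hf : ContDiff ℝ ∞ f)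
    (l : List (Fin (d + 1))) (j : Fin (d + 1) → ℕ) : ContDiff ℝ ∞ (listDeriv l j f) := by
  induction l with
  | nil => exact hf
  | cons i l ih => exact contDiff_iterate_coordDeriv ih i _

theorem contDiff_partialDeriv {f : (Fin (d + 1) → ℝ) → ℝ} (hf : ContDiff ℝ ∞ f)
    (j : Fin (d + 1) → ℕ) : ContDiff ℝ ∞ (partialDeriv j f) :=
  contDiff_listDeriv hf _ j

theorem listDeriv_sum {ι : Type*} (s : Finset ι) {F : ι → (Fin (d + 1) → ℝ) → ℝ}
    (hF : ∀ n ∈ s, ContDiff ℝ ∞ (F n)) (l : List (Fin (d + 1))) (j : Fin (d + 1) → ℕ) :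
    listDeriv l j (fun z => ∑ n ∈ s, F n z) = fun z => ∑ n ∈ s, listDeriv l j (F n) z := by
  induction l with
  | nil => rfl
  | cons i l ih =>
    rw [listDeriv_cons, ih]
    have key : ∀ m, (coordDeriv i)^[m] (fun z => ∑ n ∈ s, listDeriv l j (F n) z) =
        fun z => ∑ n ∈ s, (coordDeriv i)^[m] (listDeriv l j (F n)) z := by
      intro m
      induction m with
      | zero => rfl
      | succ m ihm =>
        rw [Function.iterate_succ_apply', ihm]
        ext z
        have h1 : HasFDerivAt
            (fun z => ∑ n ∈ s, (coordDeriv i)^[m] (listDeriv l j (F n)) z)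
            (∑ n ∈ s, fderiv ℝ ((coordDeriv i)^[m] (listDeriv l j (F n))) z) z :=
          HasFDerivAt.fun_sum fun n hn =>
            ((contDiff_iterate_coordDeriv (contDiff_listDeriv (hF n hn) l j) i m).differentiable
              (by simp) z).hasFDerivAt
        unfold coordDeriv at h1 ⊢
        rw [h1.fderiv]
        simp only [Function.iterate_succ_apply', FunLike.coe_sum, Finset.sum_apply]
    rw [key]
    rfl

theorem partialDeriv_zero (f : (Fin (d + 1) → ℝ) → ℝ) : partialDeriv 0 f = f := by
  rw [partialDeriv_eq_listDeriv]
  induction List.finRange (d + 1) with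
  | nil => rfl
  | cons i l ih => rw [listDeriv_cons, ih]; rfl

/-- The Taylor coefficient `h^j / j!`. -/
def taylorCoeff (h : Fin (d + 1) → ℝ) (j : Fin (d + 1) → ℕ) : ℝ :=
  monomial h j / ((∏ i, (j i).factorial : ℕ) : ℝ)

theorem abs_taylorCoeff_le (h : Fin (d + 1) → ℝ) (j : Fin (d + 1) → ℕ) :
    |taylorCoeff h j| ≤ |monomial h j| := by
  rw [taylorCoeff, abs_div, Nat.abs_cast]
  refine div_le_self (abs_nonneg _) ?_
  exact_mod_cast Nat.one_le_iff_ne_zero.2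
    (Finset.prod_ne_zero_iff.2 fun i _ => (Nat.factorial_pos _).ne')

theorem monomial_update (h : Fin (d + 1) → ℝ) (j : Fin (d + 1) → ℕ) {i : Fin (d + 1)}
    (hi : j i = 0) (m : ℕ) : monomial h (Function.update j i m) = monomial h j * h i ^ m := by
  unfold monomial
  rw [← Finset.mul_prod_erase _ _ (Finset.mem_univ i),
    ← Finset.mul_prod_erase (a := i) Finset.univ (fun k => h k ^ j k) (Finset.mem_univ i), hi,
    Function.update_self, pow_zero, one_mul, mul_comm]
  congr 1
  exact Finset.prod_congr rfl fun k hk => by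
    rw [Function.update_of_ne (Finset.ne_of_mem_erase hk)]

theorem taylorCoeff_update (h : Fin (d + 1) → ℝ) (j : Fin (d + 1) → ℕ) {i : Fin (d + 1)}
    (hi : j i = 0) (m : ℕ) : taylorCoeff h (Function.update j i m) =
      taylorCoeff h j * (h i ^ m / (m.factorial : ℝ)) := by
  have h1 : (∏ k, (Function.update j i m k).factorial) = m.factorial * ∏ k, (j k).factorial := by
    rw [← Finset.mul_prod_erase _ _ (Finset.mem_univ i),
      ← Finset.mul_prod_erase (a := i) Finset.univ (fun k => (j k).factorial) (Finset.mem_univ i),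
      hi, Function.update_self, Nat.factorial_zero, one_mul]
    congr 1
    exact Finset.prod_congr rfl fun k hk => by
      rw [Function.update_of_ne (Finset.ne_of_mem_erase hk)]
  rw [taylorCoeff, taylorCoeff, h1, monomial_update h j hi]
  push_cast
  rw [mul_comm (m.factorial : ℝ), mul_div_mul_comm]

/-- The multi-indices with entries `< r`, supported in the coordinates of the list. -/
def boxIndices (l : List (Fin (d + 1))) (r : ℕ) : Finset (Fin (d + 1) → ℕ) :=
  Fintype.piFinset fun i => if i ∈ l then Finset.range r else {0}

theorem mem_boxIndices {l : List (Fin (d + 1))} {r : ℕ} {j : Fin (d + 1) → ℕ} :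
    j ∈ boxIndices l r ↔ ∀ i, (i ∈ l → j i < r) ∧ (i ∉ l → j i = 0) := by
  rw [boxIndices, Fintype.mem_piFinset]
  refine forall_congr' fun i => ?_
  by_cases h : i ∈ l <;> simp [h]

theorem sum_boxIndices_cons {i : Fin (d + 1)} {l : List (Fin (d + 1))} (hi : i ∉ l) (r : ℕ)
    (F : (Fin (d + 1) → ℕ) → ℝ) :
    ∑ j ∈ boxIndices (i :: l) r, F j =
      ∑ j ∈ boxIndices l r, ∑ m ∈ Finset.range r, F (Function.update j i m) := by
  rw [← Finset.sum_product']
  refine Finset.sum_bij' (fun j _ => (Function.update j i 0, j i))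
    (fun p _ => Function.update p.1 i p.2) ?_ ?_ ?_ ?_ ?_
  · intro j hj
    rw [mem_boxIndices] at hj
    rw [Finset.mem_product, mem_boxIndices, Finset.mem_range]
    refine ⟨fun k => ?_, (hj i).1 (by simp)⟩
    by_cases hk : k = i
    · subst hk; simp [hi]
    · simpa [hk] using hj k
  · rintro ⟨j, m⟩ hj
    rw [Finset.mem_product, mem_boxIndices, Finset.mem_range] at hj
    rw [mem_boxIndices]
    intro k
    by_cases hk : k = i
    · subst hk; simpa using hj.2
    · simpa [hk] using hj.1 k
  · intro j _; simp
  · rintro ⟨j, m⟩ hj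
    rw [Finset.mem_product, mem_boxIndices] at hj
    have : j i = 0 := (hj.1 i).2 hi
    simp [← this]
  · intro j _; simp

theorem hasDerivAt_iterate_coordDeriv {f : (Fin (d + 1) → ℝ) → ℝ} (hf : ContDiff ℝ ∞ f)
    (i : Fin (d + 1)) (y : Fin (d + 1) → ℝ) (m : ℕ) (s : ℝ) :
    HasDerivAt (fun s => (coordDeriv i)^[m] f (y + Pi.single i s))
      ((coordDeriv i)^[m + 1] f (y + Pi.single i s)) s := by
  have h1 := ((contDiff_iterate_coordDeriv hf i m).differentiable (by simp)
    (y + Pi.single i s)).hasFDerivAt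
  have h2 : HasDerivAt (fun s : ℝ => y + Pi.single i s) (Pi.single i (1 : ℝ)) s := by
    have : HasDerivAt (fun s : ℝ => (Pi.single i s : Fin (d + 1) → ℝ)) (Pi.single i (1 : ℝ)) s := by
      rw [hasDerivAt_pi]
      intro k
      by_cases hk : k = i
      · subst hk; simp only [Pi.single_eq_same]; exact hasDerivAt_id' s
      · simpa [hk] using hasDerivAt_const s (0 : ℝ)
    exact this.const_add y
  have h3 := h1.comp_hasDerivAt s h2
  rw [Function.iterate_succ_apply']
  exact h3

/-- The induction hypothesis expands in the coordinates of the tail around the point already shifted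
in the head coordinate; each of its r^{length} coefficients is then expanded in the head coordinate.
Every remainder is a derivative of order exactly r in some coordinate, so its scaled degree is at
least r, whatever the scaling. -/
theorem abs_sub_taylor_list_le {r : ℕ} {h : Fin (d + 1) → ℝ} {T : ℝ}
    {Bd : (Fin (d + 1) → ℕ) → ℝ} :
    ∀ (l : List (Fin (d + 1))), l.Nodup → ∀ (f : (Fin (d + 1) → ℝ) → ℝ), ContDiff ℝ ∞ f →
    ∀ (y : Fin (d + 1) → ℝ),
    (∀ j, (∀ i, j i ≤ r) → (∀ i, i ∉ l → j i = 0) → (∃ i ∈ l, j i = r) →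
      |monomial h j| * Bd j ≤ T) →
    (∀ j, (∀ i, j i ≤ r) → (∀ i, i ∉ l → j i = 0) → (∃ i ∈ l, j i = r) →
      ∀ w : Fin (d + 1) → ℝ, (∀ i, |w i| ≤ |h i|) → (∀ i, i ∉ l → w i = 0) →
        |listDeriv l j f (y + w)| ≤ Bd j) →
    |f (y + fun i => if i ∈ l then h i else 0) -
      ∑ j ∈ boxIndices l r, taylorCoeff h j * listDeriv l j f y| ≤
      (∑ k ∈ Finset.range l.length, (r : ℝ) ^ k) * T := by
  intro l
  induction l with
  | nil =>
    intro _ f _ y _ _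
    have h1 : boxIndices ([] : List (Fin (d + 1))) r = {0} := by
      ext j; simp [mem_boxIndices, funext_iff]
    have h2 : (y + fun i => if i ∈ ([] : List (Fin (d + 1))) then h i else 0) = y := by
      ext i; simp
    rw [h1, h2]
    simp [listDeriv, taylorCoeff, monomial]
  | cons i l ih =>
    intro hl f hf y hT hBd
    rw [List.nodup_cons] at hl
    have hsingle : ∀ s, |s| ≤ |h i| → ∀ k, |(Pi.single i s : Fin (d + 1) → ℝ) k| ≤ |h k| := by
      intro s hs k
      by_cases hk : k = i
      · subst hk; simpa using hs
      · simp [hk]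
    -- Error of expanding the tail coordinates around the shifted point.
    have e1 := ih hl.2 f hf (y + Pi.single i (h i))
      (fun j h1 h2 h3 => hT j h1 (fun k hk => h2 k fun h' => hk (List.mem_cons_of_mem _ h'))
        (h3.imp fun k hk => ⟨List.mem_cons_of_mem _ hk.1, hk.2⟩))
      (fun j h1 h2 h3 w hw hw0 => by
        have hji : j i = 0 := h2 i hl.1
        have := hBd j h1 (fun k hk => h2 k fun h' => hk (List.mem_cons_of_mem _ h'))
          (h3.imp fun k hk => ⟨List.mem_cons_of_mem _ hk.1, hk.2⟩) (Pi.single i (h i) + w)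
          (fun k => by
            by_cases hk : k = i
            · subst hk; simp [hw0 k hl.1]
            · simpa [hk] using hw k)
          (fun k hk => by
            have hki : k ≠ i := fun h' => hk (h' ▸ List.mem_cons_self)
            simp [hki, hw0 k fun h' => hk (List.mem_cons_of_mem _ h')])
        rw [listDeriv_cons, hji, ← add_assoc] at this
        exact this)
    have hsplit : (y + fun k => if k ∈ i :: l then h k else 0) =
        y + Pi.single i (h i) + fun k => if k ∈ l then h k else 0 := by
      ext k
      by_cases hk : k = i
      · subst hk; simp [hl.1]
      · simp [hk]
    -- Error of moving one coefficient back to y in the coordinate i.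
    have e2 : ∀ j ∈ boxIndices l r,
        |taylorCoeff h j * listDeriv l j f (y + Pi.single i (h i)) -
          ∑ m ∈ Finset.range r, taylorCoeff h (Function.update j i m) *
            listDeriv (i :: l) (Function.update j i m) f y| ≤ T := by
      intro j hj
      rw [mem_boxIndices] at hj
      have hji : j i = 0 := (hj i).2 hl.1
      have hupd : ∀ m, listDeriv l (Function.update j i m) f = listDeriv l j f := fun m =>
        listDeriv_congr (fun k hk => Function.update_of_ne (show k ≠ i from fun h' => hl.1 (h' ▸ hk)) _ _) f
      have hj1 : ∀ k, Function.update j i r k ≤ r := fun k => by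
        by_cases hk : k = i
        · subst hk; simp
        · simp only [Function.update_of_ne hk]
          by_cases hkl : k ∈ l
          · exact ((hj k).1 hkl).le
          · rw [(hj k).2 hkl]; exact Nat.zero_le _
      have hj2 : ∀ k, k ∉ i :: l → Function.update j i r k = 0 := fun k hk => by
        rw [List.mem_cons, not_or] at hk
        rw [Function.update_of_ne hk.1]; exact (hj k).2 hk.2
      have hj3 : ∃ k ∈ i :: l, Function.update j i r k = r := ⟨i, by simp, by simp⟩
      have h1 := abs_sub_taylor_le (r := r)
        (g := fun m s => (coordDeriv i)^[m] (listDeriv l j f) (y + Pi.single i s))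
        (fun m s => hasDerivAt_iterate_coordDeriv (contDiff_listDeriv hf l j) i y m s)
        (M := Bd (Function.update j i r)) (x := |h i|) (fun s hs => by
          have := hBd _ hj1 hj2 hj3 (Pi.single i s) (hsingle s hs)
            (fun k hk => by
              have hki : k ≠ i := fun h' => hk (h' ▸ List.mem_cons_self)
              simp [hki])
          rwa [listDeriv_cons, hupd, Function.update_self] at this) (h i) le_rfl
      simp only [Pi.single_zero, add_zero, Function.iterate_zero, id_eq] at h1
      have h2 : ∑ m ∈ Finset.range r, taylorCoeff h (Function.update j i m) *
            listDeriv (i :: l) (Function.update j i m) f y =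
          taylorCoeff h j * ∑ m ∈ Finset.range r, h i ^ m / (m.factorial : ℝ) *
            (coordDeriv i)^[m] (listDeriv l j f) y := by
        rw [Finset.mul_sum]
        refine Finset.sum_congr rfl fun m _ => ?_
        rw [taylorCoeff_update h j hji, listDeriv_cons, hupd, Function.update_self]
        ring
      rw [h2, ← mul_sub, abs_mul]
      calc _ ≤ |monomial h j| * (Bd (Function.update j i r) * |h i| ^ r) :=
            mul_le_mul (abs_taylorCoeff_le h j) h1 (abs_nonneg _) (abs_nonneg _)
        _ = |monomial h (Function.update j i r)| * Bd (Function.update j i r) := by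
            rw [monomial_update h j hji, abs_mul, abs_pow]; ring
        _ ≤ T := hT _ hj1 hj2 hj3
    have hcard : (boxIndices l r).card = r ^ l.length := by
      rw [boxIndices, Fintype.card_piFinset]
      have : ∀ k, (if k ∈ l then Finset.range r else {0}).card = if k ∈ l.toFinset then r else 1 :=
        fun k => by by_cases hk : k ∈ l <;> simp [hk]
      rw [Finset.prod_congr rfl fun k _ => this k, Finset.prod_ite_mem, Finset.univ_inter,
        Finset.prod_const, List.toFinset_card_of_nodup hl.2]
    rw [hsplit, sum_boxIndices_cons hl.1, List.length_cons, Finset.sum_range_succ, add_mul]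
    have e3 : |∑ j ∈ boxIndices l r, taylorCoeff h j * listDeriv l j f (y + Pi.single i (h i)) -
        ∑ j ∈ boxIndices l r, ∑ m ∈ Finset.range r, taylorCoeff h (Function.update j i m) *
            listDeriv (i :: l) (Function.update j i m) f y| ≤ (r : ℝ) ^ l.length * T := by
      rw [← Finset.sum_sub_distrib]
      refine (Finset.abs_sum_le_sum_abs _ _).trans ((Finset.sum_le_sum e2).trans (le_of_eq ?_))
      rw [Finset.sum_const, hcard, nsmul_eq_mul, Nat.cast_pow]
    exact (abs_sub_le _ _ _).trans (add_le_add e1 e3)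

/-- The anisotropic Taylor expansion of order `r`. -/
theorem abs_sub_taylor_box_le {r : ℕ} (h : Fin (d + 1) → ℝ) {T : ℝ}
    {Bd : (Fin (d + 1) → ℕ) → ℝ} {f : (Fin (d + 1) → ℝ) → ℝ} (hf : ContDiff ℝ ∞ f)
    (y : Fin (d + 1) → ℝ)
    (hT : ∀ j, (∀ i, j i ≤ r) → (∃ i, j i = r) → |monomial h j| * Bd j ≤ T)
    (hBd : ∀ j, (∀ i, j i ≤ r) → (∃ i, j i = r) →
      ∀ w : Fin (d + 1) → ℝ, (∀ i, |w i| ≤ |h i|) → |partialDeriv j f (y + w)| ≤ Bd j) :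
    |f (y + h) - ∑ j ∈ Fintype.piFinset fun _ => Finset.range r,
      taylorCoeff h j * partialDeriv j f y| ≤ (∑ k ∈ Finset.range (d + 1), (r : ℝ) ^ k) * T := by
  have := abs_sub_taylor_list_le (r := r) (h := h) (T := T) (Bd := Bd) (List.finRange (d + 1))
    (List.nodup_finRange _) f hf y (fun j h1 _ h3 => hT j h1 (h3.imp fun _ h => h.2))
    (fun j h1 _ h3 w hw _ => hBd j h1 (h3.imp fun _ h => h.2) w hw)
  simpa [boxIndices, ← partialDeriv_eq_listDeriv] using this

end GenConv
end

noncomputable section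
namespace GenConv

/-! ### Pointwise bounds on kernels -/

variable {d N q : ℕ}

theorem coordDeriv_eq_zero {f : (Fin (d + 1) → ℝ) → ℝ} {U : Set (Fin (d + 1) → ℝ)}
    (hU : IsOpen U) (hf : ∀ z ∈ U, f z = 0) (i : Fin (d + 1)) :
    ∀ z ∈ U, coordDeriv i f z = 0 := by
  intro z hz
  have h : f =ᶠ[nhds z] fun _ => (0 : ℝ) :=
    Filter.eventuallyEq_of_mem (hU.mem_nhds hz) fun w hw => hf w hw
  rw [coordDeriv, h.fderiv_eq]
  simp

theorem listDeriv_eq_zero {f : (Fin (d + 1) → ℝ) → ℝ} {U : Set (Fin (d + 1) → ℝ)}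
    (hU : IsOpen U) (hf : ∀ z ∈ U, f z = 0) (l : List (Fin (d + 1))) (j : Fin (d + 1) → ℕ) :
    ∀ z ∈ U, listDeriv l j f z = 0 := by
  induction l with
  | nil => exact hf
  | cons i l ih =>
    rw [listDeriv_cons]
    generalize j i = m
    induction m with
    | zero => exact ih
    | succ m ihm => rw [Function.iterate_succ_apply']; exact coordDeriv_eq_zero hU ihm i

/-- The support of a piece forces its index into this window, so at most three pieces contribute at
any point. -/
theorem card_dyadic_le_three (q : ℕ) (m : ℝ) :
    ((Finset.range q).filter fun n => m ≤ ((2 : ℝ) ^ n)⁻¹ ∧ ((2 : ℝ) ^ n)⁻¹ ≤ 4 * m).card ≤ 3 := by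
  rcases Finset.eq_empty_or_nonempty
    ((Finset.range q).filter fun n => m ≤ ((2 : ℝ) ^ n)⁻¹ ∧ ((2 : ℝ) ^ n)⁻¹ ≤ 4 * m) with h | h
  · rw [h]; simp
  · obtain ⟨n₀, hn₀, hmin⟩ := Finset.exists_min_image _ id h
    have : ((Finset.range q).filter fun n => m ≤ ((2 : ℝ) ^ n)⁻¹ ∧ ((2 : ℝ) ^ n)⁻¹ ≤ 4 * m) ⊆
        Finset.Icc n₀ (n₀ + 2) := by
      intro n hn
      rw [Finset.mem_Icc]
      refine ⟨hmin n hn, ?_⟩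
      simp only [Finset.mem_filter] at hn hn₀
      by_contra h'
      have h1 := inv_two_pow_anti (show n₀ + 3 ≤ n by omega)
      rw [pow_add, mul_inv] at h1
      have h2 : (0 : ℝ) < ((2 : ℝ) ^ n₀)⁻¹ := by positivity
      linarith [hn.2.1, hn₀.2.2]
    exact (Finset.card_le_card this).trans (by simp; omega)

theorem two_pow_rpow_le {m b : ℝ} {n : ℕ} (hm : 0 < m) (h1 : m ≤ ((2 : ℝ) ^ n)⁻¹)
    (h2 : ((2 : ℝ) ^ n)⁻¹ ≤ 4 * m) : (2 : ℝ) ^ (b * n) ≤ (4 : ℝ) ^ |b| * m ^ (-b) := by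
  have e : (2 : ℝ) ^ (b * n) = (((2 : ℝ) ^ n)⁻¹) ^ (-b) := by
    rw [Real.inv_rpow (by positivity), ← Real.rpow_neg (by positivity), neg_neg,
      ← Real.rpow_natCast, ← Real.rpow_mul (by norm_num), mul_comm]
  rw [e]
  rcases le_total 0 b with hb | hb
  · have h3 : (((2 : ℝ) ^ n)⁻¹) ^ (-b) ≤ m ^ (-b) :=
      Real.rpow_le_rpow_of_nonpos hm h1 (by linarith)
    have h4 : (1 : ℝ) ≤ (4 : ℝ) ^ |b| := Real.one_le_rpow (by norm_num) (abs_nonneg _)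
    have h5 : 0 ≤ m ^ (-b) := by positivity
    nlinarith
  · rw [abs_of_nonpos hb, ← Real.mul_rpow (by norm_num) hm.le]
    exact Real.rpow_le_rpow (by positivity) h2 (by linarith)

namespace Kernel

/-- The sum of the smooth pieces of a kernel. -/
def smoothPart (K : Kernel d N q) (z : Fin (d + 1) → ℝ) : ℝ := ∑ n ∈ Finset.range q, K.piece n z

/-- The bounds are non-strict inequalities that are upward closed in C, so the infimum is itself
admissible. -/
theorem HasOrder.hasBound_norm {K : Kernel d N q} {a : ℝ} (hK : K.HasOrder a) (p : ℕ) :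
    K.HasBound a p (K.norm a p) := by
  have hne : {C | K.HasBound a p C}.Nonempty := hK p
  exact ⟨fun n hn j hj z => le_csInf hne fun C hC => hC.1 n hn j hj z,
    fun z => le_csInf hne fun C hC => hC.2 z⟩

theorem HasOrder.norm_nonneg {K : Kernel d N q} {a : ℝ} (hK : K.HasOrder a) (p : ℕ) :
    0 ≤ K.norm a p :=
  le_trans (by positivity) ((hK.hasBound_norm p).2 0)

theorem partialDeriv_piece_support (K : Kernel d N q) {n : ℕ} (hn : n < q)
    (j : Fin (d + 1) → ℕ) (z : Fin (d + 1) → ℝ) (h : partialDeriv j (K.piece n) z ≠ 0) :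
    ((2 : ℝ) ^ (n + 2))⁻¹ ≤ torusNorm z ∧ torusNorm z ≤ ((2 : ℝ) ^ n)⁻¹ := by
  by_contra h'
  refine h (listDeriv_eq_zero
    (U := torusNorm ⁻¹' (Set.Icc ((2 : ℝ) ^ (n + 2))⁻¹ ((2 : ℝ) ^ n)⁻¹)ᶜ)
    (isClosed_Icc.isOpen_compl.preimage continuous_torusNorm) (fun w hw => ?_) _ _ z h')
  by_contra h0
  exact hw (K.piece_support n hn w h0)

/-- The bound on the derivatives of the smooth part of a kernel. -/
theorem abs_sum_partialDeriv_le {K : Kernel d N q} {a : ℝ} (hK : K.HasOrder a) {p : ℕ}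
    (j : Fin (d + 1) → ℕ) (hj : ∑ i, j i ≤ p) (z : Fin (d + 1) → ℝ) :
    ∑ n ∈ Finset.range q, |partialDeriv j (K.piece n) z| ≤
      3 * (4 : ℝ) ^ |a + scaledDegree j| * K.norm a p *
        (max (torusNorm z) ((2 : ℝ) ^ q)⁻¹) ^ (-(a + scaledDegree j)) := by
  set m := max (torusNorm z) ((2 : ℝ) ^ q)⁻¹ with hm
  set b := a + scaledDegree j with hb
  have hm0 : 0 < m := lt_of_lt_of_le (by positivity) (le_max_right _ _)
  have hnm := hK.norm_nonneg p
  set X := (4 : ℝ) ^ |b| * K.norm a p * m ^ (-b) with hX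
  have hX0 : 0 ≤ X := by positivity
  calc ∑ n ∈ Finset.range q, |partialDeriv j (K.piece n) z|
      ≤ ∑ n ∈ Finset.range q,
        (if m ≤ ((2 : ℝ) ^ n)⁻¹ ∧ ((2 : ℝ) ^ n)⁻¹ ≤ 4 * m then X else 0) := by
        refine Finset.sum_le_sum fun n hn => ?_
        rw [Finset.mem_range] at hn
        by_cases h0 : partialDeriv j (K.piece n) z = 0
        · rw [h0, abs_zero]; split_ifs <;> [exact hX0; exact le_rfl]
        · obtain ⟨h1, h2⟩ := K.partialDeriv_piece_support hn j z h0
          have h3 : m ≤ ((2 : ℝ) ^ n)⁻¹ := max_le h2 (inv_two_pow_anti hn.le)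
          have h4 : ((2 : ℝ) ^ n)⁻¹ ≤ 4 * m := by
            rw [pow_add, mul_inv] at h1
            linarith [le_max_left (torusNorm z) ((2 : ℝ) ^ q)⁻¹]
          rw [if_pos ⟨h3, h4⟩]
          have h5 := (hK.hasBound_norm p).1 n hn j hj z
          rw [Real.rpow_neg (by norm_num), inv_mul_le_iff₀ (by positivity)] at h5
          have h6 := two_pow_rpow_le (b := b) hm0 h3 h4
          calc _ ≤ (2 : ℝ) ^ (b * n) * K.norm a p := h5
            _ ≤ ((4 : ℝ) ^ |b| * m ^ (-b)) * K.norm a p := by gcongr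
            _ = X := by rw [hX]; ring
    _ ≤ 3 * X := by
        rw [← Finset.sum_filter, Finset.sum_const, nsmul_eq_mul]
        gcongr
        exact_mod_cast card_dyadic_le_three q m
    _ = _ := by rw [hX]; ring

theorem abs_last_le {K : Kernel d N q} {a : ℝ} (hK : K.HasOrder a) (p : ℕ)
    (z : SpaceTime d N) :
    |K.last z| ≤ K.norm a p * (max (scaledNorm (coord z)) ((2 : ℝ) ^ q)⁻¹) ^ (-a) := by
  have hnm := hK.norm_nonneg p
  by_cases h0 : K.last z = 0
  · rw [h0, abs_zero]
    have : 0 < max (scaledNorm (coord z)) ((2 : ℝ) ^ q)⁻¹ :=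
      lt_of_lt_of_le (by positivity) (le_max_right _ _)
    positivity
  · rw [max_eq_right (K.last_support z h0)]
    have h5 := (hK.hasBound_norm p).2 z
    rw [Real.rpow_neg (by norm_num), inv_mul_le_iff₀ (by positivity)] at h5
    have e : (2 : ℝ) ^ (a * q) = (((2 : ℝ) ^ q)⁻¹) ^ (-a) := by
      rw [Real.inv_rpow (by positivity), ← Real.rpow_neg (by positivity), neg_neg,
        ← Real.rpow_natCast, ← Real.rpow_mul (by norm_num), mul_comm]
    rw [← e]; linarith

theorem deriv_eq (K : Kernel d N q) {j : Fin (d + 1) → ℕ} {z : SpaceTime d N} (hz : z ≠ 0) :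
    K.deriv j z = (∑ n ∈ Finset.range q, partialDeriv j (K.piece n) (coord z)) +
      if j = 0 then K.last z else 0 := by
  unfold deriv
  split_ifs with h
  · rw [K.sum_eq z hz, h]; simp [partialDeriv_zero]
  · simp

/-- The bound on the derivatives of a kernel. -/
theorem abs_deriv_le {K : Kernel d N q} {a : ℝ} (hK : K.HasOrder a) {p : ℕ}
    (j : Fin (d + 1) → ℕ) (hj : ∑ i, j i ≤ p) {z : SpaceTime d N} (hz : z ≠ 0) :
    |K.deriv j z| ≤ (3 * (4 : ℝ) ^ |a + scaledDegree j| + 1) * K.norm a p *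
        (max (scaledNorm (coord z)) ((2 : ℝ) ^ q)⁻¹) ^ (-(a + scaledDegree j)) := by
  rw [K.deriv_eq hz]
  have h1 := abs_sum_partialDeriv_le hK j hj (coord z)
  rw [torusNorm_coord] at h1
  have hnm := hK.norm_nonneg p
  have hm0 : 0 < max (scaledNorm (coord z)) ((2 : ℝ) ^ q)⁻¹ :=
    lt_of_lt_of_le (by positivity) (le_max_right _ _)
  have h2 : |if j = 0 then K.last z else 0| ≤ K.norm a p *
      (max (scaledNorm (coord z)) ((2 : ℝ) ^ q)⁻¹) ^ (-(a + scaledDegree j)) := by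
    split_ifs with h
    · have := abs_last_le hK p z
      rw [h]; simpa [scaledDegree] using this
    · rw [abs_zero]; positivity
  have h3 := Finset.abs_sum_le_sum_abs
    (fun n => partialDeriv j (K.piece n) (coord z)) (Finset.range q)
  calc _ ≤ _ := abs_add_le _ _
    _ ≤ _ := add_le_add (h3.trans h1) h2
    _ = _ := by ring

theorem abs_toFun_le {K : Kernel d N q} {a : ℝ} (hK : K.HasOrder a) (p : ℕ)
    {z : SpaceTime d N} (hz : z ≠ 0) :
    |K.toFun z| ≤ (3 * (4 : ℝ) ^ |a| + 1) * K.norm a p *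
        (max (scaledNorm (coord z)) ((2 : ℝ) ^ q)⁻¹) ^ (-a) := by
  have := abs_deriv_le hK (p := p) 0 (by simp) hz
  simpa [deriv, scaledDegree] using this

theorem deriv_support (K : Kernel d N q) {j : Fin (d + 1) → ℕ} {z : SpaceTime d N}
    (h : K.deriv j z ≠ 0) : scaledNorm (coord z) ≤ 1 := by
  have hone : ∀ n, ((2 : ℝ) ^ n)⁻¹ ≤ 1 := fun n => by
    simpa using inv_two_pow_anti (Nat.zero_le n)
  by_cases hz : z = 0
  · rw [hz, coord_zero, scaledNorm_zero]; norm_num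
  · rw [K.deriv_eq hz] at h
    by_cases h1 : ∑ n ∈ Finset.range q, partialDeriv j (K.piece n) (coord z) = 0
    · rw [h1, zero_add] at h
      have h2 : K.last z ≠ 0 := by
        intro h'; rw [h'] at h; simp at h
      exact (K.last_support z h2).trans (hone q)
    · obtain ⟨n, hn, h2⟩ := Finset.exists_ne_zero_of_sum_ne_zero h1
      have := K.partialDeriv_piece_support (Finset.mem_range.1 hn) j _ h2
      rw [torusNorm_coord] at this
      exact this.2.trans (hone n)

theorem toFun_support (K : Kernel d N q) {z : SpaceTime d N} (h : K.toFun z ≠ 0) :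
    scaledNorm (coord z) ≤ 1 :=
  K.deriv_support (j := 0) (by simpa [deriv] using h)

theorem recentred_zero (K : Kernel d N q) (zm zp zv : SpaceTime d N) :
    K.recentred 0 zm zp zv = K.toFun (zp - zm) := by
  simp [recentred, lowIndices]

theorem mem_lowIndices {r : ℕ} {j : Fin (d + 1) → ℕ} :
    j ∈ lowIndices d r ↔ (∀ i, j i < r) ∧ scaledDegree j < r := by
  simp [lowIndices, Fintype.mem_piFinset]

theorem sum_le_of_le {r : ℕ} {j : Fin (d + 1) → ℕ} (h : ∀ i, j i ≤ r) :
    ∑ i, j i ≤ (d + 1) * r := by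
  calc ∑ i, j i ≤ ∑ _i : Fin (d + 1), r := Finset.sum_le_sum fun i _ => h i
    _ = _ := by simp

/-- The crude bound on a recentred kernel. -/
theorem abs_recentred_le {a : ℝ} (ha : 0 ≤ a) (r : ℕ) {p : ℕ} (hp : (d + 1) * r ≤ p) :
    ∃ C : ℝ, 0 ≤ C ∧ ∀ {N q : ℕ} (K : Kernel d N q), K.HasOrder a →
      ∀ zm zp zv : SpaceTime d N, zp - zm ≠ 0 → zv - zm ≠ 0 →
      |K.recentred r zm zp zv| ≤ C * K.norm a p *
        ((max (scaledNorm (coord (zp - zm))) ((2 : ℝ) ^ q)⁻¹) ^ (-a) +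
          ∑ j ∈ lowIndices d r, scaledNorm (coord (zp - zv)) ^ scaledDegree j *
            (max (scaledNorm (coord (zv - zm))) ((2 : ℝ) ^ q)⁻¹) ^ (-(a + scaledDegree j))) := by
  refine ⟨3 * (4 : ℝ) ^ (a + r) + 1, by positivity, ?_⟩
  intro N q K hK zm zp zv h1 h2
  have hnm := hK.norm_nonneg p
  have hm1 : 0 < max (scaledNorm (coord (zp - zm))) ((2 : ℝ) ^ q)⁻¹ :=
    lt_of_lt_of_le (by positivity) (le_max_right _ _)
  have hm2 : 0 < max (scaledNorm (coord (zv - zm))) ((2 : ℝ) ^ q)⁻¹ :=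
    lt_of_lt_of_le (by positivity) (le_max_right _ _)
  rw [recentred, mul_add, Finset.mul_sum]
  refine (abs_sub _ _).trans (add_le_add ?_ ?_)
  · refine (abs_toFun_le hK p h1).trans ?_
    rw [abs_of_nonneg ha]
    gcongr
    · norm_num
    · linarith [(Nat.cast_nonneg r : (0 : ℝ) ≤ r)]
  · refine (Finset.abs_sum_le_sum_abs _ _).trans (Finset.sum_le_sum fun j hj => ?_)
    rw [mem_lowIndices] at hj
    rw [abs_mul]
    have hjr : (scaledDegree j : ℝ) ≤ r := by exact_mod_cast hj.2.le
    have e1 : |K.deriv j (zv - zm)| ≤ (3 * (4 : ℝ) ^ (a + r) + 1) * K.norm a p *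
        (max (scaledNorm (coord (zv - zm))) ((2 : ℝ) ^ q)⁻¹) ^ (-(a + scaledDegree j)) := by
      refine (abs_deriv_le hK j ((sum_le_of_le fun i => (hj.1 i).le).trans hp) h2).trans ?_
      rw [abs_of_nonneg (by positivity : 0 ≤ a + scaledDegree j)]
      gcongr
      norm_num
    have e2 := (abs_taylorCoeff_le (coord (zp - zv)) j).trans (abs_monomial_le _ _)
    unfold taylorCoeff at e2
    calc _ ≤ scaledNorm (coord (zp - zv)) ^ scaledDegree j * _ :=
          mul_le_mul e2 e1 (abs_nonneg _) (by have := scaledNorm_nonneg (coord (zp - zv)); positivity)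
      _ = _ := by ring

theorem smoothPart_add_period (K : Kernel d N q) (z : Fin (d + 1) → ℝ) (m : Fin d → ℤ) :
    K.smoothPart (z + period m) = K.smoothPart z := by
  refine Finset.sum_congr rfl fun n hn => ?_
  rw [Finset.mem_range] at hn
  have key : ∀ s : Finset (Fin d), K.piece n (z + ∑ i ∈ s, (m i) • (Pi.single i.succ (1 : ℝ) :
      Fin (d + 1) → ℝ)) = K.piece n z := by
    intro s
    induction s using Finset.induction_on with
    | empty => simp
    | insert i s his ih =>
      rw [Finset.sum_insert his, add_comm (m i • _), ← add_assoc]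
      rw [((K.periodic n hn i).zsmul (m i)) _, ih]
  have hper : period m = ∑ i, (m i) • (Pi.single i.succ (1 : ℝ) : Fin (d + 1) → ℝ) := by
    ext k
    rw [Finset.sum_apply]
    refine Fin.cases ?_ (fun k => ?_) k
    · simp [period, (Fin.succ_ne_zero _).symm]
    · simp [period, Pi.single_apply, Fin.succ_inj]
  rw [hper]; exact key Finset.univ

theorem contDiff_smoothPart (K : Kernel d N q) : ContDiff ℝ ∞ K.smoothPart :=
  ContDiff.sum fun n hn => K.smooth n (Finset.mem_range.1 hn)

theorem partialDeriv_smoothPart (K : Kernel d N q) (j : Fin (d + 1) → ℕ)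
    (z : Fin (d + 1) → ℝ) : partialDeriv j K.smoothPart z =
      ∑ n ∈ Finset.range q, partialDeriv j (K.piece n) z := by
  simp only [partialDeriv_eq_listDeriv]
  have := listDeriv_sum (Finset.range q) (fun n hn => K.smooth n (Finset.mem_range.1 hn))
    (List.finRange (d + 1)) j
  exact congrFun this z

end Kernel
end GenConv
end

/-! ### The Taylor bound on recentred kernels. -/

noncomputable section
namespace GenConv

variable {d N q : ℕ}

theorem le_scaledDegree {j : Fin (d + 1) → ℕ} (i : Fin (d + 1)) : j i ≤ scaledDegree j := by
  unfold scaledDegree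
  calc j i ≤ scaling i * j i := Nat.le_mul_of_pos_left _ (scaling_pos i)
    _ ≤ _ := Finset.single_le_sum (f := fun i => scaling i * j i) (fun _ _ => Nat.zero_le _)
        (Finset.mem_univ i)

theorem scaledDegree_le (j : Fin (d + 1) → ℕ) : scaledDegree j ≤ 2 * ∑ i, j i := by
  unfold scaledDegree
  rw [Finset.mul_sum]
  refine Finset.sum_le_sum fun i _ => Nat.mul_le_mul_right _ ?_
  unfold scaling; split_ifs <;> norm_num

namespace Kernel

theorem torusNorm_neg_add_le (z w : Fin (d + 1) → ℝ) :
    torusNorm z - scaledNorm w ≤ torusNorm (z + w) := by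
  have := torusNorm_add_le (z + w) (-w)
  rw [scaledNorm_neg, add_neg_cancel_right] at this
  linarith

theorem rpow_neg_add_natCast {x a : ℝ} (hx : 0 < x) (k : ℕ) :
    x ^ (-(a + k)) = x ^ (-a) / x ^ k := by
  rw [neg_add, Real.rpow_add hx, Real.rpow_neg hx.le (k : ℝ), Real.rpow_natCast, div_eq_mul_inv]

/-- The bound on a recentred kernel by the remainder of the Taylor expansion. -/
theorem abs_recentred_le_taylor {a : ℝ} (ha : 0 ≤ a) (r : ℕ) {p : ℕ}
    (hp : (d + 1) * r ≤ p) :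
    ∃ C : ℝ, 0 ≤ C ∧ ∀ {N q : ℕ} (K : Kernel d N q), K.HasOrder a →
      ∀ zm zp zv : SpaceTime d N,
      scaledNorm (coord (zp - zv)) ≤ scaledNorm (coord (zv - zm)) / 2 →
      4 * ((2 : ℝ) ^ q)⁻¹ ≤ scaledNorm (coord (zv - zm)) →
      |K.recentred r zm zp zv| ≤ C * K.norm a p *
        ((scaledNorm (coord (zp - zv)) / scaledNorm (coord (zv - zm))) ^ r *
          scaledNorm (coord (zv - zm)) ^ (-a)) := by
  -- b dominates all exponents a + |j|_𝔰 with entries j_i ≤ r. In the constant 8^b, a factor 4 stems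
  -- from the dyadic sum and a factor 2 from moving the argument by at most half of B.
  set b : ℝ := a + 2 * ((d + 1) * r : ℕ) with hb
  have hb0 : 0 ≤ b := by positivity
  set C₀ : ℝ := 3 * (8 : ℝ) ^ b with hC₀
  refine ⟨C₀ * (∑ k ∈ Finset.range (d + 1), (r : ℝ) ^ k) + C₀ * (r : ℝ) ^ (d + 1),
    by positivity, ?_⟩
  intro N q K hK zm zp zv hDB hBq
  have hnm := hK.norm_nonneg p
  set D := scaledNorm (coord (zp - zv)) with hD
  set B := scaledNorm (coord (zv - zm)) with hB
  have hq0 : (0 : ℝ) < ((2 : ℝ) ^ q)⁻¹ := by positivity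
  have hB0 : 0 < B := by linarith
  have hD0 : 0 ≤ D := scaledNorm_nonneg _
  have hratio : D / B ≤ 1 := by rw [div_le_one hB0]; linarith
  have hratio0 : 0 ≤ D / B := by positivity
  set y := coord (zv - zm) with hy
  set h := coord (zp - zv) with hh
  have hty : torusNorm y = B := torusNorm_coord _
  have hA : B / 2 ≤ scaledNorm (coord (zp - zm)) := by
    have := scaledNorm_coord_add_le (zp - zm) (-(zp - zv))
    rw [scaledNorm_coord_neg] at this
    have e : zp - zm + -(zp - zv) = zv - zm := by abel
    rw [e] at this
    linarith
  have hzv : zv - zm ≠ 0 := fun h0 => by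
    rw [hB, hy, h0, coord_zero, scaledNorm_zero] at hB0; exact lt_irrefl _ hB0
  have hzp : zp - zm ≠ 0 := fun h0 => by
    rw [h0, coord_zero, scaledNorm_zero] at hA; linarith
  -- Since B/2 exceeds 2^{-q}, the finest piece, which need not be differentiable, plays no role
  -- here.
  have hlast : ∀ z : SpaceTime d N, B / 2 ≤ scaledNorm (coord z) → K.last z = 0 := fun z hz => by
    by_contra h0
    have := K.last_support z h0
    linarith
  -- the derivatives near the base point
  have hder : ∀ j : Fin (d + 1) → ℕ, (∀ i, j i ≤ r) → ∀ w : Fin (d + 1) → ℝ,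
      (∀ i, |w i| ≤ |h i|) → |partialDeriv j K.smoothPart (y + w)| ≤
        C₀ * K.norm a p * B ^ (-(a + scaledDegree j)) := by
    intro j hj w hw
    have hsum := sum_le_of_le hj
    have hdeg : a + scaledDegree j ≤ b := by
      have := (scaledDegree_le j).trans (Nat.mul_le_mul_left 2 hsum)
      rw [hb]
      have h' : (scaledDegree j : ℝ) ≤ 2 * ((d + 1) * r : ℕ) := by exact_mod_cast this
      linarith
    have hdeg0 : 0 ≤ a + scaledDegree j := by positivity
    rw [partialDeriv_smoothPart]
    refine (Finset.abs_sum_le_sum_abs _ _).trans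
      ((abs_sum_partialDeriv_le hK j (hsum.trans hp) (y + w)).trans ?_)
    have h1 : B / 2 ≤ max (torusNorm (y + w)) ((2 : ℝ) ^ q)⁻¹ := by
      refine le_trans ?_ (le_max_left _ _)
      have h2 := torusNorm_neg_add_le y w
      have h3 := scaledNorm_mono hw
      rw [hty] at h2
      linarith
    have h4 : (max (torusNorm (y + w)) ((2 : ℝ) ^ q)⁻¹) ^ (-(a + scaledDegree j)) ≤
        (2 : ℝ) ^ (a + scaledDegree j) * B ^ (-(a + scaledDegree j)) := by
      refine (Real.rpow_le_rpow_of_nonpos (by positivity) h1 (by linarith)).trans (le_of_eq ?_)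
      rw [Real.div_rpow hB0.le (by norm_num),
        Real.rpow_neg (zero_le_two : (0 : ℝ) ≤ 2) (a + scaledDegree j), div_inv_eq_mul, mul_comm]
    rw [abs_of_nonneg hdeg0]
    calc _ ≤ 3 * (4 : ℝ) ^ (a + scaledDegree j) * K.norm a p *
          ((2 : ℝ) ^ (a + scaledDegree j) * B ^ (-(a + scaledDegree j))) := by gcongr
      _ = 3 * (8 : ℝ) ^ (a + scaledDegree j) * K.norm a p * B ^ (-(a + scaledDegree j)) := by
        rw [show (8 : ℝ) = 4 * 2 by norm_num, Real.mul_rpow (by norm_num) (by norm_num)]; ring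
      _ ≤ _ := by
        rw [hC₀]; gcongr; norm_num
  set T := C₀ * K.norm a p * ((D / B) ^ r * B ^ (-a)) with hT
  have hT0 : 0 ≤ T := by positivity
  -- As D ≤ B, degree r is the worst case.
  have hterm : ∀ j : Fin (d + 1) → ℕ, r ≤ scaledDegree j →
      D ^ scaledDegree j * (C₀ * K.norm a p * B ^ (-(a + scaledDegree j))) ≤ T := by
    intro j hj
    rw [rpow_neg_add_natCast hB0, hT]
    calc _ = C₀ * K.norm a p * ((D / B) ^ scaledDegree j * B ^ (-a)) := by rw [div_pow]; ring
      _ ≤ _ := by gcongr C₀ * K.norm a p * (?_ * _); exact pow_le_pow_of_le_one hratio0 hratio hj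
  have e1 := abs_sub_taylor_box_le (r := r) h (T := T)
    (Bd := fun j => C₀ * K.norm a p * B ^ (-(a + scaledDegree j)))
    K.contDiff_smoothPart y (fun j _ hj => by
      obtain ⟨i, hi⟩ := hj
      refine le_trans ?_ (hterm j (hi ▸ le_scaledDegree i))
      gcongr
      exact abs_monomial_le h j)
    (fun j hj _ w hw => hder j hj w hw)
  have hlow : lowIndices d r ⊆ Fintype.piFinset fun _ => Finset.range r := Finset.filter_subset _ _
  -- The box expansion contains indices of scaled degree at least r, which the recentred kernel does
  -- not subtract; they are as small as the remainder and join it.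
  have e2 : |∑ j ∈ (Fintype.piFinset fun _ => Finset.range r) \ lowIndices d r,
      taylorCoeff h j * partialDeriv j K.smoothPart y| ≤ (r : ℝ) ^ (d + 1) * T := by
    calc _ ≤ ∑ j ∈ (Fintype.piFinset fun _ => Finset.range r) \ lowIndices d r, T := by
          refine (Finset.abs_sum_le_sum_abs _ _).trans (Finset.sum_le_sum fun j hj => ?_)
          rw [Finset.mem_sdiff, mem_lowIndices, Fintype.mem_piFinset] at hj
          simp only [Finset.mem_range] at hj
          have hj2 : r ≤ scaledDegree j := not_lt.1 fun h' => hj.2 ⟨hj.1, h'⟩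
          rw [abs_mul]
          refine le_trans ?_ (hterm j hj2)
          refine mul_le_mul ((abs_taylorCoeff_le h j).trans (abs_monomial_le h j)) ?_
            (abs_nonneg _) (by positivity)
          have := hder j (fun i => (hj.1 i).le) 0 (fun i => by simp)
          rwa [add_zero] at this
      _ = (((Fintype.piFinset fun _ => Finset.range r) \ lowIndices d r).card : ℝ) * T := by
          rw [Finset.sum_const, nsmul_eq_mul]
      _ ≤ _ := by
          gcongr
          have : ((Fintype.piFinset fun _ : Fin (d + 1) => Finset.range r) \
              lowIndices d r).card ≤ r ^ (d + 1) :=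
            (Finset.card_le_card Finset.sdiff_subset).trans (by simp [Fintype.card_piFinset])
          exact_mod_cast this
  -- The point y + h may differ from `coord (zp - zm)` by a spatial period, to which the smooth
  -- pieces are blind.
  have hrec : K.recentred r zm zp zv = K.smoothPart (y + h) -
      ∑ j ∈ lowIndices d r, taylorCoeff h j * partialDeriv j K.smoothPart y := by
    unfold recentred
    congr 1
    · rw [K.sum_eq _ hzp, hlast _ hA, add_zero]
      obtain ⟨m, hm⟩ := coord_add (zv - zm) (zp - zv)
      rw [show zv - zm + (zp - zv) = zp - zm by abel] at hm
      rw [hm]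
      exact K.smoothPart_add_period _ m
    · refine Finset.sum_congr rfl fun j _ => ?_
      rw [K.deriv_eq hzv, partialDeriv_smoothPart, hlast _ (by linarith), ite_self, add_zero]
      rfl
  rw [hrec, ← Finset.sum_sdiff hlow] at *
  rw [← sub_sub] at e1
  have e3 := abs_sub_abs_le_abs_sub (K.smoothPart (y + h) -
      ∑ j ∈ lowIndices d r, taylorCoeff h j * partialDeriv j K.smoothPart y)
      (∑ j ∈ (Fintype.piFinset fun _ => Finset.range r) \ lowIndices d r,
      taylorCoeff h j * partialDeriv j K.smoothPart y)
  rw [sub_right_comm] at e3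
  calc _ ≤ (∑ k ∈ Finset.range (d + 1), (r : ℝ) ^ k) * T + (r : ℝ) ^ (d + 1) * T := by
        linarith
    _ = _ := by rw [hT]; ring

end Kernel
end GenConv
end

noncomputable section
namespace GenConv

variable {d N q : ℕ}

/-! ### Bounds in terms of scales -/

/-- The number `n ≤ N` is the index of the scale of the length `A`, up to the factor `Q`. -/
structure IsScaleOf (N : ℕ) (Q A : ℝ) (n : ℕ) : Prop where
  le : n ≤ N
  lower : (2 : ℝ) ^ (-(n : ℝ) - 1) ≤ max A ((2 : ℝ) ^ N)⁻¹
  upper : A ≤ Q * (2 : ℝ) ^ (-(n : ℝ))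

theorem inv_two_pow_eq_rpow (n : ℕ) : ((2 : ℝ) ^ n)⁻¹ = (2 : ℝ) ^ (-(n : ℝ)) := by
  rw [Real.rpow_neg (by norm_num), Real.rpow_natCast]

theorem IsScaleOf.max_le {N n : ℕ} {Q A : ℝ} (h : IsScaleOf N Q A n) (hQ : 1 ≤ Q) :
    max A ((2 : ℝ) ^ N)⁻¹ ≤ Q * (2 : ℝ) ^ (-(n : ℝ)) := by
  refine _root_.max_le h.upper ?_
  rw [inv_two_pow_eq_rpow]
  have h1 : (2 : ℝ) ^ (-(N : ℝ)) ≤ (2 : ℝ) ^ (-(n : ℝ)) :=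
    Real.rpow_le_rpow_of_exponent_le (by norm_num) (by
      have : (n : ℝ) ≤ N := by exact_mod_cast h.le
      linarith)
  have h2 : (0 : ℝ) < (2 : ℝ) ^ (-(n : ℝ)) := by positivity
  nlinarith

theorem IsScaleOf.rpow_neg_le {N n : ℕ} {Q A : ℝ} (h : IsScaleOf N Q A n) {b : ℝ} (hb : 0 ≤ b) :
    (max A ((2 : ℝ) ^ N)⁻¹) ^ (-b) ≤ (2 : ℝ) ^ b * (2 : ℝ) ^ (b * n) := by
  refine (Real.rpow_le_rpow_of_nonpos (by positivity) h.lower (by linarith)).trans (le_of_eq ?_)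
  rw [← Real.rpow_mul (by norm_num), ← Real.rpow_add (by norm_num)]
  congr 1; ring

theorem IsScaleOf.rpow_le {N n : ℕ} {Q A : ℝ} (h : IsScaleOf N Q A n) (hQ : 1 ≤ Q) (a : ℝ) :
    (max A ((2 : ℝ) ^ N)⁻¹) ^ (-a) ≤ ((2 * Q) ^ |a|) * (2 : ℝ) ^ (a * n) := by
  rcases le_total 0 a with ha | ha
  · refine (h.rpow_neg_le ha).trans ?_
    rw [abs_of_nonneg ha]
    gcongr
    linarith
  · have h0 : 0 ≤ max A ((2 : ℝ) ^ N)⁻¹ := le_max_of_le_right (by positivity)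
    refine (Real.rpow_le_rpow h0 (h.max_le hQ) (by linarith)).trans ?_
    rw [abs_of_nonpos ha, Real.mul_rpow (by linarith) (by positivity),
      ← Real.rpow_mul (by norm_num), neg_mul_neg, mul_comm (n : ℝ)]
    gcongr
    · linarith
    · linarith

namespace Kernel

theorem abs_toFun_le_scale (a : ℝ) {Q : ℝ} (hQ : 1 ≤ Q) (p : ℕ) :
    ∃ C : ℝ, 0 ≤ C ∧ ∀ {N q : ℕ} (K : Kernel d N q), q = N → K.HasOrder a →
      ∀ z : SpaceTime d N, z ≠ 0 → ∀ n, IsScaleOf N Q (scaledNorm (coord z)) n →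
      |K.toFun z| ≤ C * K.norm a p * (2 : ℝ) ^ (a * n) := by
  refine ⟨(3 * (4 : ℝ) ^ |a| + 1) * (2 * Q) ^ |a|, by positivity, ?_⟩
  rintro N q K rfl hK z hz n hn
  have hnm := hK.norm_nonneg p
  refine (abs_toFun_le hK p hz).trans ?_
  calc _ ≤ (3 * (4 : ℝ) ^ |a| + 1) * K.norm a p * (((2 * Q) ^ |a|) * (2 : ℝ) ^ (a * n)) := by
        gcongr; exact hn.rpow_le hQ a
    _ = _ := by ring

end Kernel

/-- Two of three numbers are equal and at most the third one. -/
def IsUltra (nA nB nD : ℕ) : Prop :=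
  (nB = nD ∧ nB ≤ nA) ∨ (nA = nD ∧ nA ≤ nB) ∨ (nA = nB ∧ nA ≤ nD)

/-- The exponent of the bound on a recentred kernel. -/
def recentredExponent (a : ℝ) (r nA nB nD : ℕ) : ℝ :=
  a * nA + ((a + r - 1) * (nB - nA : ℕ) - r * (nD - nA : ℕ))

/-- The critical case is a base point near the source, nA = nD ≤ nB: the subtracted terms have
degree k ≤ r - 1, and k = r - 1 gives exactly the exponent a + r - 1. If the base point is near the
target, the closeness of nD to nB costs at most rc. -/
theorem recentredExponent_ge_crude {a c : ℝ} {r nA nB nD : ℕ} (ha : 0 ≤ a) (hr : 1 ≤ r)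
    (hc : 0 ≤ c) (hu : IsUltra nA nB nD) (h : (nD : ℝ) ≤ nB + c) :
    a * nA ≤ recentredExponent a r nA nB nD + r * c ∧
    ∀ k : ℕ, k < r → (a + k) * nB - k * nD ≤ recentredExponent a r nA nB nD + r * c := by
  have hr' : (1 : ℝ) ≤ r := by exact_mod_cast hr
  have hrc : 0 ≤ r * c := by positivity
  unfold recentredExponent
  rcases hu with ⟨h1, h2⟩ | ⟨h1, h2⟩ | ⟨h1, h2⟩
  · subst h1
    rw [Nat.sub_eq_zero_of_le h2]
    have h3 : (nB : ℝ) ≤ nA := by exact_mod_cast h2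
    simp only [Nat.cast_zero, mul_zero, sub_zero, add_zero]
    refine ⟨by linarith, fun k _ => ?_⟩
    nlinarith
  · subst h1
    rw [Nat.sub_self, Nat.cast_zero, Nat.cast_sub h2]
    have h3 : (nA : ℝ) ≤ nB := by exact_mod_cast h2
    refine ⟨by nlinarith [mul_nonneg (by linarith : 0 ≤ a + r - 1) (sub_nonneg.2 h3)],
      fun k hk => ?_⟩
    have hk' : (k : ℝ) ≤ r - 1 := by
      have : (k : ℝ) + 1 ≤ r := by exact_mod_cast hk
      linarith
    nlinarith [mul_nonneg (sub_nonneg.2 hk') (sub_nonneg.2 h3)]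
  · subst h1
    rw [Nat.sub_self, Nat.cast_zero, Nat.cast_sub h2]
    have h3 : (nA : ℝ) ≤ nD := by exact_mod_cast h2
    have h4 : r * ((nD : ℝ) - nA) ≤ r * c := by gcongr; linarith
    refine ⟨by linarith, fun k _ => ?_⟩
    nlinarith [mul_nonneg (Nat.cast_nonneg k : (0 : ℝ) ≤ k) (sub_nonneg.2 h3)]

/-- The exponent is exact when the base point is near the target. Near the source the remainder has
a + r in place of a + r - 1, and the excess nB - nA = nB - nD is at most c. -/
theorem recentredExponent_ge_taylor {a c : ℝ} {r nA nB nD : ℕ} (ha : 0 ≤ a)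
    (hc : 0 ≤ c) (hu : IsUltra nA nB nD) (h : (nB : ℝ) ≤ nD + c) :
    (a + r) * nB - r * nD ≤ recentredExponent a r nA nB nD + c := by
  unfold recentredExponent
  rcases hu with ⟨h1, h2⟩ | ⟨h1, h2⟩ | ⟨h1, h2⟩
  · subst h1
    rw [Nat.sub_eq_zero_of_le h2]
    have h3 : (nB : ℝ) ≤ nA := by exact_mod_cast h2
    simp only [Nat.cast_zero, mul_zero, sub_zero, add_zero]
    nlinarith
  · subst h1
    rw [Nat.sub_self, Nat.cast_zero, Nat.cast_sub h2]
    nlinarith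
  · subst h1
    rw [Nat.sub_self, Nat.cast_zero, Nat.cast_sub h2]
    nlinarith

theorem le_add_logb_of_rpow_le {x y Q : ℝ} (hQ : 0 < Q) (h : (2 : ℝ) ^ (-x) ≤ Q * (2 : ℝ) ^ (-y)) :
    y ≤ x + Real.logb 2 Q := by
  have h1 : (2 : ℝ) ^ (y - x) ≤ Q := by
    rw [sub_eq_add_neg, Real.rpow_add (by norm_num)]
    have h2 : (2 : ℝ) ^ y * (2 : ℝ) ^ (-y) = 1 := by
      rw [← Real.rpow_add (by norm_num)]; simp
    calc _ ≤ (2 : ℝ) ^ y * (Q * (2 : ℝ) ^ (-y)) := by gcongr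
      _ = Q * ((2 : ℝ) ^ y * (2 : ℝ) ^ (-y)) := by ring
      _ = Q := by rw [h2, mul_one]
  have h3 := (Real.le_logb_iff_rpow_le (by norm_num) hQ).2 h1
  linarith

namespace Kernel

/-- The Taylor bound is used when the target is at most half as far from the base point as the
source is and the latter distance is well above 2^{-q}; otherwise each term is bounded separately.
-/
theorem abs_recentred_le_scale {a : ℝ} (ha : 0 ≤ a) {r : ℕ} (hr : 1 ≤ r) {Q : ℝ} (hQ : 2 ≤ Q)
    {p : ℕ} (hp : (d + 1) * r ≤ p) :
    ∃ C : ℝ, 0 ≤ C ∧ ∀ {N q : ℕ} (K : Kernel d N q), q = N → K.HasOrder a →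
      ∀ zm zp zv : SpaceTime d N, zp - zm ≠ 0 → zv - zm ≠ 0 → ∀ nA nB nD : ℕ,
      IsScaleOf N Q (scaledNorm (coord (zp - zm))) nA →
      IsScaleOf N Q (scaledNorm (coord (zv - zm))) nB →
      IsScaleOf N Q (scaledNorm (coord (zp - zv))) nD → IsUltra nA nB nD →
      |K.recentred r zm zp zv| ≤
        C * K.norm a p * (2 : ℝ) ^ recentredExponent a r nA nB nD := by
  obtain ⟨C₁, hC₁, h₁⟩ := abs_recentred_le (d := d) ha r hp
  obtain ⟨C₂, hC₂, h₂⟩ := abs_recentred_le_taylor (d := d) ha r hp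
  -- A scale index determines a length only up to a factor. The comparison of D with B in either
  -- case therefore orders nB and nD only up to this additive error.
  set c := Real.logb 2 (4 * Q) with hcdef
  have hc0 : 0 ≤ c := Real.logb_nonneg (by norm_num) (by linarith)
  set X : ℝ := 2 ^ a + (lowIndices d r).card * (Q ^ r * 2 ^ (a + r)) with hX
  refine ⟨C₁ * X * 2 ^ (r * c) + C₂ * ((2 * Q) ^ r * 2 ^ a) * 2 ^ c, by positivity, ?_⟩
  rintro N q K rfl hK zm zp zv h1 h2 nA nB nD hA hB hD hu
  have hnm := hK.norm_nonneg p
  set t := recentredExponent a r nA nB nD with ht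
  set D := scaledNorm (coord (zp - zv)) with hDdef
  set B := scaledNorm (coord (zv - zm)) with hBdef
  have hD0 : 0 ≤ D := scaledNorm_nonneg _
  have hQ1 : 1 ≤ Q := by linarith
  by_cases hcase : D ≤ B / 2 ∧ 4 * ((2 : ℝ) ^ q)⁻¹ ≤ B
  · obtain ⟨hDB, hBq⟩ := hcase
    have hq0 : (0 : ℝ) < ((2 : ℝ) ^ q)⁻¹ := by positivity
    have hB0 : 0 < B := by linarith
    have hmax : max B ((2 : ℝ) ^ q)⁻¹ = B := max_eq_left (by linarith)
    have hlow := hB.lower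
    rw [hmax] at hlow
    have hbd : (nB : ℝ) ≤ nD + c := by
      refine le_add_logb_of_rpow_le (by linarith) ?_
      have h3 : max D ((2 : ℝ) ^ q)⁻¹ ≤ B / 2 := max_le hDB (by linarith)
      have h4 := hD.lower.trans h3
      rw [Real.rpow_sub (by norm_num), Real.rpow_one] at h4
      have h5 := hB.upper
      have h6 : (0 : ℝ) < (2 : ℝ) ^ (-(nB : ℝ)) := by positivity
      nlinarith
    have hexp := recentredExponent_ge_taylor (r := r) ha hc0 hu hbd
    rw [← ht] at hexp
    have e1 : (D / B) ^ r ≤ (2 * Q) ^ r * (2 : ℝ) ^ ((r : ℝ) * nB - r * nD) := by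
      have e2 : D / B ≤ 2 * Q * (2 : ℝ) ^ ((nB : ℝ) - nD) := by
        rw [div_le_iff₀ hB0]
        calc D ≤ Q * (2 : ℝ) ^ (-(nD : ℝ)) := hD.upper
          _ = 2 * Q * (2 : ℝ) ^ ((nB : ℝ) - nD) * (2 : ℝ) ^ (-(nB : ℝ) - 1) := by
            rw [mul_assoc, ← Real.rpow_add (by norm_num),
              show (nB : ℝ) - nD + (-(nB : ℝ) - 1) = -(nD : ℝ) - 1 by ring,
              Real.rpow_sub (by norm_num), Real.rpow_one]
            ring
          _ ≤ _ := by gcongr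
      refine (pow_le_pow_left₀ (by positivity) e2 r).trans (le_of_eq ?_)
      rw [mul_pow, ← Real.rpow_natCast ((2 : ℝ) ^ ((nB : ℝ) - nD)), ← Real.rpow_mul (by norm_num)]
      congr 2; ring
    have e3 : B ^ (-a) ≤ (2 : ℝ) ^ a * (2 : ℝ) ^ (a * nB) := by
      have := hB.rpow_neg_le ha
      rwa [hmax] at this
    have e4 : (D / B) ^ r * B ^ (-a) ≤ ((2 * Q) ^ r * 2 ^ a) * 2 ^ c * 2 ^ t := by
      calc _ ≤ ((2 * Q) ^ r * (2 : ℝ) ^ ((r : ℝ) * nB - r * nD)) *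
            ((2 : ℝ) ^ a * (2 : ℝ) ^ (a * nB)) := by gcongr
        _ = ((2 * Q) ^ r * 2 ^ a) * (2 : ℝ) ^ ((a + r) * nB - r * nD) := by
            rw [show (a + r) * nB - r * nD = ((r : ℝ) * nB - r * nD) + a * nB by ring,
              Real.rpow_add (by norm_num)]
            ring
        _ ≤ ((2 * Q) ^ r * 2 ^ a) * (2 : ℝ) ^ (t + c) := by
            gcongr; norm_num
        _ = _ := by rw [Real.rpow_add (by norm_num)]; ring
    calc _ ≤ C₂ * K.norm a p * ((D / B) ^ r * B ^ (-a)) := h₂ K hK zm zp zv hDB hBq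
      _ ≤ C₂ * K.norm a p * (((2 * Q) ^ r * 2 ^ a) * 2 ^ c * 2 ^ t) := by gcongr
      _ = C₂ * ((2 * Q) ^ r * 2 ^ a) * 2 ^ c * K.norm a p * 2 ^ t := by ring
      _ ≤ _ := by
        gcongr
        exact le_add_of_nonneg_left (by positivity)
  · have hdb : (nD : ℝ) ≤ nB + c := by
      refine le_add_logb_of_rpow_le (by linarith) ?_
      have hlow := hB.lower
      rw [Real.rpow_sub (by norm_num), Real.rpow_one, div_le_iff₀ (by norm_num)] at hlow
      have hup := hD.upper
      have h6 : (0 : ℝ) < (2 : ℝ) ^ (-(nD : ℝ)) := by positivity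
      have h7 : ((2 : ℝ) ^ q)⁻¹ ≤ (2 : ℝ) ^ (-(nD : ℝ)) := by
        rw [inv_two_pow_eq_rpow]
        refine Real.rpow_le_rpow_of_exponent_le (by norm_num) ?_
        have : (nD : ℝ) ≤ q := by exact_mod_cast hD.le
        linarith
      rcases le_total B ((2 : ℝ) ^ q)⁻¹ with h8 | h8
      · rw [max_eq_right h8] at hlow
        nlinarith
      · rw [max_eq_left h8] at hlow
        -- If D is small, the Taylor case failed because B is below four grid lengths; the resulting
        -- factor 8 is covered by 4Q because Q ≥ 2.
        by_cases h9 : D ≤ B / 2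
        · have h10 : B < 4 * ((2 : ℝ) ^ q)⁻¹ := not_le.1 fun h' => hcase ⟨h9, h'⟩
          nlinarith
        · push Not at h9
          nlinarith
    obtain ⟨hexp1, hexp2⟩ := recentredExponent_ge_crude ha hr hc0 hu hdb
    rw [← ht] at hexp1 hexp2
    have e1 : (max (scaledNorm (coord (zp - zm))) ((2 : ℝ) ^ q)⁻¹) ^ (-a) ≤
        2 ^ a * (2 : ℝ) ^ (t + r * c) := by
      refine (hA.rpow_neg_le ha).trans ?_
      gcongr; norm_num
    have e2 : ∀ j ∈ lowIndices d r, D ^ scaledDegree j *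
        (max B ((2 : ℝ) ^ q)⁻¹) ^ (-(a + scaledDegree j)) ≤
        (Q ^ r * 2 ^ (a + r)) * (2 : ℝ) ^ (t + r * c) := by
      intro j hj
      rw [mem_lowIndices] at hj
      set k := scaledDegree j with hk
      have hkr : (k : ℝ) ≤ r := by exact_mod_cast hj.2.le
      have f1 : D ^ k ≤ Q ^ r * (2 : ℝ) ^ (-(k * nD : ℝ)) := by
        calc D ^ k ≤ (Q * (2 : ℝ) ^ (-(nD : ℝ))) ^ k := pow_le_pow_left₀ hD0 hD.upper k
          _ = Q ^ k * (2 : ℝ) ^ (-(k * nD : ℝ)) := by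
            rw [mul_pow, ← Real.rpow_natCast ((2 : ℝ) ^ (-(nD : ℝ))),
              ← Real.rpow_mul (by norm_num)]
            congr 2; ring
          _ ≤ _ := by gcongr; exact hj.2.le
      have f2 := hB.rpow_neg_le (b := a + k) (by positivity)
      calc _ ≤ (Q ^ r * (2 : ℝ) ^ (-(k * nD : ℝ))) *
            ((2 : ℝ) ^ (a + k) * (2 : ℝ) ^ ((a + k) * nB)) := by gcongr
        _ = (Q ^ r * (2 : ℝ) ^ (a + k)) * (2 : ℝ) ^ ((a + k) * nB - k * nD) := by
            rw [show (a + k) * nB - k * nD = -(k * nD : ℝ) + (a + k) * nB by ring,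
              Real.rpow_add (by norm_num) (-(k * nD : ℝ))]
            ring
        _ ≤ _ := by
            have := hexp2 k hj.2
            gcongr <;> norm_num
    calc _ ≤ C₁ * K.norm a p * (2 ^ a * (2 : ℝ) ^ (t + r * c) +
          ∑ j ∈ lowIndices d r, (Q ^ r * 2 ^ (a + r)) * (2 : ℝ) ^ (t + r * c)) := by
          refine (h₁ K hK zm zp zv h1 h2).trans ?_
          exact mul_le_mul_of_nonneg_left (add_le_add e1 (Finset.sum_le_sum e2)) (by positivity)
      _ = C₁ * X * 2 ^ (r * c) * K.norm a p * 2 ^ t := by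
          rw [Finset.sum_const, nsmul_eq_mul, Real.rpow_add (by norm_num), hX]; ring
      _ ≤ _ := by
        gcongr
        exact le_add_of_nonneg_right (by positivity)

end Kernel
end GenConv
end

/-! ### From edge factors to sums over spanning trees. -/

noncomputable section
namespace GenConv

namespace LabelledGraph

variable {V E : Type*} [Fintype V] [DecidableEq V] [Fintype E] [DecidableEq E] {M : ℕ}
variable {d N q : ℕ}

/-- The distances between the points of a configuration. -/
def configDist (z : V → SpaceTime d N) (u v : V) : ℝ := stDist (z u) (z v)

/-- Separation at scale m + 1 gives the lower bound, and a common cluster at scale m the upper one.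
The end values are special: for m = N the lower bound comes from the cutoff 2^{-N}, for m = 0 the
upper one from the diameter. -/
theorem isScaleOf_of_label {o : V} {D : V → V → ℝ} (cl : Clustering o D) {u v : V}
    (hD : D u v ≤ 2 * Fintype.card V) {m : ℕ} (hm : m ≤ N)
    (h : ∀ k, 1 ≤ k → k ≤ N →
      (k ≤ m ↔ cl.label ((2 : ℝ) ^ k)⁻¹ u = cl.label ((2 : ℝ) ^ k)⁻¹ v)) :
    IsScaleOf N (2 * Fintype.card V) (D u v) m := by
  refine ⟨hm, ?_, ?_⟩
  · have e : (2 : ℝ) ^ (-(m : ℝ) - 1) = ((2 : ℝ) ^ (m + 1))⁻¹ := by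
      rw [inv_two_pow_eq_rpow]; congr 1; push_cast; ring
    rw [e]
    rcases Nat.lt_or_ge m N with h1 | h1
    · refine le_max_of_le_left (cl.lt_dist _ u v fun h' => ?_).le
      have := (h (m + 1) (by omega) h1).2 h'
      omega
    · exact le_max_of_le_right (inv_two_pow_anti (by omega))
  · rw [← inv_two_pow_eq_rpow]
    rcases Nat.eq_zero_or_pos m with h1 | h1
    · subst h1; simpa using hD
    · exact cl.dist_le _ (by positivity) u v ((h m h1 hm).1 le_rfl)

/-- Sharing a cluster is transitive at each scale, so any two of the three relations imply the
third. -/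
theorem isUltra_of_label {o : V} {D : V → V → ℝ} (cl : Clustering o D) {u v w : V}
    {nA nB nD : ℕ} (hA : nA ≤ N) (hB : nB ≤ N)
    (h1 : ∀ k, 1 ≤ k → k ≤ N →
        (k ≤ nA ↔ cl.label ((2 : ℝ) ^ k)⁻¹ u = cl.label ((2 : ℝ) ^ k)⁻¹ v))
    (h2 : ∀ k, 1 ≤ k → k ≤ N →
        (k ≤ nB ↔ cl.label ((2 : ℝ) ^ k)⁻¹ u = cl.label ((2 : ℝ) ^ k)⁻¹ w))
    (h3 : ∀ k, 1 ≤ k → k ≤ N →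
        (k ≤ nD ↔ cl.label ((2 : ℝ) ^ k)⁻¹ v = cl.label ((2 : ℝ) ^ k)⁻¹ w)) :
    IsUltra nA nB nD := by
  have key : ∀ k, (k ≤ nA → k ≤ nB → k ≤ nD) ∧ (k ≤ nA → k ≤ nD → k ≤ nB) ∧
      (k ≤ nB → k ≤ nD → k ≤ nA) := fun k => by
    rcases Nat.eq_zero_or_pos k with h | h
    · subst h; simp
    · by_cases hk : k ≤ N
      · rw [h1 k h hk, h2 k h hk, h3 k h hk]
        exact ⟨fun a b => a.symm.trans b, fun a b => a.trans b, fun a b => a.trans b.symm⟩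
      · refine ⟨fun _ _ => ?_, fun _ _ => ?_, fun _ _ => ?_⟩ <;> omega
  have k1 := key nA
  have k2 := key nB
  have k3 := key nD
  unfold IsUltra
  omega

theorem two_le_two_mul_card (G : LabelledGraph V E M) : (2 : ℝ) ≤ 2 * Fintype.card V := by
  have : (1 : ℝ) ≤ Fintype.card V := by exact_mod_cast Fintype.card_pos_iff.2 ⟨G.origin⟩
  linarith

/-- The factor that bounds the kernel of an edge. -/
def edgeFactor (G : LabelledGraph V E M) {D : V → V → ℝ} (cl : Clustering G.origin D) (N : ℕ)
    (e : E) : ℝ :=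
  (2 : ℝ) ^ ∑ k ∈ Finset.Icc 1 N, G.edgeDegree (cl.label ((2 : ℝ) ^ k)⁻¹) e

theorem edgeFactor_nonneg (G : LabelledGraph V E M) {D : V → V → ℝ}
    (cl : Clustering G.origin D) (N : ℕ) (e : E) : 0 ≤ G.edgeFactor cl N e := by
  unfold edgeFactor; positivity

theorem abs_toFun_le_edgeFactor (G : LabelledGraph V E M) (e : E) (hr : G.r e = 0) (p : ℕ) :
    ∃ C : ℝ, 0 ≤ C ∧ ∀ {N q : ℕ} (K : Kernel d N q), q = N → K.HasOrder (G.a e) →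
      ∀ (z : V → SpaceTime d N) (cl : Clustering G.origin (configDist z)),
      (∀ u v, u ≠ v → z u ≠ z v) → (∀ u v, configDist z u v ≤ 2 * Fintype.card V) →
      |K.toFun (z (G.tgt e) - z (G.src e))| ≤ C * K.norm (G.a e) p * G.edgeFactor cl N e := by
  obtain ⟨C, hC, h⟩ := Kernel.abs_toFun_le_scale (d := d) (G.a e)
    (Q := 2 * Fintype.card V) (by linarith [G.two_le_two_mul_card]) p
  refine ⟨C, hC, ?_⟩
  intro N q K hq hK z cl hz hR
  obtain ⟨nA, nB, nD, hA, hB, hD, h1, h2, h3, hsum⟩ := G.sum_edgeDegree_edge cl N e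
  rw [edgeFactor, hsum, hr]
  simp only [lt_irrefl, if_false, add_zero]
  refine h K hq hK _ (sub_ne_zero.2 (hz _ _ (G.src_ne_tgt e).symm)) nA ?_
  have := isScaleOf_of_label cl (hR (G.src e) (G.tgt e)) hA h1
  rwa [configDist, stDist_comm] at this

/-- The second bound is for the finest localised kernel of the multiscale form, which is not
recentred. -/
theorem abs_recentred_le_edgeFactor (G : LabelledGraph V E M) (e : E) (hr : 0 < G.r e)
    (ha : 0 ≤ G.a e) (hbase : G.base e ≠ G.src e) {p : ℕ} (hp : (d + 1) * G.r e ≤ p) :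
    ∃ C : ℝ, 0 ≤ C ∧ ∀ {N q : ℕ} (K : Kernel d N q), q = N → K.HasOrder (G.a e) →
      ∀ (z : V → SpaceTime d N) (cl : Clustering G.origin (configDist z)),
      (∀ u v, u ≠ v → z u ≠ z v) → (∀ u v, configDist z u v ≤ 2 * Fintype.card V) →
      |K.recentred (G.r e) (z (G.src e)) (z (G.tgt e)) (z (G.base e))| ≤
        C * K.norm (G.a e) p * G.edgeFactor cl N e ∧
      (configDist z (G.tgt e) (G.src e) ≤ ((2 : ℝ) ^ N)⁻¹ →
        |K.toFun (z (G.tgt e) - z (G.src e))| ≤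
          C * K.norm (G.a e) p * G.edgeFactor cl N e) := by
  obtain ⟨C₁, hC₁, h₁⟩ := Kernel.abs_recentred_le_scale (d := d) ha hr
    (Q := 2 * Fintype.card V) G.two_le_two_mul_card hp
  obtain ⟨C₂, hC₂, h₂⟩ := Kernel.abs_toFun_le_scale (d := d) (G.a e)
    (Q := 2 * Fintype.card V) (by linarith [G.two_le_two_mul_card]) p
  refine ⟨C₁ + C₂ * 2 ^ (G.r e : ℝ), by positivity, ?_⟩
  intro N q K hq hK z cl hz hR
  have hnm := hK.norm_nonneg p
  obtain ⟨nA, nB, nD, hA, hB, hD, h1, h2, h3, hsum⟩ := G.sum_edgeDegree_edge cl N e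
  rw [if_pos hr] at hsum
  have sA := isScaleOf_of_label cl (hR (G.src e) (G.tgt e)) hA h1
  have sB := isScaleOf_of_label cl (hR (G.src e) (G.base e)) hB h2
  have sD := isScaleOf_of_label cl (hR (G.tgt e) (G.base e)) hD h3
  have hu := isUltra_of_label cl hA hB h1 h2 h3
  rw [configDist, stDist_comm] at sA sB
  have htz : z (G.tgt e) - z (G.src e) ≠ 0 := sub_ne_zero.2 (hz _ _ (G.src_ne_tgt e).symm)
  have hbz : z (G.base e) - z (G.src e) ≠ 0 := sub_ne_zero.2 (hz _ _ hbase)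
  have hfac : G.edgeFactor cl N e = 2 ^ recentredExponent (G.a e) (G.r e) nA nB nD := by
    rw [edgeFactor, hsum, recentredExponent]
  rw [hfac]
  constructor
  · refine (h₁ K hq hK _ _ _ htz hbz nA nB nD sA sB sD hu).trans ?_
    gcongr
    exact le_add_of_nonneg_right (by positivity)
  · intro hAε
    refine (h₂ K hq hK _ htz nA sA).trans ?_
    have hlow := sA.lower
    rw [max_eq_right (show stDist _ _ ≤ _ from hAε), inv_two_pow_eq_rpow,
      Real.rpow_le_rpow_left_iff (by norm_num)] at hlow
    -- The endpoints are within the finest scale, so nA ≥ N - 1. The ultrametric relation then makes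
    -- nD at most nB + 1, and the unsubtracted kernel obeys the same bound up to the factor 2^r.
    have hN : N ≤ nA + 1 := by
      have : (N : ℝ) ≤ nA + 1 := by linarith
      exact_mod_cast this
    have hDB : (nD : ℝ) ≤ nB + 1 := by
      have : nD ≤ nB + 1 := by unfold IsUltra at hu; omega
      exact_mod_cast this
    have hexp := (recentredExponent_ge_crude ha hr zero_le_one hu hDB).1
    rw [mul_one] at hexp
    calc _ ≤ C₂ * K.norm (G.a e) p *
          2 ^ (recentredExponent (G.a e) (G.r e) nA nB nD + (G.r e : ℝ)) := by
          gcongr; norm_num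
      _ = C₂ * 2 ^ (G.r e : ℝ) * K.norm (G.a e) p *
          2 ^ recentredExponent (G.a e) (G.r e) nA nB nD := by
          rw [Real.rpow_add (by norm_num)]; ring
      _ ≤ _ := by
          gcongr
          exact le_add_of_nonneg_left hC₁

/-- The weight of an edge of a spanning tree. -/
def treeWeight (dim δ R : ℝ) (N L : ℕ) (x : ℝ) : ℝ :=
  if x ≤ R then (2 : ℝ) ^ (dim * scaleIdx N x - δ * gap (scaleIdx N x) L) else 0

theorem treeWeight_nonneg (dim δ R : ℝ) (N L : ℕ) (x : ℝ) : 0 ≤ treeWeight dim δ R N L x := by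
  unfold treeWeight; split_ifs <;> positivity

/-- The sum over all enumerations of the vertices that begin with the origin, of the products of
the weights of the distances to the preceding points. -/
def treeSum (G : LabelledGraph V E M) (w : ℝ → ℝ) (z : V → SpaceTime d N) : ℝ :=
  ∑ σ ∈ Finset.univ.filter (fun σ : Fin (Fintype.card V) ≃ V =>
      ∀ i, σ i = G.origin ↔ i.val = 0),
    ∏ i ∈ Finset.univ.filter (fun i : Fin (Fintype.card V) => i.val ≠ 0),
      ∑ j ∈ Finset.univ.filter (fun j => j < i), w (stDist (z (σ i)) (z (σ j)))

/-- The pointwise bound on a product of functions attached to the edges. -/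
theorem prod_edges_le_treeSum (G : LabelledGraph V E M) (hG : G.PowerCounting d)
    (hbase : ∀ e, 0 < G.r e → G.base e ≠ G.src e) :
    ∃ δ : ℝ, 0 < δ ∧ ∀ (N L : ℕ), L ≤ N → ∀ (z : V → SpaceTime d N),
      (∀ i, stDist (z (G.star i)) (z G.origin) ≤ ((2 : ℝ) ^ L)⁻¹) →
      ∀ W B : E → ℝ, (∀ e, 0 ≤ W e) → (∀ e, 0 ≤ B e) →
      (∀ e, W e ≠ 0 → stDist (z (G.tgt e)) (z (G.src e)) ≤ 1 ∨
        0 < G.r e ∧ stDist (z (G.base e)) (z (G.src e)) ≤ 1) →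
      (∀ cl : Clustering G.origin (configDist z),
        (∀ u v, configDist z u v ≤ 2 * Fintype.card V) →
        ∀ e, W e ≤ B e * G.edgeFactor cl N e) →
      ∏ e, W e ≤ (∏ e, B e) * ((2 : ℝ) ^ (-(G.alpha d * L)) *
        G.treeSum (treeWeight (scalingSize d) δ (2 * Fintype.card V) N L) z) := by
  classical
  obtain ⟨δ, hδ, hmain⟩ := G.sum_edgeDegree_scales_le hG hbase
  refine ⟨δ, hδ, fun N L hLN z hstar W B hW hB htied hbound => ?_⟩
  set w := treeWeight (scalingSize d) δ (2 * Fintype.card V) N L with hw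
  have hw0 : ∀ x, 0 ≤ w x := treeWeight_nonneg _ _ _ _ _
  have hprod0 : ∀ σ : Fin (Fintype.card V) ≃ V, 0 ≤
      ∏ i ∈ Finset.univ.filter (fun i : Fin (Fintype.card V) => i.val ≠ 0),
        ∑ j ∈ Finset.univ.filter (fun j => j < i), w (stDist (z (σ i)) (z (σ j))) := fun σ =>
    Finset.prod_nonneg fun i _ => Finset.sum_nonneg fun j _ => hw0 _
  have hT0 : 0 ≤ G.treeSum w z := Finset.sum_nonneg fun σ _ => hprod0 σ
  have hB' : 0 ≤ ∏ e, B e := Finset.prod_nonneg fun e _ => hB e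
  by_cases hall : ∃ e, W e = 0
  · obtain ⟨e, he⟩ := hall
    rw [Finset.prod_eq_zero (Finset.mem_univ e) he]
    positivity
  push Not at hall
  obtain ⟨cl⟩ := exists_clustering G.origin (configDist z) (fun v => stDist_self _)
    (fun u v => stDist_comm _ _) (fun u v w => stDist_triangle _ _ _)
  -- Nonzero factors tie every edge within distance 1, so there is a single cluster at threshold 1.
  have hR : ∀ u v, configDist z u v ≤ 2 * Fintype.card V := fun u v => by
    have hlab := G.label_eq_of_edges hG hbase (cl.label 1) (fun e => by
      rcases htied e (hall e) with h | h
      · left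
        by_contra h'
        have := cl.lt_dist _ _ _ h'
        rw [configDist, stDist_comm] at this
        linarith
      · right
        refine ⟨h.1, ?_⟩
        by_contra h'
        have := cl.lt_dist _ _ _ h'
        rw [configDist, stDist_comm] at this
        linarith [h.2]) u v
    simpa using cl.dist_le 1 zero_le_one u v hlab
  have h1 : ∏ e, W e ≤ (∏ e, B e) * ∏ e, G.edgeFactor cl N e := by
    rw [← Finset.prod_mul_distrib]
    exact Finset.prod_le_prod (fun e _ => hW e) fun e _ => hbound cl hR e
  refine h1.trans (mul_le_mul_of_nonneg_left ?_ hB')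
  have h2 : ∏ e, G.edgeFactor cl N e =
      (2 : ℝ) ^ ∑ k ∈ Finset.Icc 1 N, ∑ e, G.edgeDegree (cl.label ((2 : ℝ) ^ k)⁻¹) e := by
    unfold edgeFactor
    rw [Finset.sum_comm, Real.rpow_sum_of_pos (by norm_num)]
  have h3 := hmain (configDist z) cl N L hLN hstar
  rw [h2]
  refine (Real.rpow_le_rpow_of_exponent_le (by norm_num) h3).trans ?_
  rw [sub_eq_add_neg, Real.rpow_add (by norm_num), mul_comm,
    Real.rpow_sum_of_pos (by norm_num)]
  refine mul_le_mul_of_nonneg_left ?_ (by positivity)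
  -- The minimal tree depends on the configuration. Summing over all enumerations and all
  -- attachments dominates it by one fixed measurable function.
  have hmem : cl.enum ∈ Finset.univ.filter (fun σ : Fin (Fintype.card V) ≃ V =>
      ∀ i, σ i = G.origin ↔ i.val = 0) := by simpa using cl.enum_eq
  refine le_trans ?_ (Finset.single_le_sum (fun σ _ => hprod0 σ) hmem)
  refine Finset.prod_le_prod (fun _ _ => by positivity) fun i hi => ?_
  simp only [Finset.mem_filter, Finset.mem_univ, true_and] at hi
  obtain ⟨j, hj, hlen⟩ := cl.len_eq i hi
  refine le_trans (le_of_eq ?_) (Finset.single_le_sum (f := fun j =>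
    w (stDist (z (cl.enum i)) (z (cl.enum j)))) (fun j _ => hw0 _)
    (show j ∈ Finset.univ.filter (fun j => j < i) by simpa using hj))
  have hle := hR (cl.enum i) (cl.enum j)
  simp only [hw, treeWeight]
  rw [if_pos (show stDist _ _ ≤ _ from hle), hlen, configDist]

end LabelledGraph
end GenConv
end

noncomputable section
namespace GenConv

open MeasureTheory

/-! ### Iterated integration along an enumeration -/

/-- Variables are integrated from the highest rank downwards: a factor does not see the variables of
higher rank, so it leaves their integral as a constant. -/
theorem lmarginal_prod_le {ι : Type*} [Fintype ι] [DecidableEq ι] {X : Type*} [MeasurableSpace X]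
    (μ : Measure X) [SigmaFinite μ] (rank : ι → ℕ) (hrank : Function.Injective rank)
    (F : ι → (ι → X) → ENNReal) (hF : ∀ i, Measurable (F i)) (A : ι → ENNReal)
    (hdep : ∀ i x y, (∀ k, rank k ≤ rank i → x k = y k) → F i x = F i y)
    (hA : ∀ i x, ∫⁻ u, F i (Function.update x i u) ∂μ ≤ A i) (s : Finset ι) :
    ∀ x, (∫⋯∫⁻_s, (fun x => ∏ i ∈ s, F i x) ∂fun _ => μ) x ≤ ∏ i ∈ s, A i := by
  induction s using Finset.induction_on_min_value rank with
  | empty => intro x; simp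
  | insert a s ha hmin ih =>
    intro x
    have hmeas : ∀ t : Finset ι, Measurable fun x => ∏ i ∈ t, F i x := fun t =>
      Finset.measurable_fun_prod t fun i _ => hF i
    rw [lmarginal_insert _ (hmeas _) ha, Finset.prod_insert ha]
    have key : ∀ x, (∫⋯∫⁻_s, (fun x => ∏ i ∈ insert a s, F i x) ∂fun _ => μ) x ≤
        F a x * ∏ i ∈ s, A i := by
      intro x
      have h1 : ∀ y, F a (Function.updateFinset x s y) = F a x := fun y => by
        refine hdep a _ _ fun k hk => ?_
        have hks : k ∉ s := fun h => by
          have h2 := hrank (le_antisymm hk (hmin k h))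
          exact ha (h2 ▸ h)
        simp [Function.updateFinset, hks]
      have h3 := ih x
      simp only [lmarginal, Finset.prod_insert ha, h1] at h3 ⊢
      have h4 : Measurable fun y : s → X => ∏ i ∈ s, F i (Function.updateFinset x s y) :=
        (hmeas s).comp measurable_updateFinset
      rw [lintegral_const_mul _ h4]
      gcongr
    calc _ ≤ ∫⁻ u, F a (Function.update x a u) * ∏ i ∈ s, A i ∂μ :=
          lintegral_mono fun u => key _
      _ = (∫⁻ u, F a (Function.update x a u) ∂μ) * ∏ i ∈ s, A i :=
          lintegral_mul_const _ ((hF a).comp (measurable_update x))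
      _ ≤ _ := by gcongr; exact hA a x

/-! ### The measure on space-time -/

variable {d N : ℕ}

/-- The product of the Lebesgue and the counting measure. -/
def stVolume (d N : ℕ) : Measure (SpaceTime d N) := (volume : Measure ℝ).prod Measure.count

instance : SigmaFinite (stVolume d N) := by unfold stVolume; infer_instance

theorem measurable_coord : Measurable (coord : SpaceTime d N → Fin (d + 1) → ℝ) := by
  rw [measurable_pi_iff]
  intro i
  refine Fin.cases ?_ (fun i => ?_) i
  · simpa [coord] using measurable_fst
  · simp only [coord, Fin.cons_succ]
    have h : Measurable fun a : ZMod (2 ^ N) => (a.valMinAbs : ℝ) / 2 ^ N := Measurable.of_discrete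
    exact h.comp ((measurable_pi_apply i).comp measurable_snd)

theorem measurable_stDist :
    Measurable fun p : SpaceTime d N × SpaceTime d N => stDist p.1 p.2 := by
  have h : Measurable fun p : SpaceTime d N × SpaceTime d N => coord (p.1 - p.2) := by
    rw [measurable_pi_iff]
    intro i
    refine Fin.cases ?_ (fun i => ?_) i
    · simp only [coord, Fin.cons_zero, Prod.fst_sub]
      exact (measurable_fst.comp measurable_fst).sub (measurable_fst.comp measurable_snd)
    · simp only [coord, Fin.cons_succ, Prod.snd_sub, Pi.sub_apply]
      have h : Measurable fun a : ZMod (2 ^ N) × ZMod (2 ^ N) =>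
          ((a.1 - a.2).valMinAbs : ℝ) / 2 ^ N := Measurable.of_discrete
      have h' : Measurable fun p : SpaceTime d N × SpaceTime d N => (p.1.2 i, p.2.2 i) :=
        ((measurable_pi_apply i).comp (measurable_snd.comp measurable_fst)).prodMk
          ((measurable_pi_apply i).comp (measurable_snd.comp measurable_snd))
      have h2 := h.comp h'
      simpa only [Function.comp_def] using h2
  exact continuous_scaledNorm.measurable.comp h

theorem card_valMinAbs_le (N : ℕ) (y : ZMod (2 ^ N)) {s : ℝ} (hs : 0 ≤ s) :
    (((Finset.univ : Finset (ZMod (2 ^ N))).filter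
      fun x => |((x - y).valMinAbs : ℝ) / 2 ^ N| ≤ s).card : ℝ) ≤ 2 * (s * 2 ^ N) + 1 := by
  set m : ℤ := ⌊s * 2 ^ N⌋ with hm
  have hm0 : 0 ≤ m := Int.floor_nonneg.2 (by positivity)
  have h1 : ((Finset.univ : Finset (ZMod (2 ^ N))).filter
      fun x => |((x - y).valMinAbs : ℝ) / 2 ^ N| ≤ s).card ≤ (Finset.Icc (-m) m).card := by
    refine Finset.card_le_card_of_injOn (fun x => (x - y).valMinAbs) (fun x hx => ?_) ?_
    · simp only [Finset.coe_filter, Finset.mem_univ, true_and, Set.mem_ofPred_eq] at hx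
      rw [abs_div, abs_of_pos (by positivity : (0 : ℝ) < 2 ^ N), div_le_iff₀ (by positivity)] at hx
      rw [Finset.coe_Icc, Set.mem_Icc, ← abs_le, hm, Int.le_floor]
      push_cast; exact hx
    · intro a _ b _ hab
      have := ZMod.injective_valMinAbs hab
      exact sub_left_inj.1 this
  rw [Int.card_Icc] at h1
  have h2 : (((m + 1 - -m).toNat : ℕ) : ℝ) = 2 * (m : ℝ) + 1 := by
    have h3 : (((m + 1 - -m).toNat : ℤ) : ℝ) = ((m + 1 - -m : ℤ) : ℝ) := by
      rw [Int.toNat_of_nonneg (by omega)]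
    push_cast at h3
    rw [h3]; ring
  have h3 : (m : ℝ) ≤ s * 2 ^ N := Int.floor_le _
  calc _ ≤ (((m + 1 - -m).toNat : ℕ) : ℝ) := by exact_mod_cast h1
    _ = 2 * (m : ℝ) + 1 := h2
    _ ≤ _ := by linarith

/-- The volume of a box. -/
theorem stVolume_box_le (y : SpaceTime d N) {T s : ℝ} (hT : 0 ≤ T) (hs : 0 ≤ s) :
    stVolume d N {z | |z.1 - y.1| ≤ T ∧ ∀ i, |coord (z - y) (Fin.succ i)| ≤ s} ≤
      ENNReal.ofReal (2 * T * (2 * (s * 2 ^ N) + 1) ^ d) := by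
  classical
  have hsub : {z : SpaceTime d N | |z.1 - y.1| ≤ T ∧ ∀ i, |coord (z - y) (Fin.succ i)| ≤ s} ⊆
      Set.Icc (y.1 - T) (y.1 + T) ×ˢ (↑(Fintype.piFinset fun i =>
        (Finset.univ : Finset (ZMod (2 ^ N))).filter
          fun x => |((x - y.2 i).valMinAbs : ℝ) / 2 ^ N| ≤ s) : Set (Fin d → ZMod (2 ^ N))) := by
    rintro z ⟨h1, h2⟩
    refine ⟨?_, ?_⟩
    · rw [abs_le] at h1
      constructor <;> linarith [h1.1, h1.2]
    · rw [Finset.mem_coe, Fintype.mem_piFinset]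
      intro i
      have := h2 i
      simp only [coord, Fin.cons_succ] at this
      simpa using this
  refine (measure_mono hsub).trans ?_
  rw [stVolume, Measure.prod_prod, Real.volume_Icc, Measure.count_apply_finset,
    Fintype.card_piFinset]
  have hcard : ((∏ i, ((Finset.univ : Finset (ZMod (2 ^ N))).filter
      fun x => |((x - y.2 i).valMinAbs : ℝ) / 2 ^ N| ≤ s).card : ℕ) : ℝ) ≤
      (2 * (s * 2 ^ N) + 1) ^ d := by
    push_cast
    calc _ ≤ ∏ _i : Fin d, (2 * (s * 2 ^ N) + 1) :=
          Finset.prod_le_prod (fun _ _ => by positivity) fun i _ => card_valMinAbs_le N _ hs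
      _ = _ := by simp
  rw [← ENNReal.ofReal_natCast, ← ENNReal.ofReal_mul (by linarith)]
  refine ENNReal.ofReal_le_ofReal ?_
  rw [show y.1 + T - (y.1 - T) = 2 * T by ring]
  gcongr

/-- Since m ≤ N, the radius is at least one grid length and the number of grid points is comparable
to the continuum volume. Counting measure carries no weight, hence the factor 2^{dN}, which is
cancelled in the end. -/
theorem stVolume_ball_le (y : SpaceTime d N) {R : ℝ} (hR : 1 ≤ R) {m : ℕ} (hm : m ≤ N) :
    stVolume d N {z | stDist z y ≤ R * ((2 : ℝ) ^ m)⁻¹} ≤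
      ENNReal.ofReal (2 * 3 ^ d * R ^ (d + 2) * (((2 : ℝ) ^ (scalingSize d * m))⁻¹ * 2 ^ (d * N))) := by
  have hs : scalingSize d = d + 2 := by
    simp [scalingSize, scaling, Fin.sum_univ_succ, Fin.succ_ne_zero]; omega
  set r := R * ((2 : ℝ) ^ m)⁻¹ with hr
  have hr0 : 0 ≤ r := by positivity
  have hsub : {z : SpaceTime d N | stDist z y ≤ r} ⊆
      {z | |z.1 - y.1| ≤ r ^ 2 ∧ ∀ i, |coord (z - y) (Fin.succ i)| ≤ r} := by
    intro z hz
    have h := (scaledNorm_le_iff hr0).1 (show scaledNorm (coord (z - y)) ≤ r from hz)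
    refine ⟨?_, fun i => ?_⟩
    · simpa [coord, scaling] using h 0
    · simpa [scaling, Fin.succ_ne_zero] using h i.succ
  refine (measure_mono hsub).trans ((stVolume_box_le y (by positivity) hr0).trans ?_)
  refine ENNReal.ofReal_le_ofReal ?_
  have h1 : 1 ≤ r * 2 ^ N := by
    rw [hr]
    have : (2 : ℝ) ^ m ≤ 2 ^ N := pow_le_pow_right₀ (by norm_num) hm
    have h2 : 1 ≤ ((2 : ℝ) ^ m)⁻¹ * 2 ^ N := by
      rw [inv_mul_eq_div, le_div_iff₀ (by positivity)]; linarith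
    nlinarith
  calc 2 * r ^ 2 * (2 * (r * 2 ^ N) + 1) ^ d ≤ 2 * r ^ 2 * (3 * (r * 2 ^ N)) ^ d := by
        gcongr; linarith
    _ = _ := by
        rw [hr, hs, mul_comm (d + 2) m, pow_mul, mul_comm d N, pow_mul]
        generalize (2 : ℝ) ^ m = a
        generalize (2 : ℝ) ^ N = b
        ring

end GenConv
end

/-! ### Integrals of tree weights. -/

noncomputable section
namespace GenConv

open MeasureTheory

variable {d N : ℕ}

theorem sum_pow_le_of_injOn {q : ℝ} (hq : 0 ≤ q) (hq1 : q < 1) (s : Finset ℕ) (f : ℕ → ℕ)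
    (hf : Set.InjOn f s) : ∑ m ∈ s, q ^ f m ≤ (1 - q)⁻¹ := by
  rw [← Finset.sum_image (f := fun k => q ^ k) hf, ← tsum_geometric_of_lt_one hq hq1]
  exact (summable_geometric_of_lt_one hq hq1).sum_le_tsum _ fun _ _ => by positivity

/-- The gap to L is injective on either side of L, so two geometric series suffice, uniformly in N
and L. -/
theorem sum_pow_gap_le {q : ℝ} (hq : 0 ≤ q) (hq1 : q < 1) (N L : ℕ) :
    ∑ m ∈ Finset.range (N + 1), q ^ gap m L ≤ 2 * (1 - q)⁻¹ := by
  rw [← Finset.sum_filter_add_sum_filter_not _ (fun m => m ≤ L), two_mul]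
  refine add_le_add (sum_pow_le_of_injOn hq hq1 _ _ ?_) (sum_pow_le_of_injOn hq hq1 _ _ ?_)
  · intro a ha b hb hab
    simp only [Finset.coe_filter, Set.mem_ofPred_eq] at ha hb
    simp only [gap] at hab; omega
  · intro a ha b hb hab
    simp only [Finset.coe_filter, Set.mem_ofPred_eq] at ha hb
    simp only [gap] at hab; omega

namespace LabelledGraph

theorem measurable_scaleIdx (N : ℕ) : Measurable (scaleIdx N) := by
  classical
  have : scaleIdx N = fun x => ∑ k ∈ Finset.Icc 1 N, if x ≤ ((2 : ℝ) ^ k)⁻¹ then 1 else 0 := by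
    ext x
    rw [scaleIdx, scaleCount, Finset.card_filter]
  rw [this]
  exact Finset.measurable_fun_sum _ fun k _ =>
    Measurable.ite measurableSet_Iic measurable_const measurable_const

theorem measurable_treeWeight (dim δ R : ℝ) (N L : ℕ) : Measurable (treeWeight dim δ R N L) := by
  unfold treeWeight
  refine Measurable.ite measurableSet_Iic ?_ measurable_const
  have h : Measurable fun n : ℕ => (2 : ℝ) ^ (dim * n - δ * gap n L) := Measurable.of_discrete
  exact h.comp (measurable_scaleIdx N)

theorem treeWeight_le {dim δ R : ℝ} (hdim : 0 ≤ dim) (hδ : 0 ≤ δ) (N L : ℕ) (x : ℝ) :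
    treeWeight dim δ R N L x ≤ (2 : ℝ) ^ (dim * N) := by
  unfold treeWeight
  split_ifs
  · refine Real.rpow_le_rpow_of_exponent_le (by norm_num) ?_
    have h1 : (scaleIdx N x : ℝ) ≤ N := by exact_mod_cast scaleIdx_le N x
    have h2 : 0 ≤ δ * gap (scaleIdx N x) L := by positivity
    nlinarith
  · positivity

theorem treeWeight_le_sum {dim δ R : ℝ} (hR : 1 ≤ R) (N L : ℕ) (x : ℝ) :
    treeWeight dim δ R N L x ≤ ∑ m ∈ Finset.range (N + 1),
      if x ≤ R * ((2 : ℝ) ^ m)⁻¹ then (2 : ℝ) ^ (dim * m - δ * gap m L) else 0 := by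
  have h0 : ∀ m ∈ Finset.range (N + 1),
      0 ≤ if x ≤ R * ((2 : ℝ) ^ m)⁻¹ then (2 : ℝ) ^ (dim * m - δ * gap m L) else 0 := fun m _ => by
    split_ifs <;> positivity
  unfold treeWeight
  split_ifs with h
  · have hmem : scaleIdx N x ∈ Finset.range (N + 1) :=
      Finset.mem_range.2 (Nat.lt_succ_of_le (scaleIdx_le N x))
    refine le_trans (le_of_eq ?_) (Finset.single_le_sum h0 hmem)
    rw [if_pos]
    rcases Nat.eq_zero_or_pos (scaleIdx N x) with h1 | h1
    · rw [h1]; simpa using h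
    · have h2 := (le_scaleIdx_iff h1 (scaleIdx_le N x)).1 le_rfl
      refine h2.trans (le_mul_of_one_le_left (by positivity) hR)
  · exact Finset.sum_nonneg h0

theorem measurable_stDist_left (y : SpaceTime d N) : Measurable fun z => stDist z y := by
  have h : Measurable fun z : SpaceTime d N => (z, y) := measurable_id.prodMk measurable_const
  have h2 := measurable_stDist.comp h
  simpa only [Function.comp_def] using h2

/-- The integral of the weight of an edge of a spanning tree. -/
theorem lintegral_treeWeight_le (d : ℕ) {δ R : ℝ} (hδ : 0 < δ) (hR : 1 ≤ R) :
    ∃ C : ℝ, 0 ≤ C ∧ ∀ (N L : ℕ) (y : SpaceTime d N),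
      ∫⁻ z, ENNReal.ofReal (treeWeight (scalingSize d) δ R N L (stDist z y)) ∂stVolume d N ≤
        ENNReal.ofReal (C * 2 ^ (d * N)) := by
  set q : ℝ := 2 ^ (-δ) with hq
  have hq0 : 0 ≤ q := by positivity
  have hq1 : q < 1 := Real.rpow_lt_one_of_one_lt_of_neg (by norm_num) (by linarith)
  have hq2 : 0 ≤ (1 - q)⁻¹ := inv_nonneg.2 (by linarith)
  set K : ℝ := 2 * 3 ^ d * R ^ (d + 2) with hK
  have hK0 : 0 ≤ K := by positivity
  refine ⟨K * (2 * (1 - q)⁻¹), by positivity, fun N L y => ?_⟩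
  have hset : ∀ m : ℕ, MeasurableSet {z : SpaceTime d N | stDist z y ≤ R * ((2 : ℝ) ^ m)⁻¹} :=
    fun m => measurableSet_le (measurable_stDist_left y) measurable_const
  calc _ ≤ ∫⁻ z, ∑ m ∈ Finset.range (N + 1),
        Set.indicator {z : SpaceTime d N | stDist z y ≤ R * ((2 : ℝ) ^ m)⁻¹}
          (fun _ => ENNReal.ofReal ((2 : ℝ) ^ (scalingSize d * m - δ * gap m L))) z
          ∂stVolume d N := by
        refine lintegral_mono fun z => ?_
        refine (ENNReal.ofReal_le_ofReal (treeWeight_le_sum hR N L _)).trans ?_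
        rw [ENNReal.ofReal_sum_of_nonneg fun m _ => by split_ifs <;> positivity]
        refine Finset.sum_le_sum fun m _ => ?_
        rw [Set.indicator_apply]
        simp only [Set.mem_ofPred_eq]
        split_ifs <;> simp
    _ = ∑ m ∈ Finset.range (N + 1),
          ENNReal.ofReal ((2 : ℝ) ^ (scalingSize d * m - δ * gap m L)) *
          stVolume d N {z : SpaceTime d N | stDist z y ≤ R * ((2 : ℝ) ^ m)⁻¹} := by
        rw [lintegral_finsetSum _ fun m _ => measurable_const.indicator (hset m)]
        refine Finset.sum_congr rfl fun m _ => ?_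
        rw [lintegral_indicator_const (hset m)]
    -- The volume of the ball cancels 2^{|𝔰|m}; only the margin δ makes the sum over scales
    -- converge.
    _ ≤ ∑ m ∈ Finset.range (N + 1), ENNReal.ofReal (K * 2 ^ (d * N) * q ^ gap m L) := by
        refine Finset.sum_le_sum fun m hm => ?_
        rw [Finset.mem_range] at hm
        refine (mul_le_mul_right (stVolume_ball_le y hR (by omega)) _).trans (le_of_eq ?_)
        rw [← ENNReal.ofReal_mul (by positivity)]
        congr 1
        have e1 : (2 : ℝ) ^ (scalingSize d * m - δ * gap m L) =
            2 ^ (scalingSize d * m) * q ^ gap m L := by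
          rw [sub_eq_add_neg, Real.rpow_add (by norm_num), hq, ← Real.rpow_natCast (2 ^ (-δ)),
            ← Real.rpow_mul (by norm_num), ← Real.rpow_natCast (2 : ℝ) (scalingSize d * m)]
          push_cast
          rw [neg_mul]
        rw [e1, ← hK]
        have e2 : (2 : ℝ) ^ (scalingSize d * m) ≠ 0 := by positivity
        field_simp
    _ = ENNReal.ofReal (∑ m ∈ Finset.range (N + 1), K * 2 ^ (d * N) * q ^ gap m L) := by
        rw [ENNReal.ofReal_sum_of_nonneg fun m _ => by positivity]
    _ ≤ _ := by
        refine ENNReal.ofReal_le_ofReal ?_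
        rw [← Finset.mul_sum]
        calc _ ≤ K * 2 ^ (d * N) * (2 * (1 - q)⁻¹) := by
              gcongr; exact sum_pow_gap_le hq0 hq1 N L
          _ = _ := by ring

variable {V E : Type*} [Fintype V] [DecidableEq V] [Fintype E] [DecidableEq E] {M : ℕ}

/-- The configuration with the vertex `0` at the origin and the other ones at given points. -/
def extend (G : LabelledGraph V E M) (z : {v // v ≠ G.origin} → SpaceTime d N) (v : V) :
    SpaceTime d N :=
  if h : v ≠ G.origin then z ⟨v, h⟩ else 0

theorem measurable_extend (G : LabelledGraph V E M) (v : V) :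
    Measurable fun z : {v // v ≠ G.origin} → SpaceTime d N => G.extend z v := by
  unfold extend
  split_ifs with h
  · exact measurable_pi_apply _
  · exact measurable_const

/-- The integral of a sum over spanning trees. -/
theorem lintegral_treeSum_le (G : LabelledGraph V E M) (w : ℝ → ℝ) (hw : Measurable w)
    (hw0 : ∀ x, 0 ≤ w x) (b : {v // v ≠ G.origin} → SpaceTime d N → ENNReal)
    (hb : ∀ v, Measurable (b v)) (A : {v // v ≠ G.origin} → ENNReal)
    (hA : ∀ v y, ∫⁻ z, ENNReal.ofReal (w (stDist z y)) * b v z ∂stVolume d N ≤ A v) :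
    ∫⁻ z, ENNReal.ofReal (G.treeSum w (G.extend z)) * ∏ v, b v (z v)
        ∂Measure.pi (fun _ => stVolume d N) ≤
      ((Fintype.card V).factorial : ENNReal) * ∏ v, ((Fintype.card V : ENNReal) * A v) := by
  classical
  set I := Finset.univ.filter (fun i : Fin (Fintype.card V) => i.val ≠ 0) with hI
  set S := Finset.univ.filter (fun σ : Fin (Fintype.card V) ≃ V =>
      ∀ i, σ i = G.origin ↔ i.val = 0) with hS
  -- The factor attached to a vertex involves only vertices that precede it in σ, as required for
  -- the iterated integration.
  let F : (Fin (Fintype.card V) ≃ V) → {v // v ≠ G.origin} →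
      ({v // v ≠ G.origin} → SpaceTime d N) → ENNReal := fun σ v z =>
    (∑ j ∈ Finset.univ.filter (fun j => j < σ.symm v),
      ENNReal.ofReal (w (stDist (z v) (G.extend z (σ j))))) * b v (z v)
  have hterm : ∀ (σ : Fin (Fintype.card V) ≃ V) (v : {v // v ≠ G.origin})
      (j : Fin (Fintype.card V)), Measurable
      fun z : {v // v ≠ G.origin} → SpaceTime d N =>
        ENNReal.ofReal (w (stDist (z v) (G.extend z (σ j)))) := fun σ v j =>
    (hw.comp (measurable_stDist.comp
      ((measurable_pi_apply v).prodMk (G.measurable_extend (σ j))))).ennreal_ofReal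
  have hF : ∀ σ v, Measurable (F σ v) := fun σ v =>
    (Finset.measurable_fun_sum _ fun j _ => hterm σ v j).mul ((hb v).comp (measurable_pi_apply v))
  have hpt : ∀ z : {v // v ≠ G.origin} → SpaceTime d N,
      ENNReal.ofReal (G.treeSum w (G.extend z)) * ∏ v, b v (z v) = ∑ σ ∈ S, ∏ v, F σ v z := by
    intro z
    rw [treeSum, ENNReal.ofReal_sum_of_nonneg fun σ _ => Finset.prod_nonneg fun i _ =>
      Finset.sum_nonneg fun j _ => hw0 _, Finset.sum_mul]
    refine Finset.sum_congr rfl fun σ hσ => ?_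
    rw [Finset.prod_mul_distrib]
    congr 1
    rw [ENNReal.ofReal_prod_of_nonneg fun i _ => Finset.sum_nonneg fun j _ => hw0 _]
    have hσ' : ∀ i, σ i = G.origin ↔ i.val = 0 := by simpa [hS] using hσ
    refine Finset.prod_bij' (fun i hi => ⟨σ i, fun h => ?_⟩) (fun v _ => σ.symm v)
      ?_ ?_ ?_ ?_ ?_
    · exact (Finset.mem_filter.1 hi).2 ((hσ' i).1 h)
    · intro i hi; exact Finset.mem_univ _
    · intro v _
      rw [Finset.mem_filter]
      refine ⟨Finset.mem_univ _, fun h => v.2 ?_⟩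
      have := (hσ' (σ.symm v)).2 h
      rwa [σ.apply_symm_apply] at this
    · intro i hi; simp
    · intro v _; simp
    · intro i hi
      rw [ENNReal.ofReal_sum_of_nonneg fun j _ => hw0 _]
      have hne : σ i ≠ G.origin := fun h => (Finset.mem_filter.1 hi).2 ((hσ' i).1 h)
      simp [extend, hne]
  have hone : ∀ σ ∈ S, ∫⁻ z, ∏ v, F σ v z ∂Measure.pi (fun _ => stVolume d N) ≤
      ∏ v, ((Fintype.card V : ENNReal) * A v) := by
    intro σ hσ
    have h := lmarginal_prod_le (stVolume d N)
      (fun v : {v // v ≠ G.origin} => (σ.symm v : ℕ))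
      (fun u v huv => Subtype.ext (σ.symm.injective (Fin.ext huv))) (F σ) (hF σ)
      (fun v => (Fintype.card V : ENNReal) * A v) ?_ ?_ Finset.univ 0
    · simpa only [lmarginal_univ] using h
    · intro v x y hxy
      have hv := hxy v le_rfl
      simp only [F]
      rw [hv]
      congr 1
      refine Finset.sum_congr rfl fun j hj => ?_
      have hj' : j < σ.symm v := (Finset.mem_filter.1 hj).2
      have : G.extend x (σ j) = G.extend y (σ j) := by
        unfold extend
        split_ifs with h
        · refine hxy ⟨σ j, h⟩ ?_
          simp only [σ.symm_apply_apply]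
          exact hj'.le
        · rfl
      rw [this]
    · intro v x
      have h1 : ∀ u j, j < σ.symm v →
          G.extend (Function.update x v u) (σ j) = G.extend x (σ j) := by
        intro u j hj
        unfold extend
        split_ifs with h
        · refine Function.update_of_ne (fun h' => ?_) _ _
          rw [← h', σ.symm_apply_apply] at hj
          exact lt_irrefl _ hj
        · rfl
      calc ∫⁻ u, F σ v (Function.update x v u) ∂stVolume d N
          = ∫⁻ u, ∑ j ∈ Finset.univ.filter (fun j => j < σ.symm v),
              ENNReal.ofReal (w (stDist u (G.extend x (σ j)))) * b v u ∂stVolume d N := by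
            refine lintegral_congr fun u => ?_
            simp only [F, Function.update_self]
            rw [Finset.sum_mul]
            refine Finset.sum_congr rfl fun j hj => ?_
            rw [h1 u j (Finset.mem_filter.1 hj).2]
        _ = ∑ j ∈ Finset.univ.filter (fun j => j < σ.symm v),
              ∫⁻ u, ENNReal.ofReal (w (stDist u (G.extend x (σ j)))) * b v u ∂stVolume d N :=
            lintegral_finsetSum _ fun j _ =>
              ((hw.comp (measurable_stDist_left _)).ennreal_ofReal).mul (hb v)
        _ ≤ ∑ j ∈ Finset.univ.filter (fun j => j < σ.symm v), A v :=
            Finset.sum_le_sum fun j _ => hA v _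
        _ ≤ (Fintype.card V : ENNReal) * A v := by
            rw [Finset.sum_const, nsmul_eq_mul]
            gcongr
            simpa using Finset.card_le_univ (Finset.univ.filter (fun j => j < σ.symm v))
  simp only [hpt]
  rw [lintegral_finsetSum _ fun σ _ => Finset.measurable_fun_prod _ fun v _ => hF σ v]
  calc _ ≤ ∑ σ ∈ S, ∏ v, ((Fintype.card V : ENNReal) * A v) := Finset.sum_le_sum hone
    _ ≤ _ := by
      rw [Finset.sum_const, nsmul_eq_mul]
      gcongr
      have h2 : Fintype.card (Fin (Fintype.card V) ≃ V) = (Fintype.card V).factorial := by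
        rw [Fintype.card_equiv (Fintype.equivFin V).symm, Fintype.card_fin]
      exact h2 ▸ Finset.card_le_univ S

end LabelledGraph
end GenConv
end

/-! ### Integration over configurations. -/

noncomputable section
namespace GenConv

open MeasureTheory

variable {d N : ℕ}

theorem lintegral_pi_stVolume {ι : Type*} [Fintype ι] [DecidableEq ι]
    (g : (ι → SpaceTime d N) → ENNReal) (hg : Measurable g) :
    ∫⁻ z, g z ∂Measure.pi (fun _ => stVolume d N) =
      ∑ x : ι → Fin d → ZMod (2 ^ N), ∫⁻ t : ι → ℝ, g fun v => (t v, x v) := by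
  have hmp := measurePreserving_arrowProdEquivProdArrow ℝ (Fin d → ZMod (2 ^ N)) ι
    (fun _ => (volume : Measure ℝ)) (fun _ => Measure.count)
  have h1 := (MeasurePreserving.symm _ hmp).lintegral_comp hg
  have hg' : Measurable fun p => g ((MeasurableEquiv.arrowProdEquivProdArrow ℝ
      (Fin d → ZMod (2 ^ N)) ι).symm p) := hg.comp (MeasurableEquiv.measurable _)
  change _ = ∫⁻ z, g z ∂Measure.pi (fun _ => stVolume d N) at h1
  rw [← h1, lintegral_prod_symm _ hg'.aemeasurable, lintegral_fintype]
  refine Finset.sum_congr rfl fun x _ => ?_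
  rw [Measure.pi_singleton]
  simp only [Measure.count_singleton, Finset.prod_const_one, mul_one]
  rfl

namespace LabelledGraph

variable {V E : Type*} [Fintype V] [DecidableEq V] [Fintype E] [DecidableEq E] {M : ℕ}

theorem place_origin (G : LabelledGraph V E M) (t : {v // v ≠ G.origin} → ℝ)
    (x : {v // v ≠ G.origin} → Fin d → ZMod (2 ^ N)) : G.place t x G.origin = 0 := by
  simp [place]

/-- The time of a vertex, as a linear functional. -/
def timeMap (G : LabelledGraph V E M) (v : V) : ({v // v ≠ G.origin} → ℝ) →ₗ[ℝ] ℝ :=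
  if h : v ≠ G.origin then LinearMap.proj ⟨v, h⟩ else 0

theorem place_fst (G : LabelledGraph V E M) (t : {v // v ≠ G.origin} → ℝ)
    (x : {v // v ≠ G.origin} → Fin d → ZMod (2 ^ N)) (v : V) :
    (G.place t x v).1 = G.timeMap v t := by
  unfold place timeMap
  split_ifs <;> rfl

theorem timeMap_ne (G : LabelledGraph V E M) {u v : V} (huv : u ≠ v) :
    G.timeMap u ≠ G.timeMap v := by
  have key : ∀ u v : V, u ≠ v → u ≠ G.origin → G.timeMap u ≠ G.timeMap v := by
    intro u v huv hu h
    have h1 := congrArg (fun f : ({v // v ≠ G.origin} → ℝ) →ₗ[ℝ] ℝ =>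
      f (Pi.single ⟨u, hu⟩ 1)) h
    simp only [timeMap, dif_pos hu, LinearMap.proj_apply, Pi.single_eq_same] at h1
    split_ifs at h1 with hv
    · rw [LinearMap.proj_apply, Pi.single_eq_of_ne (fun h' => huv (Subtype.ext_iff.1 h').symm)] at h1
      exact one_ne_zero h1
    · exact one_ne_zero h1
  by_cases hu : u = G.origin
  · exact (key v u huv.symm fun h => huv (hu.trans h.symm)).symm
  · exact key u v huv hu

/-- Almost surely, the points of a configuration are distinct. -/
theorem ae_place_injective (G : LabelledGraph V E M)
    (x : {v // v ≠ G.origin} → Fin d → ZMod (2 ^ N)) :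
    ∀ᵐ t : {v // v ≠ G.origin} → ℝ, ∀ u v, u ≠ v → G.place t x u ≠ G.place t x v := by
  rw [ae_all_iff]; intro u
  rw [ae_all_iff]; intro v
  by_cases huv : u = v
  · simp [huv]
  -- Coinciding points have equal times, and this confines the times to a proper linear subspace.
  have hne : LinearMap.ker (G.timeMap u - G.timeMap v) ≠ ⊤ := fun h =>
    G.timeMap_ne huv (sub_eq_zero.1 (LinearMap.ker_eq_top.1 h))
  have h0 := Measure.addHaar_submodule (volume : Measure ({v // v ≠ G.origin} → ℝ)) _ hne
  refine measure_mono_null (fun t ht => ?_) h0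
  have ht' : ¬ (u ≠ v → G.place t x u ≠ G.place t x v) := ht
  push Not at ht'
  have h1 := congrArg Prod.fst ht'.2
  rw [place_fst, place_fst] at h1
  rw [SetLike.mem_coe, LinearMap.mem_ker, LinearMap.sub_apply, h1, sub_self]

/-- The lower integral over all configurations. -/
def lintegralConfig (G : LabelledGraph V E M) (F : (V → SpaceTime d N) → ℝ) : ENNReal :=
  ∑ x : {v // v ≠ G.origin} → Fin d → ZMod (2 ^ N),
      ∫⁻ t : {v // v ≠ G.origin} → ℝ, ENNReal.ofReal (F (G.place t x))

/-- Distinct points may be assumed because coincidences are negligible; this matters since the value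
of a kernel at 0 is arbitrary. -/
theorem lintegralConfig_le (G : LabelledGraph V E M) {F : (V → SpaceTime d N) → ℝ}
    {g : ({v // v ≠ G.origin} → SpaceTime d N) → ENNReal} (hg : Measurable g)
    (h : ∀ z : {v // v ≠ G.origin} → SpaceTime d N,
      (∀ u v, u ≠ v → G.extend z u ≠ G.extend z v) → ENNReal.ofReal (F (G.extend z)) ≤ g z) :
    G.lintegralConfig F ≤ ∫⁻ z, g z ∂Measure.pi (fun _ => stVolume d N) := by
  rw [lintegral_pi_stVolume g hg, lintegralConfig]
  refine Finset.sum_le_sum fun x _ => lintegral_mono_ae ?_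
  filter_upwards [G.ae_place_injective x] with t ht
  exact h _ ht

theorem integrableConfig_of_lintegralConfig (G : LabelledGraph V E M)
    {F F' : (V → SpaceTime d N) → ℝ} (hF : ∀ x, Measurable fun t => F (G.place t x))
    (hle : ∀ z, z G.origin = 0 → |F z| ≤ F' z) (hfin : G.lintegralConfig F' < ⊤) : G.IntegrableConfig F := by
  intro x
  refine ⟨(hF x).aestronglyMeasurable, ?_⟩
  have h1 : ∫⁻ t : {v // v ≠ G.origin} → ℝ, ENNReal.ofReal (F' (G.place t x)) < ⊤ :=
    lt_of_le_of_lt (Finset.single_le_sum (f := fun x =>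
      ∫⁻ t : {v // v ≠ G.origin} → ℝ, ENNReal.ofReal (F' (G.place t x)))
      (fun _ _ => zero_le) (Finset.mem_univ x)) hfin
  refine lt_of_le_of_lt (lintegral_mono fun t => ?_) h1
  rw [Real.enorm_eq_ofReal_abs]
  exact ENNReal.ofReal_le_ofReal (hle _ (G.place_origin t x))

/-- Sums of integrals are bounded by the lower integral of the sum of the moduli. -/
theorem sum_abs_integralConfig_le (G : LabelledGraph V E M) {κ : Type*} (s : Finset κ)
    {F : κ → (V → SpaceTime d N) → ℝ} {F' : (V → SpaceTime d N) → ℝ}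
    (hF : ∀ n ∈ s, ∀ x, Measurable fun t => F n (G.place t x))
    (hle : ∀ z, z G.origin = 0 → ∑ n ∈ s, |F n z| ≤ F' z) {B : ℝ} (hB : 0 ≤ B)
    (hfin : G.lintegralConfig F' ≤ ENNReal.ofReal B) :
    ∑ n ∈ s, |G.integralConfig (F n)| ≤
      (((2 : ℝ) ^ (d * N))⁻¹) ^ (Fintype.card {v // v ≠ G.origin}) * B := by
  have habs : ∀ n ∈ s, |G.integralConfig (F n)| ≤
      (((2 : ℝ) ^ (d * N))⁻¹) ^ (Fintype.card {v // v ≠ G.origin}) *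
      ∑ x : {v // v ≠ G.origin} → Fin d → ZMod (2 ^ N),
        ∫ t : {v // v ≠ G.origin} → ℝ, |F n (G.place t x)| := fun n _ => by
    rw [integralConfig, abs_mul, abs_of_nonneg (by positivity)]
    gcongr
    exact (Finset.abs_sum_le_sum_abs _ _).trans
      (Finset.sum_le_sum fun x _ => abs_integral_le_integral_abs)
  refine (Finset.sum_le_sum habs).trans ?_
  rw [← Finset.mul_sum]
  gcongr
  have hnn : 0 ≤ ∑ n ∈ s, ∑ x : {v // v ≠ G.origin} → Fin d → ZMod (2 ^ N),
        ∫ t : {v // v ≠ G.origin} → ℝ, |F n (G.place t x)| :=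
    Finset.sum_nonneg fun n _ => Finset.sum_nonneg fun x _ => integral_nonneg fun t => abs_nonneg _
  rw [← ENNReal.ofReal_le_ofReal_iff hB]
  refine le_trans ?_ hfin
  rw [ENNReal.ofReal_sum_of_nonneg fun n _ => Finset.sum_nonneg fun x _ =>
    integral_nonneg fun t => abs_nonneg _]
  have h1 : ∀ n ∈ s, ENNReal.ofReal (∑ x : {v // v ≠ G.origin} → Fin d → ZMod (2 ^ N),
        ∫ t : {v // v ≠ G.origin} → ℝ, |F n (G.place t x)|) ≤
      ∑ x : {v // v ≠ G.origin} → Fin d → ZMod (2 ^ N),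
        ∫⁻ t : {v // v ≠ G.origin} → ℝ, ENNReal.ofReal |F n (G.place t x)| := fun n _ => by
    rw [ENNReal.ofReal_sum_of_nonneg fun x _ => integral_nonneg fun t => abs_nonneg _]
    refine Finset.sum_le_sum fun x _ => ?_
    have h2 : ENNReal.ofReal (∫ t : {v // v ≠ G.origin} → ℝ, |F n (G.place t x)|) ≤
        ‖∫ t : {v // v ≠ G.origin} → ℝ, |F n (G.place t x)|‖ₑ := by
      rw [Real.enorm_eq_ofReal_abs]; exact ENNReal.ofReal_le_ofReal (le_abs_self _)
    refine h2.trans ((enorm_integral_le_lintegral_enorm _).trans (le_of_eq ?_))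
    refine lintegral_congr fun t => ?_
    rw [Real.enorm_eq_ofReal_abs, abs_abs]
  refine (Finset.sum_le_sum h1).trans ?_
  rw [Finset.sum_comm, lintegralConfig]
  refine Finset.sum_le_sum fun x _ => ?_
  rw [← lintegral_finsetSum' _ fun n hn => ((hF n hn x).abs.ennreal_ofReal).aemeasurable]
  refine lintegral_mono fun t => ?_
  rw [← ENNReal.ofReal_sum_of_nonneg fun n _ => abs_nonneg _]
  exact ENNReal.ofReal_le_ofReal (hle _ (G.place_origin t x))

end LabelledGraph
end GenConv
end

/-! ### Confinement of the distinguished vertices and the main integral bound. -/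

noncomputable section
namespace GenConv

open MeasureTheory

variable {d N : ℕ}

open Classical in
/-- The indicator function of a box around the origin. -/
def boxInd (ρ lam mu : ℝ) (z : SpaceTime d N) : ℝ :=
  if |z.1| ≤ (ρ * mu) ^ 2 ∧ ∀ i, |coord z (Fin.succ i)| ≤ ρ * lam then 1 else 0

theorem boxInd_nonneg (ρ lam mu : ℝ) (z : SpaceTime d N) : 0 ≤ boxInd ρ lam mu z := by
  unfold boxInd; split_ifs <;> norm_num

theorem boxInd_le_one (ρ lam mu : ℝ) (z : SpaceTime d N) : boxInd ρ lam mu z ≤ 1 := by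
  unfold boxInd; split_ifs <;> norm_num

theorem measurableSet_box (a b : ℝ) : MeasurableSet {z : SpaceTime d N | |z.1| ≤ a ∧
    ∀ i, |coord z (Fin.succ i)| ≤ b} := by
  have h1 : MeasurableSet {z : SpaceTime d N | |z.1| ≤ a} :=
    measurableSet_le measurable_fst.abs measurable_const
  have h2 : ∀ i : Fin d, MeasurableSet {z : SpaceTime d N | |coord z (Fin.succ i)| ≤ b} := fun i =>
    measurableSet_le ((measurable_pi_apply (Fin.succ i)).comp measurable_coord).abs
      measurable_const
  have h3 := h1.inter (MeasurableSet.iInter h2)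
  have h4 : {z : SpaceTime d N | |z.1| ≤ a ∧ ∀ i, |coord z (Fin.succ i)| ≤ b} =
      {z | |z.1| ≤ a} ∩ ⋂ i, {z | |coord z (Fin.succ i)| ≤ b} := by
    ext z; simp
  rw [h4]; exact h3

theorem measurable_boxInd (ρ lam mu : ℝ) :
    Measurable (boxInd ρ lam mu : SpaceTime d N → ℝ) := by
  classical
  exact Measurable.ite (measurableSet_box _ _) measurable_const measurable_const

/-- The ratio of the volumes of the boxes of sizes `μ` and `2^{-N}` in time, if `μ < 2^{-N}`. -/
def timeRatio (N : ℕ) (mu : ℝ) : ℝ :=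
  if mu < (2 : ℝ) ^ (-(N : ℝ)) then mu ^ 2 * (2 : ℝ) ^ (2 * N) else 1

theorem timeRatio_nonneg (N : ℕ) (mu : ℝ) : 0 ≤ timeRatio N mu := by
  unfold timeRatio; split_ifs <;> positivity

/-- For x ≥ 1 the choice is L = 0; the truncation at 1 is harmless because the kernels of the
distinguished edges have range 1. -/
theorem exists_dyadic_near {x : ℝ} (hx : 0 < x) : ∃ L : ℕ, min 1 x ≤ ((2 : ℝ) ^ L)⁻¹ ∧
    ((2 : ℝ) ^ L)⁻¹ ≤ 2 * x ∧ ∀ N : ℕ, ((2 : ℝ) ^ N)⁻¹ ≤ x → L ≤ N := by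
  rcases lt_or_ge x 1 with h | h
  · obtain ⟨n, h1, h2⟩ := exists_nat_pow_near_of_lt_one hx h.le (y := (2 : ℝ)⁻¹) (by norm_num)
      (by norm_num)
    rw [inv_pow] at h1 h2
    refine ⟨n, (min_le_right _ _).trans h2, ?_, fun N hN => ?_⟩
    · rw [pow_succ, mul_inv] at h1; linarith
    · have h3 := hN.trans h2
      rw [inv_le_inv₀ (by positivity) (by positivity)] at h3
      exact (pow_le_pow_iff_right₀ (by norm_num)).1 h3
  · exact ⟨0, by simp, by norm_num; linarith, fun N _ => Nat.zero_le _⟩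

theorem stDist_zero_le_of_boxInd {ρ lam mu : ℝ} (hρ : 0 ≤ ρ) (hmu : 0 ≤ mu) (hle : mu ≤ lam)
    {z : SpaceTime d N} (h : boxInd ρ lam mu z ≠ 0) : stDist z 0 ≤ ρ * lam := by
  have h' : |z.1| ≤ (ρ * mu) ^ 2 ∧ ∀ i, |coord z (Fin.succ i)| ≤ ρ * lam := by
    by_contra h'
    rw [boxInd, if_neg h'] at h
    exact h rfl
  have hl : 0 ≤ ρ * lam := mul_nonneg hρ (hmu.trans hle)
  rw [stDist, sub_zero, scaledNorm_le_iff hl]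
  intro i
  refine Fin.cases ?_ (fun i => ?_) i
  · simp only [coord, Fin.cons_zero, scaling, if_true]
    exact h'.1.trans (by gcongr)
  · simpa [scaling, Fin.succ_ne_zero] using h'.2 i

theorem scalingSize_eq (d : ℕ) : scalingSize d = d + 2 := by
  simp [scalingSize, scaling, Fin.sum_univ_succ, Fin.succ_ne_zero]; omega

namespace LabelledGraph

variable {V E : Type*} [Fintype V] [DecidableEq V] [Fintype E] [DecidableEq E] {M : ℕ}

/-- For the partition into a single cluster every edge contributes just a_e, so the first condition
is a statement on α. -/
theorem alpha_nonneg (G : LabelledGraph V E M) (hG : G.PowerCounting d)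
    (hbase : ∀ e, 0 < G.r e → G.base e ≠ G.src e) : 0 ≤ G.alpha d := by
  have h := G.sum_edgeDegree_le hG hbase (fun _ => G.origin)
  have : Nonempty V := ⟨G.origin⟩
  have h1 : (Finset.univ.image fun _ : V => G.origin) = {G.origin} :=
    Finset.image_const Finset.univ_nonempty _
  rw [h1] at h
  simp only [edgeDegree, if_true, ne_eq, not_true, and_false, if_false, add_zero, sub_zero,
    Finset.card_singleton, Nat.cast_one] at h
  rw [alpha_eq]; linarith

theorem measurable_treeSum (G : LabelledGraph V E M) {w : ℝ → ℝ} (hw : Measurable w) :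
    Measurable fun z : {v // v ≠ G.origin} → SpaceTime d N => G.treeSum w (G.extend z) := by
  unfold treeSum
  refine Finset.measurable_fun_sum _ fun σ _ => Finset.measurable_fun_prod _ fun i _ =>
    Finset.measurable_fun_sum _ fun j _ => ?_
  have h1 := (G.measurable_extend (d := d) (N := N) (σ i)).prodMk (G.measurable_extend (σ j))
  have h2 := measurable_stDist.comp h1
  have h3 := hw.comp h2
  simpa only [Function.comp_def] using h3

/-- The distinguished vertices other than `0`. -/
def starPoint (G : LabelledGraph V E M) (i : Fin M) : {v // v ≠ G.origin} :=
  ⟨G.star i, G.star_ne_origin i⟩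

theorem starPoint_injective (G : LabelledGraph V E M) : Function.Injective G.starPoint :=
  fun _ _ h => G.star_injective (Subtype.ext_iff.1 h)

theorem prod_starPoint (G : LabelledGraph V E M) {R : Type*} [CommMonoid R]
    (f : {v // v ≠ G.origin} → R) :
    ∏ v, (if v ∈ Finset.univ.image G.starPoint then f v else 1) = ∏ i, f (G.starPoint i) := by
  rw [Finset.prod_ite_mem, Finset.univ_inter, Finset.prod_image G.starPoint_injective.injOn]

/-- The integral of the weight of an edge that ends in a small box. -/
theorem lintegral_treeWeight_box_le {δ R ρ lam mu : ℝ} (hδ : 0 ≤ δ) (hρ : 0 ≤ ρ)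
    (hmu : mu < (2 : ℝ) ^ (-(N : ℝ))) (hlam : lam = (2 : ℝ) ^ (-(N : ℝ))) (L : ℕ)
    (y : SpaceTime d N) :
    ∫⁻ z, ENNReal.ofReal (treeWeight (scalingSize d) δ R N L (stDist z y)) *
        ENNReal.ofReal (boxInd ρ lam mu z) ∂stVolume d N ≤
      ENNReal.ofReal (2 * ρ ^ 2 * (2 * ρ + 1) ^ d * timeRatio N mu * 2 ^ (d * N)) := by
  have hlam0 : 0 ≤ lam := by rw [hlam]; positivity
  have hbox := measurableSet_box (d := d) (N := N) ((ρ * mu) ^ 2) (ρ * lam)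
  have hvol := stVolume_box_le (0 : SpaceTime d N) (T := (ρ * mu) ^ 2) (s := ρ * lam)
    (by positivity) (by positivity)
  simp only [Prod.fst_zero, sub_zero] at hvol
  calc _ ≤ ∫⁻ z, Set.indicator {z : SpaceTime d N | |z.1| ≤ (ρ * mu) ^ 2 ∧
        ∀ i, |coord z (Fin.succ i)| ≤ ρ * lam}
        (fun _ => ENNReal.ofReal ((2 : ℝ) ^ ((scalingSize d : ℝ) * N))) z ∂stVolume d N := by
        refine lintegral_mono fun z => ?_
        rw [Set.indicator_apply]
        unfold boxInd
        simp only [Set.mem_ofPred_eq]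
        split_ifs with h
        · rw [ENNReal.ofReal_one, mul_one]
          exact ENNReal.ofReal_le_ofReal (treeWeight_le (Nat.cast_nonneg _) hδ N L _)
        · simp
    _ = ENNReal.ofReal ((2 : ℝ) ^ ((scalingSize d : ℝ) * N)) * stVolume d N
          {z : SpaceTime d N | |z.1| ≤ (ρ * mu) ^ 2 ∧
            ∀ i, |coord z (Fin.succ i)| ≤ ρ * lam} := lintegral_indicator_const hbox _
    _ ≤ ENNReal.ofReal ((2 : ℝ) ^ ((scalingSize d : ℝ) * N)) *
          ENNReal.ofReal (2 * (ρ * mu) ^ 2 * (2 * (ρ * lam * 2 ^ N) + 1) ^ d) := by gcongr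
    _ = _ := by
        rw [← ENNReal.ofReal_mul (by positivity)]
        congr 1
        -- The box is a bounded number of grid lengths wide, so its measure is of order μ². The
        -- weight is simply bounded by its maximum 2^{|𝔰|N} = 2^{dN}2^{2N}.
        have e1 : lam * 2 ^ N = 1 := by
          rw [hlam, ← Real.rpow_natCast, ← Real.rpow_add (by norm_num)]; simp
        have e2 : (2 : ℝ) ^ ((scalingSize d : ℝ) * N) = 2 ^ (d * N) * 2 ^ (2 * N) := by
          rw [scalingSize_eq, ← pow_add, ← add_mul, ← Real.rpow_natCast (2 : ℝ) ((d + 2) * N)]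
          push_cast; rfl
        rw [mul_assoc ρ, e1, e2, timeRatio, if_pos hmu]
        ring

/-- The bound on the integral of a product of functions attached to the edges, the distinguished
vertices being confined to a box. -/
theorem lintegralConfig_prod_le (G : LabelledGraph V E M) (hG : G.PowerCounting d)
    (hbase : ∀ e, 0 < G.r e → G.base e ≠ G.src e) {ρ : ℝ} (hρ : 1 ≤ ρ) :
    ∃ C : ℝ, 0 < C ∧ ∀ (N : ℕ) (lam mu : ℝ), 0 < mu →
      ((2 : ℝ) ^ (-(N : ℝ)) ≤ lam ∧ lam = mu ∧ lam ≤ 1) ∨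
            (mu < (2 : ℝ) ^ (-(N : ℝ)) ∧ lam = (2 : ℝ) ^ (-(N : ℝ))) →
      ∀ (W : E → (V → SpaceTime d N) → ℝ) (B : E → ℝ), (∀ e z, 0 ≤ W e z) → (∀ e, 0 ≤ B e) →
      (∀ e z, W e z ≠ 0 → stDist (z (G.tgt e)) (z (G.src e)) ≤ 1 ∨
        0 < G.r e ∧ stDist (z (G.base e)) (z (G.src e)) ≤ 1) →
      (∀ z : V → SpaceTime d N, (∀ u v, u ≠ v → z u ≠ z v) →
        ∀ cl : Clustering G.origin (configDist z),
        (∀ u v, configDist z u v ≤ 2 * Fintype.card V) →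
        ∀ e, W e z ≤ B e * G.edgeFactor cl N e) →
      G.lintegralConfig (fun z => (∏ e, W e z) * ∏ i, boxInd ρ lam mu (z (G.star i))) ≤
        ENNReal.ofReal ((∏ e, B e) * (C * lam ^ G.alpha d * timeRatio N mu ^ M *
          (2 ^ (d * N)) ^ Fintype.card {v // v ≠ G.origin})) := by
  classical
  obtain ⟨δ, hδ, hpt⟩ := G.prod_edges_le_treeSum hG hbase
  have hα := G.alpha_nonneg hG hbase
  set n : ℝ := (Fintype.card V : ℝ) with hn
  have hn1 : 1 ≤ n := by rw [hn]; exact_mod_cast Fintype.card_pos_iff.2 ⟨G.origin⟩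
  obtain ⟨C₁, hC₁, hint⟩ := lintegral_treeWeight_le d hδ (R := 2 * n) (by linarith)
  set C₃ := max C₁ (2 * ρ ^ 2 * (2 * ρ + 1) ^ d) with hC₃
  have hC₃0 : 0 < C₃ := lt_of_lt_of_le (by positivity) (le_max_right _ _)
  set c := Fintype.card {v // v ≠ G.origin} with hc
  refine ⟨(2 * ρ) ^ G.alpha d * ((Fintype.card V).factorial * (n * C₃) ^ c), by positivity, ?_⟩
  intro N lam mu hmu hcase W B hW hB htied hbound
  have hlow : (2 : ℝ) ^ (-(N : ℝ)) ≤ lam := by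
    rcases hcase with h | h
    · exact h.1
    · exact h.2.ge
  have hle : mu ≤ lam := by
    rcases hcase with h | h
    · exact h.2.1.ge
    · exact h.1.le.trans h.2.ge
  have hlam : 0 < lam := lt_of_lt_of_le (by positivity) hlow
  -- The scale L of the confinement; ρ ≥ 1 and λ ≥ 2^{-N} ensure L ≤ N.
  obtain ⟨L, hL1, hL2, hL3⟩ := exists_dyadic_near (x := ρ * lam) (by positivity)
  have hLN : L ≤ N := hL3 N (by
    rw [inv_two_pow_eq_rpow]
    nlinarith)
  set w := treeWeight (scalingSize d) δ (2 * n) N L with hw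
  have hw0 : ∀ x, 0 ≤ w x := treeWeight_nonneg _ _ _ _ _
  have hwm : Measurable w := measurable_treeWeight _ _ _ _ _
  set S := Finset.univ.image G.starPoint with hS
  set κ := timeRatio N mu with hκ
  have hκ0 : 0 ≤ κ := timeRatio_nonneg _ _
  let b : {v // v ≠ G.origin} → SpaceTime d N → ENNReal := fun v z =>
    if v ∈ S then ENNReal.ofReal (boxInd ρ lam mu z) else 1
  have hb : ∀ v, Measurable (b v) := fun v => by
    by_cases h : v ∈ S
    · simp only [b, h, if_true]; exact (measurable_boxInd _ _ _).ennreal_ofReal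
    · simp only [b, h, if_false]; exact measurable_const
  let A : {v // v ≠ G.origin} → ENNReal := fun v =>
    ENNReal.ofReal (C₃ * (if v ∈ S then κ else 1) * 2 ^ (d * N))
  have hA : ∀ v y, ∫⁻ z, ENNReal.ofReal (w (stDist z y)) * b v z ∂stVolume d N ≤ A v := by
    intro v y
    have hle1 : ∀ z, b v z ≤ 1 := fun z => by
      simp only [b]
      split_ifs
      · exact ENNReal.ofReal_le_one.2 (boxInd_le_one _ _ _ _)
      · exact le_rfl
    have hgen : ∫⁻ z, ENNReal.ofReal (w (stDist z y)) * b v z ∂stVolume d N ≤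
        ENNReal.ofReal (C₃ * 1 * 2 ^ (d * N)) := by
      calc _ ≤ ∫⁻ z, ENNReal.ofReal (w (stDist z y)) ∂stVolume d N :=
            lintegral_mono fun z => mul_le_of_le_one_right zero_le (hle1 z)
        _ ≤ ENNReal.ofReal (C₁ * 2 ^ (d * N)) := hint N L y
        _ ≤ _ := by
            refine ENNReal.ofReal_le_ofReal ?_
            rw [mul_one]; gcongr; exact le_max_left _ _
    by_cases hv : v ∈ S
    · simp only [A, hv, if_true]
      -- Only below the grid scale does the time confinement gain a factor; otherwise the box
      -- indicator is bounded by 1.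
      by_cases hsmall : mu < (2 : ℝ) ^ (-(N : ℝ))
      · have hlam' : lam = (2 : ℝ) ^ (-(N : ℝ)) := by
          rcases hcase with h | h
          · linarith [h.1, h.2.1]
          · exact h.2
        simp only [b, hv, if_true]
        refine (lintegral_treeWeight_box_le hδ.le (by linarith) hsmall hlam' L y).trans ?_
        refine ENNReal.ofReal_le_ofReal ?_
        gcongr
        exact le_max_right _ _
      · have : κ = 1 := by rw [hκ, timeRatio, if_neg hsmall]
        rw [this]; exact hgen
    · simp only [A, hv, if_false]; exact hgen
  have htree := G.lintegral_treeSum_le w hwm hw0 b hb A hA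
  have hPB : 0 ≤ ∏ e, B e := Finset.prod_nonneg fun e _ => hB e
  have hmeas : Measurable fun z : {v // v ≠ G.origin} → SpaceTime d N =>
      ENNReal.ofReal (G.treeSum w (G.extend z)) * ∏ v, b v (z v) :=
    (G.measurable_treeSum hwm).ennreal_ofReal.mul
      (Finset.measurable_fun_prod _ fun v _ => (hb v).comp (measurable_pi_apply v))
  refine (G.lintegralConfig_le (g := fun z => ENNReal.ofReal ((∏ e, B e) *
    (2 : ℝ) ^ (-(G.alpha d * L))) * (ENNReal.ofReal (G.treeSum w (G.extend z)) *
      ∏ v, b v (z v))) (hmeas.const_mul _) ?_).trans ?_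
  · intro z hz
    by_cases hzero : (∏ e, W e (G.extend z)) * ∏ i, boxInd ρ lam mu (G.extend z (G.star i)) = 0
    · rw [hzero]; simp
    have hz1 := left_ne_zero_of_mul hzero
    have hz2 := right_ne_zero_of_mul hzero
    rw [Finset.prod_ne_zero_iff] at hz1 hz2
    have horig : G.extend z G.origin = 0 := by simp [extend]
    have hstar : ∀ i, stDist (G.extend z (G.star i)) (G.extend z G.origin) ≤ ((2 : ℝ) ^ L)⁻¹ := by
      intro i
      refine le_trans (le_min ?_ ?_) hL1
      · rcases htied _ _ (hz1 (G.starEdge i) (Finset.mem_univ _)) with h | h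
        · rwa [G.starEdge_src, G.starEdge_tgt] at h
        · rw [G.starEdge_r] at h; exact absurd h.1 (lt_irrefl _)
      · rw [horig]
        exact stDist_zero_le_of_boxInd (by linarith) hmu.le hle (hz2 i (Finset.mem_univ _))
    have hone : ∀ i, boxInd ρ lam mu (G.extend z (G.star i)) = 1 := fun i => by
      have := hz2 i (Finset.mem_univ _)
      unfold boxInd at this ⊢
      split_ifs at this ⊢ with h
      · rfl
      · exact absurd rfl this
    have hb1 : ∏ v, b v (z v) = 1 := by
      refine Finset.prod_eq_one fun v _ => ?_
      simp only [b]
      split_ifs with hv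
      · obtain ⟨i, -, rfl⟩ := Finset.mem_image.1 hv
        have := hone i
        have h2 : G.extend z (G.star i) = z (G.starPoint i) := by
          simp [extend, starPoint, G.star_ne_origin i]
        rw [← h2, this, ENNReal.ofReal_one]
      · rfl
    have h := hpt N L hLN (G.extend z) hstar (fun e => W e (G.extend z)) B
      (fun e => hW e _) hB (fun e he => htied e _ he) (fun cl hcl e => hbound _ hz cl hcl e)
    rw [Finset.prod_congr rfl fun i _ => hone i, Finset.prod_const_one, mul_one, hb1, mul_one,
      ← ENNReal.ofReal_mul (by positivity)]
    refine ENNReal.ofReal_le_ofReal (h.trans (le_of_eq ?_))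
    rw [mul_assoc]
  · rw [lintegral_const_mul _ hmeas]
    have hprod : ∏ v, ((Fintype.card V : ENNReal) * A v) =
        ENNReal.ofReal ((n * C₃) ^ c * κ ^ M * (2 ^ (d * N)) ^ c) := by
      have h1 : ∀ v, (Fintype.card V : ENNReal) * A v =
          ENNReal.ofReal ((n * C₃ * 2 ^ (d * N)) * (if v ∈ S then κ else 1)) := fun v => by
        simp only [A]
        rw [← ENNReal.ofReal_natCast, ← ENNReal.ofReal_mul (by positivity)]
        congr 1; ring
      rw [Finset.prod_congr rfl fun v _ => h1 v, ← ENNReal.ofReal_prod_of_nonneg fun v _ => by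
        split_ifs <;> positivity]
      congr 1
      rw [Finset.prod_mul_distrib, Finset.prod_const, Finset.card_univ, ← hc,
        G.prod_starPoint fun _ => κ, Finset.prod_const, Finset.card_univ, Fintype.card_fin,
        mul_pow]
      ring
    rw [hprod] at htree
    refine (mul_le_mul_right htree _).trans ?_
    rw [← ENNReal.ofReal_natCast, ← ENNReal.ofReal_mul (by positivity),
      ← ENNReal.ofReal_mul (by positivity)]
    refine ENNReal.ofReal_le_ofReal ?_
    -- Here α ≥ 0 is essential, since 2^{-L} is bounded by 2ρλ from above only.
    have hL4 : (2 : ℝ) ^ (-(G.alpha d * L)) ≤ (2 * ρ) ^ G.alpha d * lam ^ G.alpha d := by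
      have e1 : (2 : ℝ) ^ (-(G.alpha d * L)) = (((2 : ℝ) ^ L)⁻¹) ^ G.alpha d := by
        rw [inv_two_pow_eq_rpow, ← Real.rpow_mul (by norm_num)]; congr 1; ring
      rw [e1, ← Real.mul_rpow (by linarith) hlam.le, mul_assoc]
      exact Real.rpow_le_rpow (by positivity) hL2 hα
    calc _ = (∏ e, B e) * ((2 : ℝ) ^ (-(G.alpha d * L)) *
          ((Fintype.card V).factorial * ((n * C₃) ^ c * κ ^ M * (2 ^ (d * N)) ^ c))) := by ring
      _ ≤ (∏ e, B e) * (((2 * ρ) ^ G.alpha d * lam ^ G.alpha d) *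
          ((Fintype.card V).factorial * ((n * C₃) ^ c * κ ^ M * (2 ^ (d * N)) ^ c))) := by gcongr
      _ = _ := by ring

end LabelledGraph
end GenConv
end

noncomputable section
namespace GenConv

open MeasureTheory

variable {d N q : ℕ}

/-! ### Measurability -/

theorem measurable_spaceTime_sub {Ω : Type*} [MeasurableSpace Ω] {f g : Ω → SpaceTime d N}
    (hf : Measurable f) (hg : Measurable g) : Measurable fun x => f x - g x := by
  have h : Measurable fun p : (Fin d → ZMod (2 ^ N)) × (Fin d → ZMod (2 ^ N)) => p.1 - p.2 :=
    measurable_of_countable _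
  have h1 := h.comp ((measurable_snd.comp hf).prodMk (measurable_snd.comp hg))
  exact ((measurable_fst.comp hf).sub (measurable_fst.comp hg)).prodMk h1

namespace Kernel

theorem measurable_last (K : Kernel d N q) : Measurable K.last :=
  measurable_from_prod_countable_left fun x => K.last_measurable x

theorem measurable_toFun (K : Kernel d N q) : Measurable K.toFun := by
  have h1 : Measurable fun z => (∑ n ∈ Finset.range q, K.piece n (coord z)) + K.last z := by
    refine (Finset.measurable_fun_sum _ fun n hn => ?_).add K.measurable_last
    have h2 := (K.smooth n (Finset.mem_range.1 hn)).continuous.measurable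
    exact h2.comp measurable_coord
  refine h1.measurable_of_countable_ne ((Set.countable_singleton (0 : SpaceTime d N)).mono ?_)
  intro z hz
  by_contra h
  exact hz (K.sum_eq z h).symm

theorem measurable_deriv (K : Kernel d N q) (j : Fin (d + 1) → ℕ) : Measurable (K.deriv j) := by
  by_cases h : j = 0
  · have : K.deriv j = K.toFun := by ext z; simp [deriv, h]
    rw [this]; exact K.measurable_toFun
  · have : K.deriv j = fun z => ∑ n ∈ Finset.range q, partialDeriv j (K.piece n) (coord z) := by
      ext z; simp [deriv, h]
    rw [this]
    refine Finset.measurable_fun_sum _ fun n hn => ?_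
    have h2 := (contDiff_partialDeriv (K.smooth n (Finset.mem_range.1 hn)) j).continuous.measurable
    exact h2.comp measurable_coord

theorem measurable_scale (K : Kernel d N q) (k : ℕ) : Measurable (K.scale k) := by
  unfold scale
  split_ifs with h1 h2
  · exact (K.smooth k h1).continuous.measurable.comp measurable_coord
  · exact K.measurable_last
  · exact measurable_const

theorem measurable_recentred (K : Kernel d N q) (r : ℕ) {Ω : Type*} [MeasurableSpace Ω]
    {f g h : Ω → SpaceTime d N} (hf : Measurable f) (hg : Measurable g) (hh : Measurable h) :
    Measurable fun x => K.recentred r (f x) (g x) (h x) := by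
  unfold recentred
  refine (K.measurable_toFun.comp (measurable_spaceTime_sub hg hf)).sub
    (Finset.measurable_fun_sum _ fun j _ => ?_)
  refine Measurable.mul (Measurable.div_const ?_ _)
    ((K.measurable_deriv j).comp (measurable_spaceTime_sub hh hf))
  unfold monomial
  refine Finset.measurable_fun_prod _ fun i _ => Measurable.pow_const ?_ _
  exact (measurable_pi_apply i).comp (measurable_coord.comp (measurable_spaceTime_sub hg hh))

/-- The support of a recentred kernel. -/
theorem recentred_support (K : Kernel d N q) {r : ℕ} {zm zp zv : SpaceTime d N}
    (h : K.recentred r zm zp zv ≠ 0) : stDist zp zm ≤ 1 ∨ 0 < r ∧ stDist zv zm ≤ 1 := by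
  by_cases h1 : K.toFun (zp - zm) = 0
  · right
    rw [recentred, h1, zero_sub, neg_ne_zero] at h
    obtain ⟨j, hj, h2⟩ := Finset.exists_ne_zero_of_sum_ne_zero h
    exact ⟨Nat.zero_lt_of_lt (mem_lowIndices.1 hj).2, K.deriv_support (right_ne_zero_of_mul h2)⟩
  · exact Or.inl (K.toFun_support h1)

theorem scale_support (K : Kernel d N q) {k : ℕ} {z : SpaceTime d N} (h : K.scale k z ≠ 0) :
    scaledNorm (coord z) ≤ 1 := by
  have hone : ((2 : ℝ) ^ k)⁻¹ ≤ 1 := by simpa using inv_two_pow_anti (Nat.zero_le k)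
  unfold scale at h
  split_ifs at h with h1 h2
  · rw [← torusNorm_coord]; exact (K.piece_support k h1 _ h).2.trans hone
  · subst h2; exact (K.last_support z h).trans hone
  · exact absurd rfl h

theorem sum_abs_scale_le {K : Kernel d N q} {a : ℝ} (hK : K.HasOrder a) (p : ℕ)
    (z : SpaceTime d N) :
    ∑ k ∈ Finset.range (q + 1), |K.scale k z| ≤ (3 * (4 : ℝ) ^ |a| + 1) * K.norm a p *
        (max (scaledNorm (coord z)) ((2 : ℝ) ^ q)⁻¹) ^ (-a) := by
  rw [Finset.sum_range_succ]
  have h1 : ∑ k ∈ Finset.range q, |K.scale k z| =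
      ∑ k ∈ Finset.range q, |partialDeriv 0 (K.piece k) (coord z)| :=
    Finset.sum_congr rfl fun k hk => by
      rw [scale, if_pos (Finset.mem_range.1 hk), partialDeriv_zero]
  have h2 : K.scale q z = K.last z := by simp [scale]
  have h3 := abs_sum_partialDeriv_le hK (p := p) 0 (by simp) (coord z)
  have h4 := abs_last_le hK p z
  have h5 : scaledDegree (0 : Fin (d + 1) → ℕ) = 0 := by simp [scaledDegree]
  rw [h5, torusNorm_coord, Nat.cast_zero, add_zero] at h3
  rw [h1, h2]
  linarith

end Kernel

theorem measurable_rescaled {φ : (Fin (d + 1) → ℝ) → ℝ} (hφ : Continuous φ) (lam mu : ℝ) :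
    Measurable (rescaled φ lam mu : SpaceTime d N → ℝ) := by
  unfold rescaled
  refine Measurable.const_mul ?_ _
  have h : Measurable fun z : SpaceTime d N =>
      (Fin.cons (coord z 0 / mu ^ 2) fun i => coord z i.succ / lam : Fin (d + 1) → ℝ) := by
    rw [measurable_pi_iff]
    intro i
    refine Fin.cases ?_ (fun i => ?_) i
    · simp only [Fin.cons_zero]
      exact ((measurable_pi_apply 0).comp measurable_coord).div_const _
    · simp only [Fin.cons_succ]
      exact ((measurable_pi_apply i.succ).comp measurable_coord).div_const _
  exact hφ.measurable.comp h

namespace LabelledGraph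

variable {V E : Type*} [Fintype V] [DecidableEq V] [Fintype E] [DecidableEq E] {M : ℕ}

/-! ### Cutoffs -/

theorem measurable_cutoff {ψ : ℝ → ℝ} (hψ : IsDyadicCutoff ψ) (n : ℕ) :
    Measurable (cutoff ψ n : SpaceTime d N → ℝ) := by
  have h1 : Measurable fun z : SpaceTime d N => 2 ^ n * scaledNorm (coord z) :=
    (continuous_scaledNorm.measurable.comp measurable_coord).const_mul _
  exact hψ.1.continuous.measurable.comp h1

theorem cutoff_nonneg {ψ : ℝ → ℝ} (hψ : IsDyadicCutoff ψ) (n : ℕ)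
    (z : SpaceTime d N) : 0 ≤ cutoff ψ n z := (hψ.2.1 _).1

theorem cutoff_le_one {ψ : ℝ → ℝ} (hψ : IsDyadicCutoff ψ) (n : ℕ)
    (z : SpaceTime d N) : cutoff ψ n z ≤ 1 := (hψ.2.1 _).2

theorem cutoff_support {ψ : ℝ → ℝ} (hψ : IsDyadicCutoff ψ) {n : ℕ}
    {z : SpaceTime d N} (h : cutoff ψ n z ≠ 0) :
    scaledNorm (coord z) ≤ ((2 : ℝ) ^ n)⁻¹ := by
  have := (hψ.2.2.1 _ h).2
  rw [← one_div, le_div_iff₀' (by positivity)]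
  exact this

/-- This is a partial sum of the partition of unity over ℤ, except at norm 0, where all cutoffs
vanish. -/
theorem sum_cutoff_le_one {ψ : ℝ → ℝ} (hψ : IsDyadicCutoff ψ) (s : Finset ℕ)
    (z : SpaceTime d N) : ∑ n ∈ s, cutoff ψ n z ≤ 1 := by
  rcases (scaledNorm_nonneg (coord z)).eq_or_lt with h | h
  · refine (Finset.sum_nonpos fun n _ => ?_).trans zero_le_one
    rw [cutoff, ← h, mul_zero]
    by_contra h'
    have := (hψ.2.2.1 0 fun h0 => h' h0.le).1
    norm_num at this
  · have h1 := hψ.2.2.2 _ h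
    have h2 := sum_le_hasSum (s.map ⟨fun n : ℕ => (n : ℤ), Nat.cast_injective⟩)
      (fun i _ => (hψ.2.1 _).1) h1
    rw [Finset.sum_map] at h2
    simpa [cutoff] using h2

theorem measurable_place (G : LabelledGraph V E M) (x : {v // v ≠ G.origin} → Fin d → ZMod (2 ^ N))
    (v : V) : Measurable fun t => G.place t x v := by
  unfold place
  split_ifs with h
  · exact (measurable_pi_apply _).prodMk measurable_const
  · exact measurable_const

theorem measurable_integrand (G : LabelledGraph V E M) (K : E → Kernel d N N)
    {φ : (Fin (d + 1) → ℝ) → ℝ} (hφ : Continuous φ) (lam mu : ℝ)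
    (x : {v // v ≠ G.origin} → Fin d → ZMod (2 ^ N)) :
    Measurable fun t => G.integrand K φ lam mu (G.place t x) := by
  unfold integrand
  refine (Finset.measurable_fun_prod _ fun e _ => ?_).mul
    (Finset.measurable_fun_prod _ fun i _ => ?_)
  · exact (K e).measurable_recentred _ (G.measurable_place x _) (G.measurable_place x _)
      (G.measurable_place x _)
  · exact (measurable_rescaled hφ lam mu).comp (G.measurable_place x _)

theorem measurable_localKernel {mu : ℝ} (G : LabelledGraph V E M) {ψ : ℝ → ℝ}
    (hψ : IsDyadicCutoff ψ) (e : E) (K : Kernel d N (G.level N mu e)) (n : ℕ × ℕ × ℕ)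
    {Ω : Type*} [MeasurableSpace Ω]
    {f g h : Ω → SpaceTime d N} (hf : Measurable f) (hg : Measurable g) (hh : Measurable h) :
    Measurable fun x => G.localKernel ψ e K n (f x) (g x) (h x) := by
  have h1 := measurable_spaceTime_sub hg hf
  have h2 := measurable_spaceTime_sub hh hf
  have h3 := measurable_spaceTime_sub hg hh
  unfold localKernel
  split_ifs
  · exact ((measurable_cutoff hψ _).comp h1).mul ((K.measurable_scale _).comp h1)
  · exact measurable_const
  · exact (K.measurable_scale _).comp h1
  · exact measurable_const
  · exact ((((measurable_cutoff hψ _).comp h1).mul ((measurable_cutoff hψ _).comp h2)).mul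
      ((measurable_cutoff hψ _).comp h3)).mul (K.measurable_recentred _ hf hg hh)
  · exact ((measurable_cutoff hψ _).comp h1).mul (K.measurable_toFun.comp h1)
  · exact measurable_const

theorem measurable_scaleIntegrand {mu : ℝ} (G : LabelledGraph V E M) {ψ : ℝ → ℝ}
    (hψ : IsDyadicCutoff ψ) (K : (e : E) → Kernel d N (G.level N mu e)) (n : E → ℕ × ℕ × ℕ)
    (x : {v // v ≠ G.origin} → Fin d → ZMod (2 ^ N)) :
    Measurable fun t => G.scaleIntegrand ψ K n (G.place t x) := by
  unfold scaleIntegrand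
  exact Finset.measurable_fun_prod _ fun e _ => G.measurable_localKernel hψ e _ _
    (G.measurable_place x _) (G.measurable_place x _) (G.measurable_place x _)

/-! ### Sums of localised kernels -/

open Classical in
/-- The scales at which the kernel of an edge is localised. -/
def edgeScales (G : LabelledGraph V E M) (N : ℕ) (mu : ℝ) (e : E) : Finset (ℕ × ℕ × ℕ) :=
  let R := Finset.range ((if e ∈ Finset.univ.image G.starEdge then logScale mu else N) + 1)
  (R ×ˢ R ×ˢ R).filter fun m => e ∈ Finset.univ.image G.starEdge →
    ((2 : ℝ) ^ (m.1 + m.2.1 + m.2.2))⁻¹ ≤ mu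

/-- The constraints concern one edge at a time. In this product form the sum over assignments of a
product over edges becomes a product of sums. -/
theorem scaleAssignments_subset (G : LabelledGraph V E M) (N : ℕ) (mu : ℝ) :
    G.scaleAssignments N mu ⊆ Fintype.piFinset (G.edgeScales N mu) := by
  intro n hn
  rw [scaleAssignments, Finset.mem_filter, Fintype.mem_piFinset] at hn
  rw [Fintype.mem_piFinset]
  intro e
  rw [edgeScales, Finset.mem_filter]
  refine ⟨hn.1 e, fun he => ?_⟩
  obtain ⟨i, -, rfl⟩ := Finset.mem_image.1 he
  exact hn.2 i

theorem edgeScales_subset (G : LabelledGraph V E M) (N : ℕ) (mu : ℝ) (e : E) :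
    G.edgeScales N mu e ⊆ Finset.range (G.level N mu e + 1) ×ˢ
      Finset.range (G.level N mu e + 1) ×ˢ Finset.range (G.level N mu e + 1) := by
  have h : (if e ∈ Finset.univ.image G.starEdge then logScale mu else N) ≤ G.level N mu e := by
    unfold level
    split_ifs
    · exact le_max_right _ _
    · exact le_rfl
  refine (Finset.filter_subset _ _).trans ?_
  have h' := Finset.range_mono (Nat.succ_le_succ h)
  exact Finset.product_subset_product h' (Finset.product_subset_product h' h')

/-- The localised kernels of an edge without recentring. -/
theorem sum_abs_localKernel_le_scale {mu : ℝ} (G : LabelledGraph V E M) {ψ : ℝ → ℝ}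
    (hψ : IsDyadicCutoff ψ) (e : E) (he : e ∈ Finset.univ.image G.starEdge ∨ G.r e = 0)
    (K : Kernel d N (G.level N mu e)) (zm zp zv : SpaceTime d N) :
    ∑ m ∈ G.edgeScales N mu e, |G.localKernel ψ e K m zm zp zv| ≤
      ∑ k ∈ Finset.range (G.level N mu e + 1), |K.scale k (zp - zm)| := by
  have h1 : ∀ m : ℕ × ℕ × ℕ, |G.localKernel ψ e K m zm zp zv| ≤
      if m.2 = (0, 0) then |K.scale m.1 (zp - zm)| else 0 := by
    rintro ⟨k, p, m⟩
    have h2 : |cutoff ψ k (zp - zm) * K.scale k (zp - zm)| ≤ |K.scale k (zp - zm)| := by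
      rw [abs_mul, abs_of_nonneg (cutoff_nonneg hψ _ _)]
      exact mul_le_of_le_one_left (abs_nonneg _) (cutoff_le_one hψ _ _)
    simp only [localKernel, Prod.mk.injEq]
    by_cases h3 : e ∈ Finset.univ.image G.starEdge
    · rw [if_pos h3]
      by_cases h4 : p = 0 ∧ m = 0
      · rw [if_pos h4, if_pos h4]; exact h2
      · rw [if_neg h4, if_neg h4, abs_zero]
    · rw [if_neg h3, if_pos (he.resolve_left h3)]
      by_cases h4 : p = 0 ∧ m = 0
      · rw [if_pos h4, if_pos h4]
      · rw [if_neg h4, if_neg h4, abs_zero]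
  have h0 : ∀ m : ℕ × ℕ × ℕ, 0 ≤ if m.2 = (0, 0) then |K.scale m.1 (zp - zm)| else 0 :=
    fun m => (abs_nonneg _).trans (h1 m)
  refine (Finset.sum_le_sum fun m _ => h1 m).trans
    ((Finset.sum_le_sum_of_subset_of_nonneg (G.edgeScales_subset N mu e) fun m _ _ => h0 m).trans ?_)
  rw [Finset.sum_product]
  refine Finset.sum_le_sum fun k _ => ?_
  simp only [Finset.sum_ite_eq']
  split_ifs
  · exact le_rfl
  · exact abs_nonneg _

/-- The localised kernels of an edge with recentring. -/
theorem sum_abs_localKernel_le_recentred {mu : ℝ} (G : LabelledGraph V E M) {ψ : ℝ → ℝ}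
    (hψ : IsDyadicCutoff ψ) (e : E) (he : e ∉ Finset.univ.image G.starEdge) (hr : 0 < G.r e)
    (K : Kernel d N (G.level N mu e)) (zm zp zv : SpaceTime d N) :
    ∑ m ∈ G.edgeScales N mu e, |G.localKernel ψ e K m zm zp zv| ≤
      |K.recentred (G.r e) zm zp zv| +
        if stDist zp zm ≤ ((2 : ℝ) ^ N)⁻¹ then |K.toFun (zp - zm)| else 0 := by
  have hlev : G.level N mu e = N := if_neg he
  -- The recentred case occurs only below index N, so the truncated cutoffs describe it on the whole
  -- index cube and the sum over (k, p, m) factorises.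
  let A : SpaceTime d N → ℕ → ℝ := fun z k => if k < N then cutoff ψ k z else 0
  have hA0 : ∀ z k, 0 ≤ A z k := fun z k => by
    simp only [A]; split_ifs <;> [exact cutoff_nonneg hψ _ _; exact le_rfl]
  have hA1 : ∀ z (s : Finset ℕ), ∑ k ∈ s, A z k ≤ 1 := fun z s => by
    simp only [A]
    rw [← Finset.sum_filter]; exact sum_cutoff_le_one hψ _ z
  set X := |K.recentred (G.r e) zm zp zv| with hX
  set Y : ℝ := if stDist zp zm ≤ ((2 : ℝ) ^ N)⁻¹ then |K.toFun (zp - zm)| else 0 with hY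
  have hX0 : 0 ≤ X := abs_nonneg _
  have hY0 : 0 ≤ Y := by rw [hY]; split_ifs <;> [exact abs_nonneg _; exact le_rfl]
  have h1 : ∀ m : ℕ × ℕ × ℕ, |G.localKernel ψ e K m zm zp zv| ≤
      A (zp - zm) m.1 * (A (zv - zm) m.2.1 * A (zp - zv) m.2.2) * X +
        if m = (N, 0, 0) then Y else 0 := by
    rintro ⟨k, p, m⟩
    have hc : 0 ≤ A (zp - zm) k * (A (zv - zm) p * A (zp - zv) m) * X :=
      mul_nonneg (mul_nonneg (hA0 _ _) (mul_nonneg (hA0 _ _) (hA0 _ _))) hX0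
    have hd : 0 ≤ if ((k, p, m) : ℕ × ℕ × ℕ) = (N, 0, 0) then Y else 0 := by
      split_ifs <;> [exact hY0; exact le_rfl]
    rw [localKernel, if_neg he, if_neg hr.ne']
    by_cases h2 : k < N ∧ p < N ∧ m < N
    · rw [if_pos h2, abs_mul, abs_of_nonneg (mul_nonneg (mul_nonneg (cutoff_nonneg hψ _ _)
        (cutoff_nonneg hψ _ _)) (cutoff_nonneg hψ _ _))]
      have e1 : A (zp - zm) k = cutoff ψ k (zp - zm) := if_pos h2.1
      have e2 : A (zv - zm) p = cutoff ψ p (zv - zm) := if_pos h2.2.1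
      have e3 : A (zp - zv) m = cutoff ψ m (zp - zv) := if_pos h2.2.2
      rw [← hX, e1, e2, e3, mul_assoc (cutoff ψ k (zp - zm))]
      linarith
    rw [if_neg h2]
    by_cases h3 : (k, p, m) = (N, 0, 0)
    · rw [if_pos h3, if_pos h3]
      refine le_trans ?_ (le_add_of_nonneg_left hc)
      rw [abs_mul, abs_of_nonneg (cutoff_nonneg hψ _ _), hY]
      by_cases h4 : cutoff ψ N (zp - zm) = 0
      · rw [h4, zero_mul]; exact hY0
      · rw [if_pos (show stDist zp zm ≤ _ from cutoff_support hψ h4)]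
        exact mul_le_of_le_one_left (abs_nonneg _) (cutoff_le_one hψ _ _)
    · rw [if_neg h3, abs_zero]; exact add_nonneg hc hd
  have h0 := fun m => (abs_nonneg _).trans (h1 m)
  refine (Finset.sum_le_sum fun m _ => h1 m).trans
    ((Finset.sum_le_sum_of_subset_of_nonneg (G.edgeScales_subset N mu e) fun m _ _ => h0 m).trans ?_)
  rw [Finset.sum_add_distrib, Finset.sum_ite_eq', ← Finset.sum_mul]
  set R := Finset.range (G.level N mu e + 1)
  have h2 : ∑ m ∈ R ×ˢ R ×ˢ R, A (zp - zm) m.1 * (A (zv - zm) m.2.1 * A (zp - zv) m.2.2) ≤ 1 := by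
    rw [Finset.sum_product]
    simp only
    rw [← Finset.sum_mul_sum R (R ×ˢ R) (fun k => A (zp - zm) k)
      (fun m => A (zv - zm) m.1 * A (zp - zv) m.2), Finset.sum_product]
    simp only
    rw [← Finset.sum_mul_sum R R (fun k => A (zv - zm) k) (fun m => A (zp - zv) m)]
    have n1 := Finset.sum_nonneg (s := R) fun k _ => hA0 (zv - zm) k
    have n2 := Finset.sum_nonneg (s := R) fun k _ => hA0 (zp - zv) k
    exact mul_le_one₀ (hA1 _ _) (mul_nonneg n1 n2) (mul_le_one₀ (hA1 _ _) n2 (hA1 _ _))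
  refine add_le_add (mul_le_of_le_one_left hX0 h2) ?_
  split_ifs <;> [exact le_rfl; exact hY0]

/-- The support of a localised kernel. -/
theorem localKernel_support {mu : ℝ} (G : LabelledGraph V E M) (ψ : ℝ → ℝ) (e : E)
    (K : Kernel d N (G.level N mu e)) (m : ℕ × ℕ × ℕ) {zm zp zv : SpaceTime d N}
    (h : G.localKernel ψ e K m zm zp zv ≠ 0) :
    stDist zp zm ≤ 1 ∨ 0 < G.r e ∧ stDist zv zm ≤ 1 := by
  unfold localKernel at h
  split_ifs at h with h1 h2 h3 h4 h5 h6
  · exact Or.inl (K.scale_support (right_ne_zero_of_mul h))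
  · exact absurd rfl h
  · exact Or.inl (K.scale_support h)
  · exact absurd rfl h
  · exact K.recentred_support (right_ne_zero_of_mul h)
  · exact Or.inl (K.toFun_support (right_ne_zero_of_mul h))
  · exact absurd rfl h

/-- The localised kernels of a distinguished edge are supported in a small ball. -/
theorem stDist_le_of_localKernel_star {mu : ℝ} (G : LabelledGraph V E M) {ψ : ℝ → ℝ}
    (hψ : IsDyadicCutoff ψ) {e : E} (he : e ∈ Finset.univ.image G.starEdge)
    (K : Kernel d N (G.level N mu e)) {m : ℕ × ℕ × ℕ} (hm : m ∈ G.edgeScales N mu e)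
    {zm zp zv : SpaceTime d N} (h : G.localKernel ψ e K m zm zp zv ≠ 0) : stDist zp zm ≤ mu := by
  have h1 := (Finset.mem_filter.1 hm).2 he
  rw [localKernel, if_pos he] at h
  split_ifs at h with h2
  · rw [h2.1, h2.2, add_zero, add_zero] at h1
    exact (cutoff_support hψ (left_ne_zero_of_mul h)).trans h1
  · exact absurd rfl h

end LabelledGraph
end GenConv
end

/-! ### Assembly: the generalised convolution and its multiscale form. -/

noncomputable section
namespace GenConv

variable {d N q : ℕ}

theorem abs_rescaled_le {φ : (Fin (d + 1) → ℝ) → ℝ} {ρ B lam mu : ℝ} (hρ : 0 ≤ ρ)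
    (hlam : 0 < lam) (hmu : 0 < mu) (hsupp : ∀ z, φ z ≠ 0 → scaledNorm z ≤ ρ)
    (hB : ∀ z, |φ z| ≤ B) (z : SpaceTime d N) :
    |rescaled φ lam mu z| ≤ (lam ^ d)⁻¹ * (mu ^ 2)⁻¹ * B * boxInd (max ρ 1) lam mu z := by
  have hB0 : 0 ≤ B := (abs_nonneg _).trans (hB 0)
  set w : Fin (d + 1) → ℝ := Fin.cons (coord z 0 / mu ^ 2) fun i => coord z i.succ / lam with hw
  rw [rescaled, ← hw, abs_mul, abs_of_nonneg (by positivity), mul_assoc _ B]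
  refine mul_le_mul_of_nonneg_left ?_ (by positivity)
  by_cases h0 : φ w = 0
  · rw [h0, abs_zero]
    exact mul_nonneg hB0 (boxInd_nonneg _ _ _ _)
  have h1 := (scaledNorm_le_iff hρ).1 (hsupp w h0)
  have hle : ρ ≤ max ρ 1 := le_max_left _ _
  have hbox : |z.1| ≤ (max ρ 1 * mu) ^ 2 ∧ ∀ i, |coord z (Fin.succ i)| ≤ max ρ 1 * lam := by
    constructor
    · have h2 := h1 0
      simp only [hw, Fin.cons_zero, scaling, if_true, coord, abs_div] at h2
      rw [abs_of_pos (by positivity : 0 < mu ^ 2), div_le_iff₀ (by positivity), ← mul_pow] at h2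
      exact h2.trans (by gcongr)
    · intro i
      have h2 := h1 i.succ
      simp only [hw, Fin.cons_succ, scaling, Fin.succ_ne_zero, if_false, abs_div, pow_one] at h2
      rw [abs_of_pos hlam, div_le_iff₀ hlam] at h2
      exact h2.trans (by gcongr)
  rw [boxInd, if_pos hbox, mul_one]
  exact hB w

theorem boxInd_one_of_stDist_le {lam mu : ℝ} (hle : mu ≤ lam) (hmu : 0 ≤ mu)
    {z : SpaceTime d N} (h : stDist z 0 ≤ mu) : boxInd 1 lam mu z = 1 := by
  have h1 := (scaledNorm_le_iff hmu).1 h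
  rw [sub_zero] at h1
  refine if_pos ⟨?_, fun i => ?_⟩
  · simpa [scaling, coord] using h1 0
  · have := h1 i.succ
    simp only [scaling, Fin.succ_ne_zero, if_false, pow_one] at this
    linarith

/-- In both regimes one test function costs λ^{-|𝔰|}: below the grid scale the singular factor
μ^{-2} is compensated by the confinement in time. The M test functions thus account for the
difference between α and α̃. -/
theorem rescaling_mul_timeRatio {lam mu : ℝ} (hmu : 0 < mu)
    (hcase : ((2 : ℝ) ^ (-(N : ℝ)) ≤ lam ∧ lam = mu ∧ lam ≤ 1) ∨
      (mu < (2 : ℝ) ^ (-(N : ℝ)) ∧ lam = (2 : ℝ) ^ (-(N : ℝ)))) :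
    (lam ^ d)⁻¹ * (mu ^ 2)⁻¹ * timeRatio N mu = (lam ^ (scalingSize d))⁻¹ := by
  rw [scalingSize_eq, pow_add, mul_inv, mul_assoc]
  congr 1
  rcases hcase with ⟨h1, h2, -⟩ | ⟨h1, h2⟩
  · rw [timeRatio, if_neg (by rw [← h2]; exact not_lt.2 h1), mul_one, h2]
  · rw [timeRatio, if_pos h1, ← mul_assoc, inv_mul_cancel₀ (by positivity), one_mul, h2,
      ← inv_two_pow_eq_rpow, inv_pow, inv_inv, ← pow_mul, mul_comm]

namespace LabelledGraph

variable {V E : Type*} [Fintype V] [DecidableEq V] [Fintype E] [DecidableEq E] {M : ℕ}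

theorem lintegralConfig_const_mul (G : LabelledGraph V E M) {κ : ℝ} (hκ : 0 ≤ κ)
    (F : (V → SpaceTime d N) → ℝ) :
    G.lintegralConfig (fun z => κ * F z) = ENNReal.ofReal κ * G.lintegralConfig F := by
  unfold lintegralConfig
  rw [Finset.mul_sum]
  refine Finset.sum_congr rfl fun x _ => ?_
  rw [← MeasureTheory.lintegral_const_mul' _ _ ENNReal.ofReal_ne_top]
  exact MeasureTheory.lintegral_congr fun t => ENNReal.ofReal_mul hκ

theorem alphaTilde_eq (G : LabelledGraph V E M) (d : ℕ) :
    G.alphaTilde d = G.alpha d - scalingSize d * M := by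
  have h1 : G.starVertices.card = M + 1 := by
    rw [starVertices, Finset.card_insert_of_notMem, Finset.card_image_of_injective _
      G.star_injective, Finset.card_univ, Fintype.card_fin]
    rw [Finset.mem_image]
    rintro ⟨i, -, hi⟩
    exact G.star_ne_origin i hi
  have h2 : (Finset.univ \ G.starVertices).card + (M + 1) = Fintype.card V := by
    rw [← h1, Finset.card_sdiff_add_card_eq_card (Finset.subset_univ _), Finset.card_univ]
  have h3 : (Finset.univ.erase G.origin).card + 1 = Fintype.card V := by
    rw [Finset.card_erase_add_one (Finset.mem_univ _), Finset.card_univ]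
  have h4 : ((Finset.univ.erase G.origin).card : ℝ) =
      (Finset.univ \ G.starVertices).card + M := by
    have : (Finset.univ.erase G.origin).card = (Finset.univ \ G.starVertices).card + M := by omega
    exact_mod_cast this
  rw [alphaTilde, alpha, h4]; ring

/-- The alternative a = 0 is for the distinguished edges, whose level may exceed N: their bound is
independent of the scale. -/
theorem sum_abs_scale_le_edgeFactor (G : LabelledGraph V E M) (e : E) (hr : G.r e = 0) (p : ℕ) :
    ∃ C : ℝ, 0 ≤ C ∧ ∀ {N q : ℕ} (K : Kernel d N q), (q = N ∨ G.a e = 0) →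
      K.HasOrder (G.a e) →
      ∀ (z : V → SpaceTime d N) (cl : Clustering G.origin (configDist z)),
      (∀ u v, configDist z u v ≤ 2 * Fintype.card V) →
      ∑ k ∈ Finset.range (q + 1), |K.scale k (z (G.tgt e) - z (G.src e))| ≤
        C * K.norm (G.a e) p * G.edgeFactor cl N e := by
  refine ⟨(3 * (4 : ℝ) ^ |G.a e| + 1) * (2 * (2 * Fintype.card V)) ^ |G.a e|, by positivity, ?_⟩
  intro N q K hq hK z cl hR
  have hnm := hK.norm_nonneg p
  obtain ⟨nA, nB, nD, hA, hB, hD, h1, h2, h3, hsum⟩ := G.sum_edgeDegree_edge cl N e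
  rw [edgeFactor, hsum, hr]
  simp only [lt_irrefl, if_false, add_zero]
  have sA := isScaleOf_of_label cl (hR (G.src e) (G.tgt e)) hA h1
  rw [configDist, stDist_comm] at sA
  have key : (max (scaledNorm (coord (z (G.tgt e) - z (G.src e)))) ((2 : ℝ) ^ q)⁻¹) ^ (-G.a e) ≤
      (2 * (2 * Fintype.card V)) ^ |G.a e| * (2 : ℝ) ^ (G.a e * nA) := by
    rcases hq with rfl | h0
    · exact sA.rpow_le (by linarith [G.two_le_two_mul_card]) _
    · simp [h0]
  refine (Kernel.sum_abs_scale_le hK p _).trans ?_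
  calc _ ≤ (3 * (4 : ℝ) ^ |G.a e| + 1) * K.norm (G.a e) p *
        ((2 * (2 * Fintype.card V)) ^ |G.a e| * (2 : ℝ) ^ (G.a e * nA)) := by gcongr
    _ = _ := by ring

/-- The bound on the kernel of an edge, recentred or not. -/
theorem exists_recentred_le_edgeFactor (G : LabelledGraph V E M)
    (hbase : ∀ e, 0 < G.r e → G.base e ≠ G.src e) (hsing : ∀ e, 0 < G.r e → 0 ≤ G.a e)
    {p : ℕ} (hp : ∀ e, (d + 1) * G.r e ≤ p) (e : E) :
    ∃ C : ℝ, 0 ≤ C ∧ ∀ {N : ℕ} (K : Kernel d N N), K.HasOrder (G.a e) →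
      ∀ (z : V → SpaceTime d N) (cl : Clustering G.origin (configDist z)),
      (∀ u v, u ≠ v → z u ≠ z v) → (∀ u v, configDist z u v ≤ 2 * Fintype.card V) →
      |K.recentred (G.r e) (z (G.src e)) (z (G.tgt e)) (z (G.base e))| ≤
        C * K.norm (G.a e) p * G.edgeFactor cl N e := by
  rcases Nat.eq_zero_or_pos (G.r e) with hr | hr
  · obtain ⟨C, hC, h⟩ := G.abs_toFun_le_edgeFactor (d := d) e hr p
    refine ⟨C, hC, fun K hK z cl hz hR => ?_⟩
    rw [hr, K.recentred_zero]
    exact h K rfl hK z cl hz hR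
  · obtain ⟨C, hC, h⟩ := G.abs_recentred_le_edgeFactor e hr (hsing e hr) (hbase e hr) (hp e)
    exact ⟨C, hC, fun K hK z cl hz hR => (h K rfl hK z cl hz hR).1⟩

/-- The bound on the sum of the localised kernels of an edge. -/
theorem exists_sum_abs_localKernel_le_edgeFactor (G : LabelledGraph V E M)
    (hbase : ∀ e, 0 < G.r e → G.base e ≠ G.src e) (hsing : ∀ e, 0 < G.r e → 0 ≤ G.a e)
    {p : ℕ} (hp : ∀ e, (d + 1) * G.r e ≤ p) (e : E) :
    ∃ C : ℝ, 0 ≤ C ∧ ∀ {N : ℕ} {mu : ℝ} {ψ : ℝ → ℝ}, IsDyadicCutoff ψ →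
      ∀ K : Kernel d N (G.level N mu e), K.HasOrder (G.a e) →
      ∀ (z : V → SpaceTime d N) (cl : Clustering G.origin (configDist z)),
      (∀ u v, u ≠ v → z u ≠ z v) → (∀ u v, configDist z u v ≤ 2 * Fintype.card V) →
      ∑ m ∈ G.edgeScales N mu e,
          |G.localKernel ψ e K m (z (G.src e)) (z (G.tgt e)) (z (G.base e))| ≤
        C * K.norm (G.a e) p * G.edgeFactor cl N e := by
  by_cases he : e ∈ Finset.univ.image G.starEdge ∨ G.r e = 0
  · have hr : G.r e = 0 := by
      rcases he with h | h
      · obtain ⟨i, -, rfl⟩ := Finset.mem_image.1 h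
        exact G.starEdge_r i
      · exact h
    obtain ⟨C, hC, h⟩ := G.sum_abs_scale_le_edgeFactor (d := d) e hr p
    refine ⟨C, hC, fun {N mu ψ} hψ K hK z cl hz hR => ?_⟩
    refine (G.sum_abs_localKernel_le_scale hψ e he K _ _ _).trans (h K ?_ hK z cl hR)
    by_cases hs : e ∈ Finset.univ.image G.starEdge
    · obtain ⟨i, -, rfl⟩ := Finset.mem_image.1 hs
      exact Or.inr (G.starEdge_a i)
    · exact Or.inl (if_neg hs)
  · push Not at he
    have hr := Nat.pos_of_ne_zero he.2
    obtain ⟨C, hC, h⟩ := G.abs_recentred_le_edgeFactor e hr (hsing e hr) (hbase e hr) (hp e)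
    refine ⟨C + C, by positivity, fun {N mu ψ} hψ K hK z cl hz hR => ?_⟩
    have hnm := hK.norm_nonneg p
    have hf := G.edgeFactor_nonneg cl N e
    obtain ⟨h1, h2⟩ := h K (if_neg he.1) hK z cl hz hR
    refine (G.sum_abs_localKernel_le_recentred hψ e he.1 hr K _ _ _).trans ?_
    rw [add_mul, add_mul]
    refine add_le_add h1 ?_
    split_ifs with h3
    · exact h2 h3
    · positivity

/-- The bound on the generalised convolution. -/
theorem exists_genConv_le (G : LabelledGraph V E M) (hG : G.PowerCounting d)
    (hbase : ∀ e, 0 < G.r e → G.base e ≠ G.src e) (hsing : ∀ e, 0 < G.r e → 0 ≤ G.a e)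
    {p : ℕ} (hp : ∀ e, (d + 1) * G.r e ≤ p) {ρ : ℝ} (hρ : 0 < ρ) :
    ∃ C : ℝ, 0 < C ∧
        ∀ (N : ℕ) (K : E → Kernel d N N), (∀ e, (K e).HasOrder (G.a e)) →
        ∀ (φ : (Fin (d + 1) → ℝ) → ℝ) (B : ℝ), Continuous φ →
          (∀ z, φ z ≠ 0 → scaledNorm z ≤ ρ) → (∀ z, |φ z| ≤ B) →
        ∀ lam mu : ℝ, 0 < mu →
          ((2 : ℝ) ^ (-(N : ℝ)) ≤ lam ∧ lam = mu ∧ lam ≤ 1) ∨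
            (mu < (2 : ℝ) ^ (-(N : ℝ)) ∧ lam = (2 : ℝ) ^ (-(N : ℝ))) →
          G.IntegrableConfig (G.integrand K φ lam mu) ∧
          |G.genConv K φ lam mu| ≤
            C * lam ^ G.alphaTilde d * B ^ M * ∏ e, (K e).norm (G.a e) p := by
  choose c hc hbd using G.exists_recentred_le_edgeFactor (d := d) hbase hsing hp
  obtain ⟨C, hC, hmain⟩ := G.lintegralConfig_prod_le (d := d) hG hbase (le_max_right ρ 1)
  have hPc : 0 ≤ ∏ e, c e := Finset.prod_nonneg fun e _ => hc e
  refine ⟨(∏ e, c e + 1) * C, by positivity, ?_⟩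
  intro N K hK φ B hφ hsupp hB lam mu hmu hcase
  have hlam : 0 < lam := by
    rcases hcase with h | h
    · rw [h.2.1]; exact hmu
    · rw [h.2]; positivity
  have hB0 : 0 ≤ B := (abs_nonneg _).trans (hB 0)
  have hnm : ∀ e, 0 ≤ (K e).norm (G.a e) p := fun e => (hK e).norm_nonneg p
  have hPn : 0 ≤ ∏ e, (K e).norm (G.a e) p := Finset.prod_nonneg fun e _ => hnm e
  set κ : ℝ := (lam ^ d)⁻¹ * (mu ^ 2)⁻¹ * B with hκ
  have hκ0 : 0 ≤ κ := by positivity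
  let W : E → (V → SpaceTime d N) → ℝ := fun e z =>
    |(K e).recentred (G.r e) (z (G.src e)) (z (G.tgt e)) (z (G.base e))|
  have h1 := hmain N lam mu hmu hcase W (fun e => c e * (K e).norm (G.a e) p)
    (fun e z => abs_nonneg _) (fun e => mul_nonneg (hc e) (hnm e))
    (fun e z h => (K e).recentred_support (abs_ne_zero.1 h))
    (fun z hz cl hR e => hbd e (K e) (hK e) z cl hz hR)
  set F' : (V → SpaceTime d N) → ℝ := fun z =>
    κ ^ M * ((∏ e, W e z) * ∏ i, boxInd (max ρ 1) lam mu (z (G.star i))) with hF'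
  set X : ℝ := (∏ e, c e * (K e).norm (G.a e) p) * (C * lam ^ G.alpha d * timeRatio N mu ^ M *
          (2 ^ (d * N)) ^ Fintype.card {v // v ≠ G.origin}) with hX
  have hX0 : 0 ≤ X := by
    have := timeRatio_nonneg N mu
    have h2 : 0 ≤ ∏ e, c e * (K e).norm (G.a e) p :=
      Finset.prod_nonneg fun e _ => mul_nonneg (hc e) (hnm e)
    positivity
  have h2 : G.lintegralConfig F' ≤ ENNReal.ofReal (κ ^ M * X) := by
    rw [hF', G.lintegralConfig_const_mul (by positivity), ENNReal.ofReal_mul (by positivity)]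
    gcongr
  have hle : ∀ z, |G.integrand K φ lam mu z| ≤ F' z := by
    intro z
    rw [integrand, abs_mul, Finset.abs_prod, Finset.abs_prod, hF']
    have h3 : ∏ i, |rescaled φ lam mu (z (G.star i))| ≤
        κ ^ M * ∏ i, boxInd (max ρ 1) lam mu (z (G.star i)) := by
      calc _ ≤ ∏ i, (κ * boxInd (max ρ 1) lam mu (z (G.star i))) :=
            Finset.prod_le_prod (fun _ _ => abs_nonneg _) fun i _ =>
              abs_rescaled_le hρ.le hlam hmu hsupp hB _
        _ = _ := by
            rw [Finset.prod_mul_distrib, Finset.prod_const, Finset.card_univ, Fintype.card_fin]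
    have h4 : 0 ≤ ∏ e, W e z := Finset.prod_nonneg fun _ _ => abs_nonneg _
    calc _ ≤ (∏ e, W e z) * (κ ^ M * ∏ i, boxInd (max ρ 1) lam mu (z (G.star i))) :=
          mul_le_mul_of_nonneg_left h3 h4
      _ = _ := by ring
  have hmeas := G.measurable_integrand (N := N) K hφ lam mu
  refine ⟨G.integrableConfig_of_lintegralConfig hmeas (fun z _ => hle z) (h2.trans_lt ENNReal.ofReal_lt_top), ?_⟩
  have h5 := G.sum_abs_integralConfig_le {()} (F := fun _ => G.integrand K φ lam mu)
    (fun _ _ => hmeas) (fun z _ => by simpa using hle z) (by positivity) h2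
  rw [Finset.sum_singleton] at h5
  refine (show |G.genConv K φ lam mu| ≤ _ from h5).trans ?_
  -- The prefactors of the test functions and the gain from confinement combine to λ^{-|𝔰|M}.
  have hexp : ((lam ^ d)⁻¹ * (mu ^ 2)⁻¹ * timeRatio N mu) ^ M * lam ^ G.alpha d =
      lam ^ G.alphaTilde d := by
    rw [rescaling_mul_timeRatio hmu hcase, G.alphaTilde_eq, Real.rpow_sub hlam, inv_pow,
      ← pow_mul, ← Nat.cast_mul, Real.rpow_natCast]
    field_simp
  have hcancel : (((2 : ℝ) ^ (d * N))⁻¹) ^ Fintype.card {v // v ≠ G.origin} *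
      (2 ^ (d * N)) ^ Fintype.card {v // v ≠ G.origin} = 1 := by
    rw [← mul_pow, inv_mul_cancel₀ (by positivity), one_pow]
  calc _ = ((((2 : ℝ) ^ (d * N))⁻¹) ^ Fintype.card {v // v ≠ G.origin} *
        (2 ^ (d * N)) ^ Fintype.card {v // v ≠ G.origin}) *
        (((lam ^ d)⁻¹ * (mu ^ 2)⁻¹ * timeRatio N mu) ^ M * lam ^ G.alpha d) *
        ((∏ e, c e) * C * B ^ M * ∏ e, (K e).norm (G.a e) p) := by
        rw [hX, hκ, Finset.prod_mul_distrib]; ring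
    _ = (∏ e, c e) * (C * lam ^ G.alphaTilde d * B ^ M * ∏ e, (K e).norm (G.a e) p) := by
        rw [hcancel, hexp]; ring
    _ ≤ (∏ e, c e + 1) * (C * lam ^ G.alphaTilde d * B ^ M * ∏ e, (K e).norm (G.a e) p) := by
        gcongr; linarith
    _ = _ := by ring

/-- The bound on the multiscale sum. -/
theorem exists_multiscale_le (G : LabelledGraph V E M) (hG : G.PowerCounting d)
    (hbase : ∀ e, 0 < G.r e → G.base e ≠ G.src e) (hsing : ∀ e, 0 < G.r e → 0 ≤ G.a e)
    {p : ℕ} (hp : ∀ e, (d + 1) * G.r e ≤ p) :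
    ∃ C : ℝ, 0 < C ∧
        ∀ (N : ℕ) (ψ : ℝ → ℝ), IsDyadicCutoff ψ →
        ∀ lam mu : ℝ, 0 < mu →
        ∀ K : (e : E) → Kernel d N (G.level N mu e), (∀ e, (K e).HasOrder (G.a e)) →
          ((2 : ℝ) ^ (-(N : ℝ)) ≤ lam ∧ lam = mu ∧ lam ≤ 1) ∨
            (mu < (2 : ℝ) ^ (-(N : ℝ)) ∧ lam = (2 : ℝ) ^ (-(N : ℝ))) →
          (∀ n ∈ G.scaleAssignments N mu, G.IntegrableConfig (G.scaleIntegrand ψ K n)) ∧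
          |G.multiscale ψ K| ≤ C * lam ^ G.alpha d * timeRatio N mu ^ M *
              ∏ e, (K e).norm (G.a e) p := by
  choose c hc hbd using G.exists_sum_abs_localKernel_le_edgeFactor (d := d) hbase hsing hp
  obtain ⟨C, hC, hmain⟩ := G.lintegralConfig_prod_le (d := d) hG hbase (le_refl 1)
  have hPc : 0 ≤ ∏ e, c e := Finset.prod_nonneg fun e _ => hc e
  refine ⟨(∏ e, c e + 1) * C, by positivity, ?_⟩
  intro N ψ hψ lam mu hmu K hK hcase
  have hmulam : mu ≤ lam := by
    rcases hcase with h | h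
    · exact h.2.1.ge
    · exact h.1.le.trans h.2.ge
  have hlam : 0 < lam := hmu.trans_le hmulam
  have hnm : ∀ e, 0 ≤ (K e).norm (G.a e) p := fun e => (hK e).norm_nonneg p
  have hPn : 0 ≤ ∏ e, (K e).norm (G.a e) p := Finset.prod_nonneg fun e _ => hnm e
  have htr := timeRatio_nonneg N mu
  -- The scales are summed inside the modulus for each edge separately, so that the bound does not
  -- grow with the number of assignments.
  let W : E → (V → SpaceTime d N) → ℝ := fun e z => ∑ m ∈ G.edgeScales N mu e,
    |G.localKernel ψ e (K e) m (z (G.src e)) (z (G.tgt e)) (z (G.base e))|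
  have hW0 : ∀ e z, 0 ≤ W e z := fun e z => Finset.sum_nonneg fun m _ => abs_nonneg _
  have hWne : ∀ e z, W e z ≠ 0 → ∃ m ∈ G.edgeScales N mu e,
      G.localKernel ψ e (K e) m (z (G.src e)) (z (G.tgt e)) (z (G.base e)) ≠ 0 := by
    intro e z h
    obtain ⟨m, hm, h'⟩ := Finset.exists_ne_zero_of_sum_ne_zero h
    exact ⟨m, hm, abs_ne_zero.1 h'⟩
  have h1 := hmain N lam mu hmu hcase W (fun e => c e * (K e).norm (G.a e) p)
    hW0 (fun e => mul_nonneg (hc e) (hnm e))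
    (fun e z h => by
      obtain ⟨m, -, h'⟩ := hWne e z h
      exact G.localKernel_support ψ e (K e) m h')
    (fun z hz cl hR e => hbd e hψ (K e) (hK e) z cl hz hR)
  set F' : (V → SpaceTime d N) → ℝ := fun z =>
    (∏ e, W e z) * ∏ i, boxInd 1 lam mu (z (G.star i)) with hF'
  set X : ℝ := (∏ e, c e * (K e).norm (G.a e) p) * (C * lam ^ G.alpha d * timeRatio N mu ^ M *
          (2 ^ (d * N)) ^ Fintype.card {v // v ≠ G.origin}) with hX
  have hX0 : 0 ≤ X := by
    have h2 : 0 ≤ ∏ e, c e * (K e).norm (G.a e) p :=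
      Finset.prod_nonneg fun e _ => mul_nonneg (hc e) (hnm e)
    positivity
  have hle : ∀ z, z G.origin = 0 →
      ∑ n ∈ G.scaleAssignments N mu, |G.scaleIntegrand ψ K n z| ≤ F' z := by
    intro z hz
    have h2 : ∑ n ∈ G.scaleAssignments N mu, |G.scaleIntegrand ψ K n z| ≤ ∏ e, W e z := by
      simp only [W]
      rw [Finset.prod_univ_sum]
      refine (Finset.sum_le_sum_of_subset_of_nonneg (G.scaleAssignments_subset N mu)
        fun _ _ _ => abs_nonneg _).trans (le_of_eq ?_)
      exact Finset.sum_congr rfl fun n _ => by rw [scaleIntegrand, Finset.abs_prod]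
    refine h2.trans ?_
    by_cases h0 : ∏ e, W e z = 0
    · rw [hF']; simp only; rw [h0, zero_mul]
    -- The cutoffs on the distinguished edges replace the test functions: they confine the
    -- distinguished vertices to the ball of radius μ, hence to the box with ρ = 1.
    · have h3 : ∏ i, boxInd 1 lam mu (z (G.star i)) = 1 := by
        refine Finset.prod_eq_one fun i _ => ?_
        obtain ⟨m, hm, h4⟩ := hWne (G.starEdge i) z
          (Finset.prod_ne_zero_iff.1 h0 _ (Finset.mem_univ _))
        have h5 := G.stDist_le_of_localKernel_star hψ
          (Finset.mem_image_of_mem _ (Finset.mem_univ i)) (K _) hm h4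
        rw [G.starEdge_src, G.starEdge_tgt, hz] at h5
        exact boxInd_one_of_stDist_le hmulam hmu.le h5
      rw [hF']; simp only; rw [h3, mul_one]
  have hmeas := fun n => G.measurable_scaleIntegrand hψ K n
  refine ⟨fun n hn => G.integrableConfig_of_lintegralConfig (hmeas n) (fun z hz =>
    (Finset.single_le_sum (f := fun n => |G.scaleIntegrand ψ K n z|)
      (fun _ _ => abs_nonneg _) hn).trans (hle z hz)) (h1.trans_lt ENNReal.ofReal_lt_top), ?_⟩
  have h5 := G.sum_abs_integralConfig_le (G.scaleAssignments N mu) (fun n _ => hmeas n) hle hX0 h1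
  refine (Finset.abs_sum_le_sum_abs _ _).trans (h5.trans ?_)
  have hcancel : (((2 : ℝ) ^ (d * N))⁻¹) ^ Fintype.card {v // v ≠ G.origin} *
      (2 ^ (d * N)) ^ Fintype.card {v // v ≠ G.origin} = 1 := by
    rw [← mul_pow, inv_mul_cancel₀ (by positivity), one_pow]
  calc _ = ((((2 : ℝ) ^ (d * N))⁻¹) ^ Fintype.card {v // v ≠ G.origin} *
        (2 ^ (d * N)) ^ Fintype.card {v // v ≠ G.origin}) *
        ((∏ e, c e) * (C * lam ^ G.alpha d * timeRatio N mu ^ M *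
          ∏ e, (K e).norm (G.a e) p)) := by
        rw [hX, Finset.prod_mul_distrib]; ring
    _ = (∏ e, c e) * (C * lam ^ G.alpha d * timeRatio N mu ^ M *
          ∏ e, (K e).norm (G.a e) p) := by rw [hcancel, one_mul]
    _ ≤ (∏ e, c e + 1) * (C * lam ^ G.alpha d * timeRatio N mu ^ M *
          ∏ e, (K e).norm (G.a e) p) := by
        gcongr; linarith
    _ = _ := by ring

end LabelledGraph
end GenConv
end

/-- The sup norm of φ enters through an arbitrary bound B on |φ|. -/
theorem mainTheorem2 {V E : Type*} [Fintype V] [DecidableEq V] [Fintype E] [DecidableEq E]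
    {M : ℕ} (hM : 0 < M) (d : ℕ) (G : GenConv.LabelledGraph V E M)
    (hG : G.PowerCounting d)
    (hbase : ∀ e, 0 < G.r e → G.base e ≠ G.src e)
    (hsing : ∀ e, 0 < G.r e → 0 ≤ G.a e) :
    ∃ p : ℕ,
      (∀ ρ : ℝ, 0 < ρ → ∃ C : ℝ, 0 < C ∧
        ∀ (N : ℕ) (K : E → GenConv.Kernel d N N), (∀ e, (K e).HasOrder (G.a e)) →
        ∀ (φ : (Fin (d + 1) → ℝ) → ℝ) (B : ℝ), ContDiff ℝ (⊤ : ℕ∞) φ →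
          (∀ z, φ z ≠ 0 → GenConv.scaledNorm z ≤ ρ) → (∀ z, |φ z| ≤ B) →
        ∀ lam mu : ℝ, 0 < mu →
          ((2 : ℝ) ^ (-(N : ℝ)) ≤ lam ∧ lam = mu ∧ lam ≤ 1) ∨
            (mu < (2 : ℝ) ^ (-(N : ℝ)) ∧ lam = (2 : ℝ) ^ (-(N : ℝ))) →
          G.IntegrableConfig (G.integrand K φ lam mu) ∧
          |G.genConv K φ lam mu| ≤
            C * lam ^ G.alphaTilde d * B ^ M * ∏ e, (K e).norm (G.a e) p) ∧
      (∃ C : ℝ, 0 < C ∧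
        ∀ (N : ℕ) (ψ : ℝ → ℝ), GenConv.LabelledGraph.IsDyadicCutoff ψ →
        ∀ lam mu : ℝ, 0 < mu →
        ∀ K : (e : E) → GenConv.Kernel d N (G.level N mu e), (∀ e, (K e).HasOrder (G.a e)) →
          ((2 : ℝ) ^ (-(N : ℝ)) ≤ lam ∧ lam = mu ∧ lam ≤ 1) ∨
            (mu < (2 : ℝ) ^ (-(N : ℝ)) ∧ lam = (2 : ℝ) ^ (-(N : ℝ))) →
          (∀ n ∈ G.scaleAssignments N mu, G.IntegrableConfig (G.scaleIntegrand ψ K n)) ∧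
          (mu < (2 : ℝ) ^ (-(N : ℝ)) → |G.multiscale ψ K| ≤
            C * lam ^ G.alpha d * (mu ^ 2 * (2 : ℝ) ^ (2 * N)) ^ M *
              ∏ e, (K e).norm (G.a e) p) ∧
          (lam = mu → |G.multiscale ψ K| ≤
            C * lam ^ G.alpha d * ∏ e, (K e).norm (G.a e) p)) := by
  -- The Taylor expansion at an edge uses derivatives with at most r_e in each of the d + 1
  -- coordinates.
  have hp : ∀ e, (d + 1) * G.r e ≤ (d + 1) * ∑ e, G.r e := fun e =>
    Nat.mul_le_mul_left _ (Finset.single_le_sum (f := G.r) (fun _ _ => Nat.zero_le _)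
      (Finset.mem_univ e))
  refine ⟨(d + 1) * ∑ e, G.r e, fun ρ hρ => ?_, ?_⟩
  · obtain ⟨C, hC, h⟩ := G.exists_genConv_le hG hbase hsing hp hρ
    exact ⟨C, hC, fun N K hK φ B hφ => h N K hK φ B hφ.continuous⟩
  · obtain ⟨C, hC, h⟩ := G.exists_multiscale_le hG hbase hsing hp
    refine ⟨C, hC, fun N ψ hψ lam mu hmu K hK hcase => ?_⟩
    obtain ⟨h1, h2⟩ := h N ψ hψ lam mu hmu K hK hcase
    refine ⟨h1, fun hlt => ?_, fun heq => ?_⟩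
    · rwa [GenConv.timeRatio, if_pos hlt] at h2
    · have hge : ¬ mu < (2 : ℝ) ^ (-(N : ℝ)) := by
        rcases hcase with h | h
        · rw [← heq]; exact not_lt.2 h.1
        · rw [← heq, h.2]; exact lt_irrefl _
      rwa [GenConv.timeRatio, if_neg hge, one_pow, mul_one] at h2
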